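/- **Setting.** Let $a=x+\tfrac12\frac{d}{dx}$, $a^\dagger=x-\tfrac12\frac{d}{dx}$ on $L^2(\mathbb R)$ (so $[a,a^\dagger]=1$), $X_\phi=\tfrac12(a^\dagger e^{i\phi}+ae^{-i\phi})$ with generalized eigenvectors $|y\rangle_\phi$, and $D(z)=e^{za^\dagger-\bar z a}$, so that $e^{ikX_\phi}=D(\tfrac i2ke^{i\phi})$. A Hilbert–Schmidt operator $A$ is identified with its integral kernel, i.e. with the vector $|A\rangle\!\rangle\in L^2(\mathbb R)\otimes L^2(\mathbb R)$ of two modes $a,b$, with $\langle\!\langle A|B\rangle\!\rangle=\mathrm{Tr}[A^\dagger B]$. Test operators are those with Schwartz kernel. Put $\mathcal F[m](x)=\int\frac{dk}{2\pi}e^{ikx}m(k)$. For a tempered distribution $h$ (a function, or for instance $\delta$) let $h(X_\phi-x)=\int dy\,h(y-x)\,|y\rangle_\phi{}_\phi\langle y|$, a generalized operator that is paired with test operators; $\delta(X_\phi-x)=|x\rangle_\phi{}_\phi\langle x|$. The quadrature densities $y\mapsto\mathrm{Tr}[A|y\rangle_\phi{}_\phi\langle y|]$ of test operators are Schwartz functions,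 with Fourier transform $\int dy\,e^{-iky}\,\mathrm{Tr}[A|y\rangle_\phi{}_\phi\langle y|]=\mathrm{Tr}[(e^{ikX_\phi})^\dagger A]$. Let $T_h$ be the operator $A\mapsto\big((\phi,x)\mapsto\langle\!\langle h(X_\phi-x)|A\rangle\!\rangle\big)$ from test operators to functions on $[0,\pi)\times\mathbb R$ with the measure $\frac{d\phi}{\pi}dx$, and let $F=T_h^*\overline{T_h}=\int_0^\pi\frac{d\phi}\pi\int dx\,|h(X_\phi-x)\rangle\!\rangle\langle\!\langle h(X_\phi-x)|$ be the frame operator. The $h(X_\phi-x)$ form a *frame* if $T_h$ maps all test operators to square integrable functions and is closable, and $F$ is well defined, densely defined and injective with dense range (so $F^{-1}$ is a densely defined, in general unbounded, operator). **Claims.** 1. The map $A\mapsto\mathrm{Tr}[D(z)^\dagger A]$ on test operators extends to a unitary map from the Hilbert–Schmidt operators onto $L^2(\mathbb C,d^2z/\pi)$, which carries the closure of $a-b^\dagger$ to multiplication by $z$. Hence $f(|a-b^\dagger|)$ is multiplication by $f(|z|)$ in this representation. 2. On test operators $A$, $(a-b^\dagger)|A\rangle\!\rangle=|[a,A]\rangle\!\rangle$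 and $$|a-b^\dagger|^2|A\rangle\!\rangle=(a^\dagger-b)(a-b^\dagger)|A\rangle\!\rangle=|[a^\dagger,[a,A]]\rangle\!\rangle,\qquad [a^\dagger,[a,A]]=-(L[a]+L[a^\dagger])A,$$ with $L[V]A=V^\dagger AV-\tfrac12(V^\dagger VA+AV^\dagger V)$. Moreover $[a^\dagger,[a,e^{ikX_\phi}]]=\tfrac14k^2e^{ikX_\phi}$. 3. Suppose that $H=\mathcal F^{-1}[h]$ is a (measurable, essentially) bounded function (so $h=\mathcal F[H]$; for integrable $h$, $H(k)=\int dx\,e^{-ikx}h(x)$). If $H$ is invertible, i.e. $H\ne0$ almost everywhere, then the $h(X_\phi-x)$ form a frame. If $h'$ also has bounded $H'=\mathcal F^{-1}[h']$ and $|H|=|H'|$ almost everywhere, then $h$ and $h'$ have the same frame operator (whether or not $H$, $H'$ are invertible). 4. If $H$ is bounded and $|H|$ is even almost everywhere (as for real $h$), then $$F=f(|a-b^\dagger|),\qquad f(t)=\frac{1}{\pi t}\,|\mathcal F^{-1}[h](2t)|^2 ,$$ including equality of domains. Equivalently, for $h=\sqrt\pi\,\mathcal F[g(\tfrac12|\cdot|)]$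 with bounded $g$, $F=f(|a-b^\dagger|)$ with $|t|f(|t|)=|g(|t|)|^2$. 5. Let $H$ be bounded and nonzero almost everywhere, with $|H|$ even almost everywhere. Then, as generalized operators, $$F^{-1}\big||x\rangle_\phi{}_\phi\langle x|\big\rangle\!\big\rangle=|h^\vee(x-X_\phi)\rangle\!\rangle,\qquad h^\vee=\mathcal F\Big[\frac1{f(|k|/2)}\Big],$$ and the canonical dual of the frame is $$F^{-1}|h(X_\phi-x)\rangle\!\rangle=|\tilde h(X_\phi-x)\rangle\!\rangle,\qquad \tilde h=\mathcal F\Big[\frac{H(k)}{f(|k|/2)}\Big].$$ That is, for a test operator $A$ in the range of $F$, the coefficients of $F^{-1}A$ for $|x\rangle_\phi{}_\phi\langle x|$ and for $h(X_\phi-x)$ (given by the closures of $T_\delta$, $T_h$) are, for almost all $(\phi,x)$, the coefficients of $A$ for $h^\vee(x-X_\phi)$ and $\tilde h(X_\phi-x)$, provided $F^{-1}A$ is in the domain of the closure of $T_\delta$ (respectively $T_h$) and the integrals over $k$ that define the latter converge absolutely for almost all $\phi$. For such $A$ (in the case of $\tilde h$) and every test operator $B$, $\langle\!\langle B|A\rangle\!\rangle=\int_0^\pi\frac{d\phi}{\pi}\int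 dx\,\langle\!\langle B|h(X_\phi-x)\rangle\!\rangle\langle\!\langle\tilde h(X_\phi-x)|A\rangle\!\rangle$, with an integrable integrand. If $1/H$ is locally (essentially) bounded, the test operators $A$ to which both identities apply are dense in the Hilbert–Schmidt operators. 6. (Gaussian example.) For $\sigma>0$ and $g(t)=\sqrt{\tfrac{\sigma^2}{2\pi}}\,e^{-\sigma^2t^2/2}$ one has $h(y)=\sqrt\pi\,\mathcal F[g(\tfrac12\,\cdot)](y)=\tfrac1{\sqrt\pi}e^{-2y^2/\sigma^2}$. Its inverse Fourier transform is $k\mapsto\sqrt\pi\,g(k/2)$, the $h(X_\phi-x)$ form a frame, and its frame operator is $f(|a-b^\dagger|)$ with $f(t)=\frac{\sigma^2}{2\pi t}e^{-\sigma^2t^2}$. -/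

import Mathlib

open MeasureTheory SchwartzMap
open scoped ComplexConjugate ENNReal

noncomputable section

namespace HomodyneFrames

/-! ### One mode: the harmonic oscillator on `L²(ℝ)`

The wave function is written in the spectral representation of the quadrature `X_0 = (a† + a)/2`, so
that `[X_0, Y] = i/2` for the conjugate quadrature `Y = -(i/2) d/dx`, and `a = X_0 + i Y`. -/

/-- Operators act on (smooth) wave functions. -/
abbrev WaveOp := (ℝ → ℂ) → (ℝ → ℂ)

/-- The annihilation operator `a = x + (1/2) d/dx`. -/
def annih : WaveOp := fun u x => x * u x + deriv u x / 2

/-- The creation operator `a† = x - (1/2) d/dx`. -/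
def creat : WaveOp := fun u x => x * u x - deriv u x / 2

/-- The quadrature `X_φ = (a† e^{iφ} + a e^{-iφ}) / 2`. -/
def quadrature (φ : ℝ) : WaveOp := fun u x =>
  (Complex.exp (Complex.I * φ) * creat u x + Complex.exp (-(Complex.I * φ)) * annih u x) / 2

/-- The displacement operator `D(z) = exp(z a† - z̄ a)`. With `z = q + i p` its exponent is
`2 i p x - q d/dx`, so that `(D(z) u)(x) = e^{2ipx - ipq} u(x - q)`. -/
def displace (z : ℂ) : WaveOp := fun u x =>
  Complex.exp (Complex.I * ((2 * z.im * x - z.re * z.im : ℝ) : ℂ)) * u (x - z.re)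

/-- `exp(i k X_φ) = D(i k e^{iφ} / 2)`. -/
def quadratureExp (k φ : ℝ) : WaveOp :=
  displace (Complex.I * k * Complex.exp (Complex.I * φ) / 2)

/-- The commutator `[S, T]`. -/
def opComm (S T : WaveOp) : WaveOp := fun u x => S (T u) x - T (S u) x

/-- The (dual) Lindblad super-operator `L[V] A = V† A V - (V† V A + A V† V)/2`; the argument `Vd`
is the adjoint of `V`. -/
def lindblad (V Vd A : WaveOp) : WaveOp := fun u x =>
  Vd (A (V u)) x - (Vd (V (A u)) x + A (Vd (V u)) x) / 2

/-- The generalized eigenfunction `x ↦ ⟨x|y⟩_φ` of `X_φ` at the eigenvalue `y`, for `sin φ ≠ 0`,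
normalized to a Dirac delta in `y`. -/
def quadratureKet (φ y : ℝ) : ℝ → ℂ := fun x =>
  ((1 / √(Real.pi * |Real.sin φ|) : ℝ) : ℂ) *
    Complex.exp (Complex.I * (((2 * x * y - Real.cos φ * x ^ 2) / Real.sin φ : ℝ) : ℂ))

/-- The eigenvalue equation of the generalized eigenfunctions. -/
theorem quadrature_quadratureKet (φ y x : ℝ) (hφ : Real.sin φ ≠ 0) :
    quadrature φ (quadratureKet φ y) x = y * quadratureKet φ y x := by
  have hs : (Complex.sin φ) ≠ 0 := by
    rw [← Complex.ofReal_sin]; exact_mod_cast hφ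
  have h1 : HasDerivAt (fun x : ℝ => (2 * x * y - Real.cos φ * x ^ 2) / Real.sin φ)
      ((2 * y - Real.cos φ * (2 * x)) / Real.sin φ) x := by
    have ha : HasDerivAt (fun x : ℝ => 2 * x * y) (2 * y) x := by
      simpa using ((hasDerivAt_id x).const_mul 2).mul_const y
    have hb : HasDerivAt (fun x : ℝ => Real.cos φ * x ^ 2) (Real.cos φ * (2 * x)) x := by
      simpa using (hasDerivAt_pow 2 x).const_mul (Real.cos φ)
    exact (ha.sub hb).div_const _
  have h2 : HasDerivAt (quadratureKet φ y)
      (quadratureKet φ y x * (Complex.I *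
        (((2 * y - Real.cos φ * (2 * x)) / Real.sin φ : ℝ) : ℂ))) x := by
    have h3 := ((h1.ofReal_comp.const_mul Complex.I).cexp).const_mul
      ((1 / √(Real.pi * |Real.sin φ|) : ℝ) : ℂ)
    exact h3.congr_deriv (mul_assoc _ _ _).symm
  simp only [quadrature, creat, annih, h2.deriv]
  have he1 : Complex.exp (Complex.I * φ) = Complex.cos φ + Complex.sin φ * Complex.I := by
    rw [mul_comm, Complex.exp_mul_I]
  have he2 : Complex.exp (-(Complex.I * φ)) = Complex.cos φ - Complex.sin φ * Complex.I := by
    rw [show -(Complex.I * (φ : ℂ)) = (-φ : ℂ) * Complex.I by ring, Complex.exp_mul_I,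
      Complex.cos_neg, Complex.sin_neg]
    ring
  rw [he1, he2]
  push_cast
  field_simp
  linear_combination (2 * Complex.cos φ * x - 2 * y) * Complex.sin φ * quadratureKet φ y x *
    Complex.I_sq

/-! ### Two modes: Hilbert-Schmidt operators as vectors -/

/-- The space of Hilbert-Schmidt operators on `L²(ℝ)`. A Hilbert-Schmidt operator is its integral
kernel; as the Fock basis consists of real functions, the kernel of `A` is also the bipartite vector
`|A⟫ = ∑ A_{nm} |n⟩ ⊗ |m⟩` of the modes `a` (first variable) and `b` (second variable), and the
inner product is `⟪A|B⟫ = Tr[A† B]`. -/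
abbrev HS := Lp ℂ 2 (volume : Measure (ℝ × ℝ))

/-- Test operators: those with a Schwartz integral kernel. -/
abbrev TestOp := 𝓢(ℝ × ℝ, ℂ)

/-- A test operator as a Hilbert-Schmidt operator. -/
def toHS (K : TestOp) : HS := K.toLp 2 volume

/-- The integral operator with kernel `K`. -/
def kernelOp (K : ℝ × ℝ → ℂ) : WaveOp := fun u x => ∫ y, K (x, y) * u y

/-- `a - b†`, where `a` acts on the first and `b†` on the second variable. -/
def modeZ (K : ℝ × ℝ → ℂ) : ℝ × ℝ → ℂ := fun p =>
  annih (fun s => K (s, p.2)) p.1 - creat (fun t => K (p.1, t)) p.2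

/-- `(a - b†)† = a† - b`. -/
def modeZdag (K : ℝ × ℝ → ℂ) : ℝ × ℝ → ℂ := fun p =>
  creat (fun s => K (s, p.2)) p.1 - annih (fun t => K (p.1, t)) p.2

/-- The graph of `a - b†` on test operators. -/
def modeZGraph : Set (HS × HS) :=
  {P | ∃ K : TestOp, P.1 = toHS K ∧ ⇑P.2 =ᵐ[volume] modeZ K}

/-- The measure `d²z / π` on the complex plane. -/
def planeMeasure : Measure ℂ := ENNReal.ofReal (1 / Real.pi) • volume

/-- `Tr[D(z)† A] = ⟪D(z)|A⟫` for the operator with kernel `K`: here `D(z)† = D(-z)`, and the trace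
is the integral of the kernel over the diagonal. -/
def charFn (K : ℝ × ℝ → ℂ) (z : ℂ) : ℂ := ∫ x, displace (-z) (fun s => K (s, x)) x

/-- `W` is a spectral representation of the closure of the operator with graph `G`: it carries this
closure to the multiplication by `z` with its maximal domain. -/
def IsSpectralRep (G : Set (HS × HS)) (μ : Measure ℂ) (W : HS ≃ₗᵢ[ℂ] Lp ℂ 2 μ) : Prop :=
  ∀ A C : HS, (A, C) ∈ closure G ↔ ∀ᵐ z ∂μ, W C z = z * W A z

/-- The functional calculus in the spectral representation `W` of an operator `Z`: this says that `A`
is in the domain of `g(Z)`, and `C = g(Z) A`. -/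
def IsFunctionOf {μ : Measure ℂ} (W : HS ≃ₗᵢ[ℂ] Lp ℂ 2 μ) (g : ℂ → ℂ) (A C : HS) : Prop :=
  ∀ᵐ z ∂μ, W C z = g z * W A z

/-! ### Functions of the quadratures as generalized operators -/

/-- The (complex) probability density `y ↦ Tr[A |y⟩_φ⟨y|]` of the quadrature `X_φ`, for the operator
`A` with kernel `K`. If `sin φ = 0` then `X_φ = (cos φ) x` with `cos φ = ±1`. -/
def quadratureDensity (φ : ℝ) (K : ℝ × ℝ → ℂ) (y : ℝ) : ℂ :=
  open Classical in
  if Real.sin φ = 0 then K (Real.cos φ * y, Real.cos φ * y)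
  else ∫ p : ℝ × ℝ, conj (quadratureKet φ y p.1) * K p * quadratureKet φ y p.2

/-- The Fourier transform `𝓕[m](x) = ∫ dk/(2π) e^{ikx} m(k)`. -/
def fourierTr (m : ℝ → ℂ) (x : ℝ) : ℂ :=
  ∫ k : ℝ, Complex.exp (Complex.I * k * x) * m k / (2 * Real.pi)

/-- A tempered distribution applied to a function that is a Schwartz function. -/
def distPair (h : 𝓢'(ℝ, ℂ)) (θ : ℝ → ℂ) : ℂ :=
  open Classical in
  if H : ∃ s : 𝓢(ℝ, ℂ), ⇑s = θ then h H.choose else 0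

/-- The bounded measurable function `H` is the inverse Fourier transform of the tempered distribution
`h`, that is `H = 𝓕⁻¹[h]`, or `h = 𝓕[H]`. For an integrable function `h` this is
`H(k) = ∫ dx e^{-ikx} h(x)`. -/
def HasBoundedFourier (h : 𝓢'(ℝ, ℂ)) (H : ℝ → ℂ) : Prop :=
  MemLp H ∞ volume ∧ ∀ θ : 𝓢(ℝ, ℂ), h θ = ∫ k, H k * fourierTr θ k

/-- The coefficient `⟪h(X_φ - x)|A⟫` for the operator `A` with kernel `K`. Here
`h(X_φ - x) = ∫ dy h(y - x) |y⟩_φ⟨y|`, and hence the complex conjugate of the coefficient is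
`Tr[A† h(X_φ - x)] = ∫ dy h(y) Tr[A† |x + y⟩_φ⟨x + y|]`. -/
def frameCoeff (h : 𝓢'(ℝ, ℂ)) (x φ : ℝ) (K : ℝ × ℝ → ℂ) : ℂ :=
  conj (distPair h (fun y => conj (quadratureDensity φ K (x + y))))

/-- The integrand of `symbolCoeff`. -/
def symbolIntegrand (m : ℝ → ℂ) (x φ : ℝ) (K : ℝ × ℝ → ℂ) (k : ℝ) : ℂ :=
  m k * fourierTr (fun y => conj (quadratureDensity φ K (x + y))) k

/-- The coefficient `⟪𝓕[m](X_φ - x)|A⟫` for the generalized function `𝓕[m]` with Fourier symbol `m`,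
which need not be bounded; it is meaningful where `symbolIntegrand` is integrable. -/
def symbolCoeff (m : ℝ → ℂ) (x φ : ℝ) (K : ℝ × ℝ → ℂ) : ℂ :=
  conj (∫ k, symbolIntegrand m x φ K k)

/-! ### The frame operator -/

/-- The measure `(dφ/π) dx` on `[0, π) × ℝ`; points are pairs `(φ, x)`. -/
def quorumMeasure : Measure (ℝ × ℝ) :=
  (ENNReal.ofReal (1 / Real.pi) • volume.restrict (Set.Ico 0 Real.pi)).prod volume

/-- Square integrable functions of `(φ, x)`. -/
abbrev Coeffs := Lp ℂ 2 quorumMeasure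

/-- The graph, on test operators, of the analysis operator `A ↦ ((φ, x) ↦ ⟪h(X_φ - x)|A⟫)`. -/
def analysisGraph (h : 𝓢'(ℝ, ℂ)) : Set (HS × Coeffs) :=
  {P | ∃ K : TestOp, P.1 = toHS K ∧ ⇑P.2 =ᵐ[quorumMeasure] fun q => frameCoeff h q.2 q.1 K}

/-- The frame operator `F = ∫ dφ/π ∫ dx |h(X_φ - x)⟫⟪h(X_φ - x)|` of the generalized vectors
`h(X_φ - x)`. It is `T* T̄`, where `T` is the analysis operator on test operators, `T̄` its closure,
and `T*` its adjoint. `FrameOp h A C` says that `A` is in the domain of `F`, and `F A = C`. -/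
def FrameOp (h : 𝓢'(ℝ, ℂ)) (A C : HS) : Prop :=
  ∃ u : Coeffs, (A, u) ∈ closure (analysisGraph h) ∧
    ∀ B v, (B, v) ∈ analysisGraph h → inner ℂ v u = inner ℂ B C

/-- The generalized operators `h(X_φ - x)` form a (generalized, continuous) frame: the coefficients of
every test operator are square integrable, the analysis operator is closable, and the positive
operator `F` is well-defined, densely defined and invertible, with a densely defined (in general
unbounded) inverse. -/
structure IsFrame (h : 𝓢'(ℝ, ℂ)) : Prop where
  bessel : ∀ K : TestOp, ∃ u : Coeffs, (toHS K, u) ∈ analysisGraph h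
  closable : ∀ u : Coeffs, ((0 : HS), u) ∈ closure (analysisGraph h) → u = 0
  unique : ∀ A C C' : HS, FrameOp h A C → FrameOp h A C' → C = C'
  dense_domain : Dense {A : HS | ∃ C, FrameOp h A C}
  injective : ∀ A A' C : HS, FrameOp h A C → FrameOp h A' C → A = A'
  dense_range : Dense {C : HS | ∃ A, FrameOp h A C}

/-- `f(t) = |H(2t)|² / (π t)`. -/
def frameSymbol (H : ℝ → ℂ) (t : ℝ) : ℝ := ‖H (2 * t)‖ ^ 2 / (Real.pi * t)

/-- `K` is a test operator, with `B = F⁻¹ K` and `u` the coefficients of `B` for the generalized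
operators `g(X_φ - x)`, on which the coefficients for `𝓕[m](X_φ - x)` converge. -/
def IsDualTest (h g : 𝓢'(ℝ, ℂ)) (m : ℝ → ℂ) (K : TestOp) (B : HS) (u : Coeffs) : Prop :=
  FrameOp h B (toHS K) ∧ (B, u) ∈ closure (analysisGraph g) ∧
    ∀ᵐ φ ∂volume.restrict (Set.Ico 0 Real.pi), ∀ x : ℝ, Integrable (symbolIntegrand m x φ K)

/-- `F⁻¹ |g(X_φ - x)⟫ = |𝓕[m](X_φ - x)⟫`, with `F` the frame operator of `h(X_φ - x)`, as an equality
of generalized operators: `⟪g(X_φ - x)|F⁻¹ A⟫ = ⟪𝓕[m](X_φ - x)|A⟫`. -/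
def FrameInverseEq (h g : 𝓢'(ℝ, ℂ)) (m : ℝ → ℂ) : Prop :=
  ∀ (K : TestOp) (B : HS) (u : Coeffs), IsDualTest h g m K B u →
    ⇑u =ᵐ[quorumMeasure] fun q => symbolCoeff m q.2 q.1 K

/-- The Dirac delta, for which `δ(X_φ - x) = |x⟩_φ⟨x|`. -/
def diracDelta : 𝓢'(ℝ, ℂ) := (Measure.dirac (0 : ℝ)).toTemperedDistribution

/-- `g(t) = √(σ²/(2π)) exp(-σ² t²/2)`. -/
def gaussian (σ t : ℝ) : ℝ := √(σ ^ 2 / (2 * Real.pi)) * Real.exp (-(σ ^ 2 * t ^ 2 / 2))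

end HomodyneFrames

end

open HomodyneFrames

/-!
Everything is diagonal in the characteristic function `χ_A(z) = Tr[D(z)† A]`.

In the coordinates `(q, u) ↦ (u + q/2, u - q/2)` of the kernel of `A`, the characteristic function
is a Fourier transform in `u` (`charFn_eq_fourier`). Hence `A ↦ χ_A` is a bijection of Schwartz
functions (`symbolEquiv`), it extends to a unitary map `spectralMap` onto `L²(ℂ, d²z/π)` by
Plancherel's theorem, and integration by parts turns `a - b†` into the multiplication by `z`
(`charFn_modeZ`). Schwartz functions are a core of the multiplication by any locally square
integrable function (`mem_closure_schwartzMulGraph`): this identifies the closure of `a - b†`, and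
below the closure of the analysis operator.

The Fourier transform of the density of the quadrature `X_φ` is the restriction of `χ_A` to the ray
`z = (i/2) k e^{iφ}` (`quadratureDensity_eq`). For `h = 𝓕[H]`, the coefficient `⟪h(X_φ - x)|A⟫` is
therefore the inverse Fourier transform in `k` of `conj H(k) χ_A((i/2) k e^{iφ})` (`symbolCoeff_eq`,
`frameCoeff_eq`). The rays with `φ ∈ [0, π)` and `k ∈ ℝ` sweep the plane once, and `d²z/π` is
`|k|/4 dk dφ/π`. So the analysis operator is, in the spectral representation, the multiplication by
a function `a_H` with `|a_H(z)|² = |H(k)|² / (π |z|)`, followed by an isometry `quorumLI` made of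
polar coordinates and the Fourier transform in the radius (`analysisGraph_eq`,
`mem_closure_analysisGraph`). Since `H` is bounded and `1/|z|` is locally integrable on the plane,
`a_H` is locally square integrable.

Consequently the frame operator is the maximal multiplication operator by `|a_H|²` (`frameOp_iff`).
It depends on `|H|` only; it is densely defined, and it is injective with dense range if `H ≠ 0`
almost everywhere (`isFrame_of_ae_ne_zero`); if `|H|` is even then `k = ± 2 |z|` gives
`|a_H(z)|² = f(|z|)` with `f = frameSymbol H` (`frameOp_iff_isFunctionOf`). Dividing a Fourier
symbol by `f(|k|/2)` undoes the frame operator, which gives the canonical dual (`frameInverseEq`), and the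
adjoint relation that defines `F` is the expansion in the dual frame (`inner_eq_integral_dual`). If
`1/H` is locally bounded, all of this applies to test operators whose characteristic function has
compact support (`dense_isDualTest`).

The commutator identities are computations with kernels: differentiation under the integral sign,
integration by parts, and `[a, a†] = 1`.
-/

open scoped FourierTransform

noncomputable section

namespace HomodyneFrames

/-! ### Partial Fourier transforms of Schwartz functions -/

/-- A family of bounded functions on the plane that is stable under partial derivatives and under
multiplication by the coordinates consists of Schwartz functions. -/
theorem exists_schwartz_of_stable (S : Set (ℝ × ℝ → ℂ))
    (hb : ∀ f ∈ S, ∃ C : ℝ, ∀ p, ‖f p‖ ≤ C)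
    (hd : ∀ f ∈ S, ∃ g₁ ∈ S, ∃ g₂ ∈ S, ∀ p : ℝ × ℝ, HasFDerivAt f
      ((ContinuousLinearMap.fst ℝ ℝ ℝ).smulRight (g₁ p) +
        (ContinuousLinearMap.snd ℝ ℝ ℝ).smulRight (g₂ p)) p)
    (hm : ∀ f ∈ S, (fun p : ℝ × ℝ => (p.1 : ℂ) * f p) ∈ S ∧
      (fun p : ℝ × ℝ => (p.2 : ℂ) * f p) ∈ S)
    {f : ℝ × ℝ → ℂ} (hf : f ∈ S) : ∃ s : 𝓢(ℝ × ℝ, ℂ), ⇑s = f := by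
  have hsm : ∀ n : ℕ, ∀ f ∈ S, ContDiff ℝ n f := by
    intro n
    induction n with
    | zero =>
      intro f hf
      obtain ⟨g₁, -, g₂, -, h⟩ := hd f hf
      exact contDiff_zero.2 (continuous_iff_continuousAt.2 fun p => (h p).continuousAt)
    | succ n ih =>
      intro f hf
      obtain ⟨g₁, h₁, g₂, h₂, h⟩ := hd f hf
      rw [Nat.cast_succ, contDiff_succ_iff_hasFDerivAt]
      exact ⟨_, (contDiff_const.smulRight (ih g₁ h₁)).add (contDiff_const.smulRight (ih g₂ h₂)),
        h⟩
  have hdec0 : ∀ k : ℕ, ∀ f ∈ S, ∃ C : ℝ, ∀ p, ‖p‖ ^ k * ‖f p‖ ≤ C := by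
    intro k
    induction k with
    | zero => intro f hf; simpa using hb f hf
    | succ k ih =>
      intro f hf
      obtain ⟨C₁, h₁⟩ := ih _ (hm f hf).1
      obtain ⟨C₂, h₂⟩ := ih _ (hm f hf).2
      refine ⟨C₁ + C₂, fun p => ?_⟩
      have e : ‖p‖ ≤ ‖p.1‖ + ‖p.2‖ := by
        rw [Prod.norm_def]
        exact max_le_add_of_nonneg (norm_nonneg _) (norm_nonneg _)
      have a₁ := h₁ p
      have a₂ := h₂ p
      simp only [norm_mul, Complex.norm_real] at a₁ a₂
      calc ‖p‖ ^ (k + 1) * ‖f p‖ = ‖p‖ ^ k * ‖f p‖ * ‖p‖ := by ring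
        _ ≤ ‖p‖ ^ k * ‖f p‖ * (‖p.1‖ + ‖p.2‖) := by gcongr
        _ ≤ C₁ + C₂ := by linarith
  have hdec : ∀ n k : ℕ, ∀ f ∈ S, ∃ C : ℝ, ∀ p, ‖p‖ ^ k * ‖iteratedFDeriv ℝ n f p‖ ≤ C := by
    intro n
    induction n with
    | zero => intro k f hf; simpa using hdec0 k f hf
    | succ n ih =>
      intro k f hf
      obtain ⟨g₁, h₁, g₂, h₂, h⟩ := hd f hf
      obtain ⟨C₁, b₁⟩ := ih k g₁ h₁
      obtain ⟨C₂, b₂⟩ := ih k g₂ h₂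
      let L₁ : ℂ →L[ℝ] (ℝ × ℝ →L[ℝ] ℂ) :=
        ContinuousLinearMap.smulRightL ℝ (ℝ × ℝ) ℂ (ContinuousLinearMap.fst ℝ ℝ ℝ)
      let L₂ : ℂ →L[ℝ] (ℝ × ℝ →L[ℝ] ℂ) :=
        ContinuousLinearMap.smulRightL ℝ (ℝ × ℝ) ℂ (ContinuousLinearMap.snd ℝ ℝ ℝ)
      have hfd : fderiv ℝ f = (L₁ ∘ g₁) + (L₂ ∘ g₂) := by
        ext1 p
        rw [(h p).fderiv]
        rfl
      refine ⟨‖L₁‖ * C₁ + ‖L₂‖ * C₂, fun p => ?_⟩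
      have c₁ : ContDiffAt ℝ n g₁ p := (hsm n g₁ h₁).contDiffAt
      have c₂ : ContDiffAt ℝ n g₂ p := (hsm n g₂ h₂).contDiffAt
      rw [← norm_iteratedFDeriv_fderiv, hfd,
        iteratedFDeriv_add_apply (L₁.contDiff.contDiffAt.comp p c₁)
          (L₂.contDiff.contDiffAt.comp p c₂)]
      calc _ ≤ ‖p‖ ^ k * (‖iteratedFDeriv ℝ n (L₁ ∘ g₁) p‖ + ‖iteratedFDeriv ℝ n (L₂ ∘ g₂) p‖) := by
            gcongr; exact norm_add_le _ _
        _ ≤ ‖p‖ ^ k * (‖L₁‖ * ‖iteratedFDeriv ℝ n g₁ p‖ + ‖L₂‖ * ‖iteratedFDeriv ℝ n g₂ p‖) := by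
            gcongr
            · exact L₁.norm_iteratedFDeriv_comp_left c₁ le_rfl
            · exact L₂.norm_iteratedFDeriv_comp_left c₂ le_rfl
        _ = ‖L₁‖ * (‖p‖ ^ k * ‖iteratedFDeriv ℝ n g₁ p‖) +
            ‖L₂‖ * (‖p‖ ^ k * ‖iteratedFDeriv ℝ n g₂ p‖) := by ring
        _ ≤ _ := by gcongr <;> [exact b₁ p; exact b₂ p]
  exact ⟨⟨f, contDiff_infty.2 fun n => hsm n f hf, fun k n => hdec n k f hf⟩, rfl⟩

/-- Multiplication of a Schwartz function by a function of temperate growth. -/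
def mulSchwartz {E : Type*} [NormedAddCommGroup E] [NormedSpace ℝ E] (g : E → ℂ) (K : 𝓢(E, ℂ)) :
    𝓢(E, ℂ) := smulLeftCLM ℂ g K

theorem mulSchwartz_apply {E : Type*} [NormedAddCommGroup E] [NormedSpace ℝ E] {g : E → ℂ}
    (hg : g.HasTemperateGrowth) (K : 𝓢(E, ℂ)) (x : E) : mulSchwartz g K x = g x * K x := by
  rw [mulSchwartz, smulLeftCLM_apply_apply hg, smul_eq_mul]

theorem hasTemperateGrowth_fst : Function.HasTemperateGrowth fun p : ℝ × ℝ => (p.1 : ℂ) :=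
  (Complex.ofRealCLM.comp (ContinuousLinearMap.fst ℝ ℝ ℝ)).hasTemperateGrowth

theorem hasTemperateGrowth_snd : Function.HasTemperateGrowth fun p : ℝ × ℝ => (p.2 : ℂ) :=
  (Complex.ofRealCLM.comp (ContinuousLinearMap.snd ℝ ℝ ℝ)).hasTemperateGrowth

/-- The restriction `u ↦ k (q, u)` of a Schwartz function to a line. -/
def sliceSchwartz (k : 𝓢(ℝ × ℝ, ℂ)) (q : ℝ) : 𝓢(ℝ, ℂ) :=
  compCLMOfAntilipschitz (K := 1) ℂ (g := fun u : ℝ => (q, u))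
    (by
      have h : (fun u : ℝ => (q, u)) =
          (fun u : ℝ => ContinuousLinearMap.inr ℝ ℝ ℝ u + (q, (0 : ℝ))) := by ext u <;> simp
      rw [h]
      exact (ContinuousLinearMap.inr ℝ ℝ ℝ).hasTemperateGrowth.add (.const _))
    (AntilipschitzWith.of_le_mul_dist fun x y => by simp [Prod.dist_eq]) k

@[simp] theorem sliceSchwartz_apply (k : 𝓢(ℝ × ℝ, ℂ)) (q u : ℝ) :
    sliceSchwartz k q u = k (q, u) := rfl

theorem exists_decay_snd (k : 𝓢(ℝ × ℝ, ℂ)) :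
    ∃ C : ℝ, 0 ≤ C ∧ ∀ q u : ℝ, ‖k (q, u)‖ ≤ C * (1 + u ^ 2)⁻¹ := by
  obtain ⟨C₀, p₀, h₀⟩ := k.decay 0 0
  obtain ⟨C₂, p₂, h₂⟩ := k.decay 2 0
  refine ⟨C₀ + C₂, by positivity, fun q u => ?_⟩
  have a := h₀ (q, u)
  have b := h₂ (q, u)
  simp only [norm_iteratedFDeriv_zero, pow_zero, one_mul] at a b
  have hu : u ^ 2 ≤ ‖(q, u)‖ ^ 2 := by
    rw [← sq_abs]
    gcongr
    exact norm_snd_le (q, u)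
  rw [← div_eq_mul_inv, le_div_iff₀ (by positivity)]
  nlinarith [mul_le_mul_of_nonneg_right hu (norm_nonneg (k (q, u)))]

/-- The partial Fourier transform in the second variable, as a function. -/
def partialFourierFun (k : ℝ × ℝ → ℂ) (p : ℝ × ℝ) : ℂ := 𝓕 (fun u => k (p.1, u)) p.2

theorem partialFourierFun_eq (k : ℝ × ℝ → ℂ) (p : ℝ × ℝ) :
    partialFourierFun k p =
      ∫ u : ℝ, Complex.exp (((-2 * Real.pi * u * p.2 : ℝ) : ℂ) * Complex.I) * k (p.1, u) :=
  Real.fourier_real_eq_integral_exp_smul _ _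

/-- Differentiation under the integral sign: the partial derivatives of a partial Fourier transform
are the partial Fourier transforms of `∂₁ k` and of `-2πi u k`. -/
theorem hasFDerivAt_partialFourierFun (k k₁ k₂ : 𝓢(ℝ × ℝ, ℂ))
    (h₁ : ∀ p, k₁ p = fderiv ℝ k p (1, 0))
    (h₂ : ∀ p : ℝ × ℝ, k₂ p = (-2 * Real.pi * Complex.I) * p.2 * k p) (p : ℝ × ℝ) :
    HasFDerivAt (partialFourierFun k)
      ((ContinuousLinearMap.fst ℝ ℝ ℝ).smulRight (partialFourierFun k₁ p) +
        (ContinuousLinearMap.snd ℝ ℝ ℝ).smulRight (partialFourierFun k₂ p)) p := by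
  set e : ℝ × ℝ → ℝ → ℂ := fun p u =>
    Complex.exp (((-2 * Real.pi * u * p.2 : ℝ) : ℂ) * Complex.I) with he
  have hen : ∀ p u, ‖e p u‖ = 1 := fun p u => Complex.norm_exp_ofReal_mul_I _
  let L₁ : ℂ →L[ℝ] (ℝ × ℝ →L[ℝ] ℂ) :=
    ContinuousLinearMap.smulRightL ℝ (ℝ × ℝ) ℂ (ContinuousLinearMap.fst ℝ ℝ ℝ)
  let L₂ : ℂ →L[ℝ] (ℝ × ℝ →L[ℝ] ℂ) :=
    ContinuousLinearMap.smulRightL ℝ (ℝ × ℝ) ℂ (ContinuousLinearMap.snd ℝ ℝ ℝ)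
  have hint : ∀ (K : 𝓢(ℝ × ℝ, ℂ)) (p : ℝ × ℝ), Integrable fun u : ℝ => e p u * K (p.1, u) := by
    intro K p
    refine (sliceSchwartz K p.1).integrable.bdd_mul (c := 1) ?_ ?_
    · exact Continuous.aestronglyMeasurable (by simp only [he]; fun_prop)
    · exact Filter.Eventually.of_forall fun u => (hen p u).le
  obtain ⟨C₁, p₁, b₁⟩ := exists_decay_snd k₁
  obtain ⟨C₂, p₂, b₂⟩ := exists_decay_snd k₂
  have key := hasFDerivAt_integral_of_dominated_of_fderiv_le (𝕜 := ℝ) (μ := (volume : Measure ℝ))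
    (F := fun p u => e p u * k (p.1, u))
    (F' := fun p u => L₁ (e p u * k₁ (p.1, u)) + L₂ (e p u * k₂ (p.1, u)))
    (x₀ := p) (s := Set.univ)
    (bound := fun u => (‖L₁‖ * C₁ + ‖L₂‖ * C₂) * (1 + u ^ 2)⁻¹)
    Filter.univ_mem
    (Filter.Eventually.of_forall fun p => (hint k p).aestronglyMeasurable)
    (hint k p)
    ((L₁.integrable_comp (hint k₁ p)).add (L₂.integrable_comp (hint k₂ p))).aestronglyMeasurable
    (Filter.Eventually.of_forall fun u p _ => by
      calc _ ≤ ‖L₁‖ * ‖e p u * k₁ (p.1, u)‖ + ‖L₂‖ * ‖e p u * k₂ (p.1, u)‖ :=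
            (norm_add_le _ _).trans (add_le_add (L₁.le_opNorm _) (L₂.le_opNorm _))
        _ ≤ ‖L₁‖ * (C₁ * (1 + u ^ 2)⁻¹) + ‖L₂‖ * (C₂ * (1 + u ^ 2)⁻¹) := by
            simp only [norm_mul, hen, one_mul]
            gcongr <;> [exact b₁ _ _; exact b₂ _ _]
        _ = _ := by ring)
    (integrable_inv_one_add_sq.const_mul _)
    (Filter.Eventually.of_forall fun u p _ => by
      have hk : HasFDerivAt (fun p : ℝ × ℝ => k (p.1, u))
          ((fderiv ℝ k (p.1, u)).comp ((ContinuousLinearMap.fst ℝ ℝ ℝ).prod 0)) p :=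
        (k.hasFDerivAt (p.1, u)).comp p ((hasFDerivAt_fst).prodMk (hasFDerivAt_const u p))
      have hee : HasFDerivAt (fun p : ℝ × ℝ => e p u)
          (e p u • ((ContinuousLinearMap.snd ℝ ℝ ℝ).smulRight
            (((-2 * Real.pi * u : ℝ) : ℂ) * Complex.I))) p := by
        have h0 : HasFDerivAt (fun p : ℝ × ℝ => ((-2 * Real.pi * u * p.2 : ℝ) : ℂ) * Complex.I)
            ((ContinuousLinearMap.snd ℝ ℝ ℝ).smulRight
              (((-2 * Real.pi * u : ℝ) : ℂ) * Complex.I)) p := by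
          convert ((ContinuousLinearMap.snd ℝ ℝ ℝ).smulRight
            (((-2 * Real.pi * u : ℝ) : ℂ) * Complex.I)).hasFDerivAt using 1
          ext q
          simp
          ring
        exact h0.cexp
      refine (hee.mul hk).congr_fderiv ?_
      ext
      · simp [L₁, L₂, h₁]
      · have h0 : fderiv ℝ k (p.1, u) (0, 0) = 0 := map_zero _
        simp [L₁, L₂, h₂, h0]
        ring)
  rw [integral_add (L₁.integrable_comp (hint k₁ p)) (L₂.integrable_comp (hint k₂ p)),
    L₁.integral_comp_comm (hint k₁ p), L₂.integral_comp_comm (hint k₂ p)] at key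
  simp only [he, ← partialFourierFun_eq] at key
  exact key

theorem integrable_deriv_schwartz (f : 𝓢(ℝ, ℂ)) : Integrable (deriv f) :=
  (derivCLM ℂ ℂ f).integrable

theorem fourier_deriv_schwartz (f : 𝓢(ℝ, ℂ)) (x : ℝ) :
    𝓕 (deriv f) x = 2 * Real.pi * Complex.I * x * 𝓕 (f : ℝ → ℂ) x := by
  rw [Real.fourier_deriv f.integrable f.differentiable (integrable_deriv_schwartz f)]
  simp

/-- The directional derivative of a Schwartz function. -/
def dirDeriv {E : Type*} [NormedAddCommGroup E] [NormedSpace ℝ E] (v : E) (K : 𝓢(E, ℂ)) :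
    𝓢(E, ℂ) := LineDeriv.lineDerivOp v K

theorem dirDeriv_apply {E : Type*} [NormedAddCommGroup E] [NormedSpace ℝ E] (v : E) (K : 𝓢(E, ℂ))
    (x : E) : dirDeriv v K x = fderiv ℝ K x v := lineDerivOp_apply_eq_fderiv v K x

theorem deriv_sliceSchwartz (k : 𝓢(ℝ × ℝ, ℂ)) (q : ℝ) :
    deriv (sliceSchwartz k q) = sliceSchwartz (dirDeriv (0, 1) k) q := by
  ext u
  have h : HasDerivAt (fun u : ℝ => (q, u)) ((0 : ℝ), (1 : ℝ)) u :=
    (hasDerivAt_const u q).prodMk (hasDerivAt_id u)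
  rw [sliceSchwartz_apply, dirDeriv_apply]
  exact ((k.hasFDerivAt (q, u)).comp_hasDerivAt u h).deriv

theorem partialFourierFun_slice (k : 𝓢(ℝ × ℝ, ℂ)) (q ξ : ℝ) :
    partialFourierFun k (q, ξ) = 𝓕 (sliceSchwartz k q) ξ := rfl

/-- The partial Fourier transforms of Schwartz functions form a family that is stable under
derivatives and under multiplication by the coordinates. -/
theorem exists_partialFourier (k : 𝓢(ℝ × ℝ, ℂ)) :
    ∃ s : 𝓢(ℝ × ℝ, ℂ), ⇑s = partialFourierFun k := by
  refine exists_schwartz_of_stable (Set.range fun k : 𝓢(ℝ × ℝ, ℂ) => partialFourierFun k)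
    ?_ ?_ ?_ ⟨k, rfl⟩
  · rintro _ ⟨k, rfl⟩
    obtain ⟨C, hC, h⟩ := exists_decay_snd k
    refine ⟨∫ u : ℝ, C * (1 + u ^ 2)⁻¹, fun p => ?_⟩
    dsimp only
    rw [partialFourierFun_eq]
    refine norm_integral_le_of_norm_le (integrable_inv_one_add_sq.const_mul _)
      (Filter.Eventually.of_forall fun u => ?_)
    rw [norm_mul, Complex.norm_exp_ofReal_mul_I, one_mul]
    exact h _ _
  · rintro _ ⟨k, rfl⟩
    have hg : Function.HasTemperateGrowth fun p : ℝ × ℝ => (-2 * Real.pi * Complex.I) * (p.2 : ℂ) :=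
      (Function.HasTemperateGrowth.const _).mul hasTemperateGrowth_snd
    exact ⟨_, ⟨dirDeriv (1, 0) k, rfl⟩, _, ⟨mulSchwartz _ k, rfl⟩,
      hasFDerivAt_partialFourierFun k _ _ (dirDeriv_apply _ k) (mulSchwartz_apply hg k)⟩
  · rintro _ ⟨k, rfl⟩
    refine ⟨⟨mulSchwartz (fun p => (p.1 : ℂ)) k, ?_⟩,
      ⟨((2 * Real.pi * Complex.I)⁻¹ : ℂ) • dirDeriv (0, 1) k, ?_⟩⟩
    · ext p
      simp only [partialFourierFun_eq, mulSchwartz_apply hasTemperateGrowth_fst]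
      rw [← integral_const_mul]
      congr 1 with u
      ring
    · ext p
      have h1 := fourier_deriv_schwartz (sliceSchwartz k p.1) p.2
      rw [deriv_sliceSchwartz] at h1
      have h2 : partialFourierFun (((2 * Real.pi * Complex.I)⁻¹ : ℂ) • dirDeriv (0, 1) k) p =
          (2 * Real.pi * Complex.I)⁻¹ * partialFourierFun (dirDeriv (0, 1) k) p := by
        simp only [partialFourierFun_eq]
        rw [← integral_const_mul]
        congr 1 with u
        simp
        ring
      dsimp only
      refine h2.trans ?_
      rw [← Prod.mk.eta (p := p), partialFourierFun_slice, partialFourierFun_slice, fourier_coe, h1]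
      rw [fourier_coe]
      field_simp

/-- The partial Fourier transform in the second variable. -/
def partialFourier (k : 𝓢(ℝ × ℝ, ℂ)) : 𝓢(ℝ × ℝ, ℂ) := (exists_partialFourier k).choose

theorem partialFourier_apply (k : 𝓢(ℝ × ℝ, ℂ)) (q ξ : ℝ) :
    partialFourier k (q, ξ) = 𝓕 (sliceSchwartz k q) ξ := by
  rw [partialFourier, (exists_partialFourier k).choose_spec, partialFourierFun_slice]

theorem sliceSchwartz_partialFourier (k : 𝓢(ℝ × ℝ, ℂ)) (q : ℝ) :
    sliceSchwartz (partialFourier k) q = 𝓕 (sliceSchwartz k q) := by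
  ext ξ
  rw [sliceSchwartz_apply, partialFourier_apply]

theorem ext_sliceSchwartz {k l : 𝓢(ℝ × ℝ, ℂ)} (h : ∀ q, sliceSchwartz k q = sliceSchwartz l q) :
    k = l := by
  ext ⟨q, u⟩
  rw [← sliceSchwartz_apply, h, sliceSchwartz_apply]

/-- Precomposition with a linear equivalence, as an equivalence of Schwartz spaces. -/
def compEquiv {D E : Type*} [NormedAddCommGroup D] [NormedSpace ℝ D] [NormedAddCommGroup E]
    [NormedSpace ℝ E] (g : D ≃L[ℝ] E) : 𝓢(E, ℂ) ≃ₗ[ℂ] 𝓢(D, ℂ) where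
  __ := (compCLMOfContinuousLinearEquiv ℂ g).toLinearMap
  invFun := compCLMOfContinuousLinearEquiv ℂ g.symm
  left_inv f := by ext x; simp
  right_inv f := by ext x; simp

@[simp] theorem compEquiv_apply {D E : Type*} [NormedAddCommGroup D] [NormedSpace ℝ D]
    [NormedAddCommGroup E] [NormedSpace ℝ E] (g : D ≃L[ℝ] E) (f : 𝓢(E, ℂ)) (x : D) :
    compEquiv g f x = f (g x) := rfl

/-- The reflection `(q, u) ↦ (q, -u)`. -/
def reflectSnd : (ℝ × ℝ) ≃L[ℝ] (ℝ × ℝ) :=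
  (ContinuousLinearEquiv.refl ℝ ℝ).prodCongr (ContinuousLinearEquiv.neg ℝ)

theorem sliceSchwartz_reflect_partialFourier (k : 𝓢(ℝ × ℝ, ℂ)) (q : ℝ) :
    sliceSchwartz (compEquiv reflectSnd (partialFourier k)) q = 𝓕⁻ (sliceSchwartz k q) := by
  ext ξ
  exact partialFourier_apply k q (-ξ)

/-- The partial Fourier transform in the second variable is bijective on Schwartz functions. -/
def partialFourierEquiv : 𝓢(ℝ × ℝ, ℂ) ≃ₗ[ℂ] 𝓢(ℝ × ℝ, ℂ) where
  toFun := partialFourier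
  map_add' k l := ext_sliceSchwartz fun q => by
    have h : sliceSchwartz (k + l) q = sliceSchwartz k q + sliceSchwartz l q := rfl
    rw [sliceSchwartz_partialFourier, h, FourierTransform.fourier_add]
    simp only [← sliceSchwartz_partialFourier]
    rfl
  map_smul' c k := ext_sliceSchwartz fun q => by
    have h : sliceSchwartz (c • k) q = c • sliceSchwartz k q := rfl
    rw [sliceSchwartz_partialFourier, h, FourierTransform.fourier_smul]
    simp only [← sliceSchwartz_partialFourier]
    rfl
  invFun k := compEquiv reflectSnd (partialFourier k)
  left_inv k := ext_sliceSchwartz fun q => by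
    rw [sliceSchwartz_reflect_partialFourier, sliceSchwartz_partialFourier,
      FourierTransform.fourierInv_fourier_eq]
  right_inv k := ext_sliceSchwartz fun q => by
    rw [sliceSchwartz_partialFourier, sliceSchwartz_reflect_partialFourier,
      FourierTransform.fourier_fourierInv_eq]

/-! ### The characteristic function of a test operator -/

/-- The difference and midpoint coordinates: `(q, u) ↦ (u + q/2, u - q/2)`. -/
def midpointEquiv : (ℝ × ℝ) ≃L[ℝ] (ℝ × ℝ) :=
  LinearEquiv.toContinuousLinearEquiv
  { toFun := fun p => (p.2 + p.1 / 2, p.2 - p.1 / 2)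
    invFun := fun p => (p.1 - p.2, (p.1 + p.2) / 2)
    map_add' := fun p q => by ext <;> simp <;> ring
    map_smul' := fun c p => by ext <;> simp <;> ring
    left_inv := fun p => by ext <;> simp
    right_inv := fun p => by ext <;> simp <;> ring }

@[simp] theorem midpointEquiv_apply (q u : ℝ) : midpointEquiv (q, u) = (u + q / 2, u - q / 2) := rfl

/-- The coordinates `z ↦ (re z, im z / π)`. -/
def planeEquiv : ℂ ≃L[ℝ] (ℝ × ℝ) :=
  LinearEquiv.toContinuousLinearEquiv
  { toFun := fun z => (z.re, z.im / Real.pi)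
    invFun := fun p => ⟨p.1, Real.pi * p.2⟩
    map_add' := fun p q => by ext <;> simp [add_div]
    map_smul' := fun c p => by ext <;> simp [mul_div_assoc]
    left_inv := fun p => by apply Complex.ext <;> simp; field_simp
    right_inv := fun p => by ext <;> simp }

/-- The map from a test operator to its characteristic function `z ↦ Tr[D(z)† A]`, which is a
bijection of Schwartz functions. -/
def symbolEquiv : TestOp ≃ₗ[ℂ] 𝓢(ℂ, ℂ) :=
  (compEquiv midpointEquiv).trans (partialFourierEquiv.trans (compEquiv planeEquiv))

theorem symbolEquiv_eq_fourier (K : TestOp) (z : ℂ) :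
    symbolEquiv K z =
      𝓕 (sliceSchwartz (compEquiv midpointEquiv K) z.re) (z.im / Real.pi) :=
  partialFourier_apply _ _ _

theorem charFn_eq_integral (K : ℝ × ℝ → ℂ) (z : ℂ) :
    charFn K z = ∫ u : ℝ, Complex.exp (((-2 * u * z.im : ℝ) : ℂ) * Complex.I) *
      K (u + z.re / 2, u - z.re / 2) := by
  rw [charFn, ← integral_sub_right_eq_self _ (z.re / 2)]
  congr 1 with u
  simp only [displace, Complex.neg_re, Complex.neg_im]
  congr 2
  · push_cast; ring
  · congr 1; ring

/-- The trace over the diagonal that defines the characteristic function is a Fourier transform in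
the midpoint coordinate. -/
theorem charFn_eq_fourier (K : ℝ × ℝ → ℂ) (z : ℂ) :
    charFn K z = 𝓕 (fun u : ℝ => K (u + z.re / 2, u - z.re / 2)) (z.im / Real.pi) := by
  rw [charFn_eq_integral, Real.fourier_real_eq_integral_exp_smul]
  congr 1 with u
  rw [smul_eq_mul]
  congr 4
  field_simp

theorem symbolEquiv_apply (K : TestOp) (z : ℂ) : symbolEquiv K z = charFn K z := by
  rw [symbolEquiv_eq_fourier, charFn_eq_fourier]
  rfl

/-! ### The operator `a - b†` on test operators -/

theorem hasTemperateGrowth_sub : Function.HasTemperateGrowth fun p : ℝ × ℝ => (p.1 : ℂ) - p.2 :=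
  hasTemperateGrowth_fst.sub hasTemperateGrowth_snd

theorem deriv_fst_schwartz (K : TestOp) (p : ℝ × ℝ) :
    HasDerivAt (fun s => K (s, p.2)) (dirDeriv (1, 0) K p) p.1 := by
  have h : HasDerivAt (fun s : ℝ => (s, p.2)) ((1 : ℝ), (0 : ℝ)) p.1 :=
    (hasDerivAt_id p.1).prodMk (hasDerivAt_const p.1 p.2)
  rw [dirDeriv_apply]
  exact (K.hasFDerivAt p).comp_hasDerivAt p.1 h

theorem deriv_snd_schwartz (K : TestOp) (p : ℝ × ℝ) :
    HasDerivAt (fun t => K (p.1, t)) (dirDeriv (0, 1) K p) p.2 := by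
  have h : HasDerivAt (fun t : ℝ => (p.1, t)) ((0 : ℝ), (1 : ℝ)) p.2 :=
    (hasDerivAt_const p.2 p.1).prodMk (hasDerivAt_id p.2)
  rw [dirDeriv_apply]
  exact (K.hasFDerivAt p).comp_hasDerivAt p.2 h

/-- The common form of `a - b†` (for `c = 1/2`) and of `a† - b` (for `c = -1/2`) on test
operators: `(x - y) + c (∂_x + ∂_y)`. -/
def modeSchwartz (c : ℂ) (K : TestOp) : TestOp :=
  mulSchwartz (fun p => (p.1 : ℂ) - p.2) K + c • dirDeriv (1, 1) K

theorem dirDeriv_diag (K : TestOp) (p : ℝ × ℝ) :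
    dirDeriv (1, 1) K p = dirDeriv (1, 0) K p + dirDeriv (0, 1) K p := by
  simp only [dirDeriv_apply]
  rw [← map_add]
  simp

theorem modeSchwartz_apply (c : ℂ) (K : TestOp) (p : ℝ × ℝ) : modeSchwartz c K p =
    (p.1 - p.2) * K p + c * (dirDeriv (1, 0) K p + dirDeriv (0, 1) K p) := by
  rw [← dirDeriv_diag, ← mulSchwartz_apply hasTemperateGrowth_sub]
  rfl

theorem modeZ_schwartz (K : TestOp) : modeZ K = modeSchwartz (1 / 2) K := by
  ext p
  rw [modeSchwartz_apply]
  simp only [modeZ, annih, creat]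
  rw [(deriv_fst_schwartz K p).deriv, (deriv_snd_schwartz K p).deriv]
  ring

theorem modeZdag_schwartz (K : TestOp) : modeZdag K = modeSchwartz (-1 / 2) K := by
  ext p
  rw [modeSchwartz_apply]
  simp only [modeZdag, annih, creat]
  rw [(deriv_fst_schwartz K p).deriv, (deriv_snd_schwartz K p).deriv]
  ring

theorem charFn_modeSchwartz (c : ℂ) (K : TestOp) (z : ℂ) :
    charFn (modeSchwartz c K) z = (z.re + 2 * c * z.im * Complex.I) * charFn K z := by
  set φ := sliceSchwartz (compEquiv midpointEquiv K) z.re with hφ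
  have h0 : charFn K z = 𝓕 (φ : ℝ → ℂ) (z.im / Real.pi) := charFn_eq_fourier K z
  have h1 : (fun u : ℝ => modeSchwartz c K (u + z.re / 2, u - z.re / 2)) =
      ⇑((z.re : ℂ) • φ + c • derivCLM ℂ ℂ φ) := by
    ext u
    have h2 : HasDerivAt φ (dirDeriv (1, 1) K (u + z.re / 2, u - z.re / 2)) u := by
      have h : HasDerivAt (fun u : ℝ => (u + z.re / 2, u - z.re / 2)) ((1 : ℝ), (1 : ℝ)) u :=
        ((hasDerivAt_id u).add_const _).prodMk ((hasDerivAt_id u).sub_const _)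
      rw [dirDeriv_apply]
      exact (K.hasFDerivAt _).comp_hasDerivAt u h
    rw [modeSchwartz_apply, ← dirDeriv_diag, ← h2.deriv]
    simp [hφ]
  rw [charFn_eq_fourier, h1, h0, ← fourier_coe, FourierTransform.fourier_add,
    FourierTransform.fourier_smul, FourierTransform.fourier_smul]
  have h3 : 𝓕 (derivCLM ℂ ℂ φ) (z.im / Real.pi) = _ := fourier_deriv_schwartz φ (z.im / Real.pi)
  simp only [add_apply, smul_apply, smul_eq_mul, h3, fourier_coe]
  push_cast
  field_simp

theorem charFn_modeZ (K : TestOp) (z : ℂ) : charFn (modeZ K) z = z * charFn K z := by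
  rw [modeZ_schwartz, charFn_modeSchwartz]
  congr 1
  apply Complex.ext <;> simp

theorem charFn_modeZdag (K : TestOp) (z : ℂ) : charFn (modeZdag K) z = conj z * charFn K z := by
  rw [modeZdag_schwartz, charFn_modeSchwartz]
  congr 1
  apply Complex.ext <;> simp
  ring

/-! ### The spectral representation of `a - b†` -/

theorem eLpNorm_two_sq {α : Type*} [MeasurableSpace α] (μ : Measure α) (f : α → ℂ) :
    eLpNorm f 2 μ ^ 2 = ∫⁻ x, ‖f x‖ₑ ^ 2 ∂μ := by
  have := eLpNorm_nnreal_pow_eq_lintegral (f := f) (μ := μ) (p := 2) (by norm_num)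
  simpa using this

theorem eLpNorm_two_eq_iff {α β : Type*} [MeasurableSpace α] [MeasurableSpace β] {μ : Measure α}
    {ν : Measure β} {f : α → ℂ} {g : β → ℂ} :
    eLpNorm f 2 μ = eLpNorm g 2 ν ↔ ∫⁻ x, ‖f x‖ₑ ^ 2 ∂μ = ∫⁻ x, ‖g x‖ₑ ^ 2 ∂ν := by
  rw [← eLpNorm_two_sq, ← eLpNorm_two_sq]
  exact (ENNReal.pow_right_strictMono two_ne_zero).injective.eq_iff.symm

theorem memLp_two_iff {α : Type*} [MeasurableSpace α] {μ : Measure α} {f : α → ℂ}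
    (hf : AEStronglyMeasurable f μ) : MemLp f 2 μ ↔ ∫⁻ x, ‖f x‖ₑ ^ 2 ∂μ < ∞ := by
  rw [← eLpNorm_two_sq, ENNReal.pow_lt_top_iff]
  simp [MemLp, hf]

theorem norm_toLp_eq_of_lintegral {α β : Type*} [MeasurableSpace α] [MeasurableSpace β]
    {μ : Measure α} {ν : Measure β} (f : Lp ℂ 2 μ) (g : Lp ℂ 2 ν)
    (h : ∫⁻ x, ‖f x‖ₑ ^ 2 ∂μ = ∫⁻ x, ‖g x‖ₑ ^ 2 ∂ν) : ‖f‖ = ‖g‖ := by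
  rw [Lp.norm_def, Lp.norm_def, eLpNorm_two_eq_iff.2 h]

instance : planeMeasure.IsAddHaarMeasure :=
  Measure.IsAddHaarMeasure.smul _ (by simp [Real.pi_pos]) (by simp)

/-- The factor `π` in `planeEquiv` accounts for the normalization of `d²z/π`. -/
theorem measurePreserving_planeEquiv_symm :
    MeasurePreserving (planeEquiv.symm : ℝ × ℝ → ℂ) volume planeMeasure := by
  have h1 : MeasurePreserving (fun y : ℝ => Real.pi * y) volume
      (ENNReal.ofReal (1 / Real.pi) • volume) := by
    refine ⟨by fun_prop, ?_⟩
    rw [Real.map_volume_mul_left Real.pi_pos.ne', abs_of_pos (by positivity), one_div]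
  have h2 := (MeasurePreserving.id (volume : Measure ℝ)).prod h1
  rw [Measure.prod_smul_right] at h2
  have h3 : MeasurePreserving Complex.measurableEquivRealProd.symm
      (ENNReal.ofReal (1 / Real.pi) • ((volume : Measure ℝ).prod (volume : Measure ℝ)))
      planeMeasure :=
    Complex.volume_preserving_equiv_real_prod.symm.smul_measure _
  exact h3.comp h2

theorem measurePreserving_midpointEquiv :
    MeasurePreserving (midpointEquiv : ℝ × ℝ → ℝ × ℝ) volume volume := by
  have h1 : MeasurePreserving (fun p : ℝ × ℝ => (p.1, p.2 - p.1 / 2)) volume volume :=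
    (MeasurePreserving.id (volume : Measure ℝ)).skew_product (g := fun q u => u - q / 2)
      (by fun_prop)
      (Filter.Eventually.of_forall fun q =>
        (measurePreserving_sub_right (volume : Measure ℝ) (q / 2)).map_eq)
  have h2 : MeasurePreserving (fun p : ℝ × ℝ => (p.1, p.2 + p.1)) volume volume :=
    (MeasurePreserving.id (volume : Measure ℝ)).skew_product (g := fun q u => u + q)
      (by fun_prop)
      (Filter.Eventually.of_forall fun q =>
        (measurePreserving_add_right (volume : Measure ℝ) q).map_eq)
  have hs : MeasurePreserving (Prod.swap : ℝ × ℝ → ℝ × ℝ) volume volume :=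
    Measure.measurePreserving_swap
  have h3 := hs.comp (h2.comp (hs.comp h1))
  convert h3 using 1
  ext p
  · change p.2 + p.1 / 2 = p.1 + (p.2 - p.1 / 2)
    ring
  · rfl

theorem eLpNorm_fourier_schwartz (f : 𝓢(ℝ, ℂ)) :
    eLpNorm (𝓕 f : 𝓢(ℝ, ℂ)) 2 volume = eLpNorm f 2 volume := by
  have h := norm_fourier_toL2_eq f
  rwa [norm_toLp, norm_toLp, ENNReal.toReal_eq_toReal_iff' (eLpNorm_lt_top _ _ _).ne
    (eLpNorm_lt_top _ _ _).ne] at h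

theorem lintegral_partialFourier (k : 𝓢(ℝ × ℝ, ℂ)) :
    ∫⁻ p, ‖partialFourier k p‖ₑ ^ 2 = ∫⁻ p, ‖k p‖ₑ ^ 2 := by
  rw [Measure.volume_eq_prod, lintegral_prod _ (by fun_prop), lintegral_prod _ (by fun_prop)]
  congr 1 with q
  have h := eLpNorm_two_eq_iff.1 (eLpNorm_fourier_schwartz (sliceSchwartz k q))
  rw [← sliceSchwartz_partialFourier] at h
  exact h

theorem lintegral_symbolEquiv (K : TestOp) :
    ∫⁻ z, ‖symbolEquiv K z‖ₑ ^ 2 ∂planeMeasure = ∫⁻ p, ‖K p‖ₑ ^ 2 := by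
  rw [← measurePreserving_planeEquiv_symm.lintegral_comp (by fun_prop),
    ← measurePreserving_midpointEquiv.lintegral_comp (f := fun p => ‖K p‖ₑ ^ 2) (by fun_prop)]
  have h := lintegral_partialFourier (compEquiv midpointEquiv K)
  convert h using 4 with p
  · have e : symbolEquiv K (planeEquiv.symm p) =
        partialFourier (compEquiv midpointEquiv K) (planeEquiv (planeEquiv.symm p)) := rfl
    rw [e, ContinuousLinearEquiv.apply_symm_apply]
  · rfl

theorem norm_symbolEquiv (K : TestOp) :
    ‖(symbolEquiv K).toLp 2 planeMeasure‖ = ‖K.toLp 2 volume‖ := by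
  rw [norm_toLp, norm_toLp, eLpNorm_two_eq_iff.2 (lintegral_symbolEquiv K)]

/-- The unitary extension of the map `A ↦ (z ↦ Tr[D(z)† A])` to Hilbert-Schmidt operators. -/
def spectralMap : HS ≃ₗᵢ[ℂ] Lp ℂ 2 planeMeasure :=
  symbolEquiv.extendOfIsometry (toLpCLM ℂ ℂ 2 (volume : Measure (ℝ × ℝ))).toLinearMap
    (toLpCLM ℂ ℂ 2 planeMeasure).toLinearMap
    (denseRange_toLpCLM ENNReal.ofNat_ne_top) (denseRange_toLpCLM ENNReal.ofNat_ne_top)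
    norm_symbolEquiv

theorem spectralMap_toHS (K : TestOp) :
    spectralMap (toHS K) = (symbolEquiv K).toLp 2 planeMeasure :=
  LinearEquiv.extendOfIsometry_eq symbolEquiv
    (toLpCLM ℂ ℂ 2 (volume : Measure (ℝ × ℝ))).toLinearMap
    (toLpCLM ℂ ℂ 2 planeMeasure).toLinearMap
    (denseRange_toLpCLM ENNReal.ofNat_ne_top) (denseRange_toLpCLM ENNReal.ofNat_ne_top)
    norm_symbolEquiv K

theorem spectralMap_toHS_ae (K : TestOp) :
    ⇑(spectralMap (toHS K)) =ᵐ[planeMeasure] charFn K := by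
  rw [spectralMap_toHS]
  filter_upwards [coeFn_toLp (symbolEquiv K) 2 planeMeasure] with z hz
  rw [hz, symbolEquiv_apply]

/-! ### Multiplication operators and their cores -/

/-- The graph of a maximal multiplication operator is closed. -/
theorem isClosed_mulGraph {α : Type*} [MeasurableSpace α] (μ : Measure α) (a : α → ℂ) :
    IsClosed {P : Lp ℂ 2 μ × Lp ℂ 2 μ | ⇑P.2 =ᵐ[μ] fun z => a z * P.1 z} := by
  refine isClosed_of_closure_subset fun P hP => ?_
  obtain ⟨x, hx, hlim⟩ := mem_closure_iff_seq_limit.1 hP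
  have h1 : Filter.Tendsto (fun n => (x n).1) Filter.atTop (nhds P.1) :=
    (continuous_fst.tendsto P).comp hlim
  have h2 : Filter.Tendsto (fun n => (x n).2) Filter.atTop (nhds P.2) :=
    (continuous_snd.tendsto P).comp hlim
  obtain ⟨n₁, m₁, t₁⟩ := (tendstoInMeasure_of_tendsto_Lp h1).exists_seq_tendsto_ae
  obtain ⟨n₂, m₂, t₂⟩ :=
    (tendstoInMeasure_of_tendsto_Lp (h2.comp m₁.tendsto_atTop)).exists_seq_tendsto_ae
  have hx' : ∀ᵐ z ∂μ, ∀ n, (x n).2 z = a z * (x n).1 z := ae_all_iff.2 hx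
  filter_upwards [t₁, t₂, hx'] with z z₁ z₂ hz
  refine tendsto_nhds_unique z₂ ?_
  simp only [Function.comp_def, hz]
  exact (z₁.comp m₂.tendsto_atTop).const_mul _

/-- The graph of the multiplication by `a` on Schwartz functions. -/
def schwartzMulGraph (a : ℂ → ℂ) : Set (Lp ℂ 2 planeMeasure × Lp ℂ 2 planeMeasure) :=
  {P | ∃ s : 𝓢(ℂ, ℂ), P.1 = s.toLp 2 planeMeasure ∧ ⇑P.2 =ᵐ[planeMeasure] fun z => a z * s z}

/-- Schwartz functions form a core of the multiplication by a locally square integrable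
function `a`: they are dense in `L²` of the measure `(1 + |a|²) d²z/π`. -/
theorem mem_closure_schwartzMulGraph {a : ℂ → ℂ} (ha : Measurable a)
    (hloc : ∀ R : ℝ, ∫⁻ z in Metric.closedBall 0 R, ‖a z‖ₑ ^ 2 ∂planeMeasure < ∞)
    (f g : Lp ℂ 2 planeMeasure) :
    (f, g) ∈ closure (schwartzMulGraph a) ↔ ⇑g =ᵐ[planeMeasure] fun z => a z * f z := by
  constructor
  · intro h
    refine closure_minimal ?_ (isClosed_mulGraph planeMeasure a) h
    rintro ⟨f, g⟩ ⟨s, rfl, h⟩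
    filter_upwards [h, coeFn_toLp s 2 planeMeasure] with z h1 h2
    rw [h1, h2]
  · intro h
    -- approximation in `L²` of the measure `μ` controls `f` and `a f` at the same time
    set w : ℂ → ℝ≥0∞ := fun z => 1 + ‖a z‖ₑ ^ 2 with hw
    have hwm : Measurable w := by fun_prop
    set μ := planeMeasure.withDensity w with hμ
    have hac : μ ≪ planeMeasure := withDensity_absolutelyContinuous _ _
    have hint : ∀ u : ℂ → ℂ, AEStronglyMeasurable u planeMeasure →
        eLpNorm u 2 μ ^ 2 = eLpNorm u 2 planeMeasure ^ 2 +
          eLpNorm (fun z => a z * u z) 2 planeMeasure ^ 2 := by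
      intro u hu
      rw [eLpNorm_two_sq, eLpNorm_two_sq, eLpNorm_two_sq, hμ,
        lintegral_withDensity_eq_lintegral_mul₀ hwm.aemeasurable (by fun_prop),
        ← lintegral_add_left' (by fun_prop)]
      congr 1 with z
      simp only [hw, Pi.mul_apply, enorm_mul]
      ring
    have hfm : MemLp f 2 μ := by
      refine ⟨(Lp.aestronglyMeasurable f).mono_ac hac, ?_⟩
      have h2 : ∀ x : ℝ≥0∞, x < ∞ ↔ x ^ 2 < ∞ := fun x => by simp [ENNReal.pow_lt_top_iff]
      rw [h2, hint _ (Lp.aestronglyMeasurable f),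
        ← eLpNorm_congr_ae h]
      exact ENNReal.add_lt_top.2 ⟨ENNReal.pow_lt_top (Lp.eLpNorm_lt_top f),
        ENNReal.pow_lt_top (Lp.eLpNorm_lt_top g)⟩
    have : IsFiniteMeasureOnCompacts μ := ⟨fun K hK => by
      obtain ⟨R, hR⟩ := hK.isBounded.subset_closedBall 0
      refine (measure_mono hR).trans_lt ?_
      rw [hμ, withDensity_apply _ measurableSet_closedBall, hw, lintegral_add_left (by fun_prop)]
      refine ENNReal.add_lt_top.2 ⟨?_, hloc R⟩
      simp [(isCompact_closedBall (0 : ℂ) R).measure_lt_top]⟩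
    rw [Metric.mem_closure_iff]
    intro ε hε
    obtain ⟨φ, hφc, hφs, hφ⟩ := MemLp.exist_eLpNorm_sub_le (μ := μ) ENNReal.ofNat_ne_top
      one_le_two hfm (half_pos hε)
    set s : 𝓢(ℂ, ℂ) := hφc.toSchwartzMap hφs with hs
    have hsφ : ⇑s = φ := rfl
    have hle : ∀ u : ℂ → ℂ, AEStronglyMeasurable u planeMeasure →
        eLpNorm u 2 planeMeasure ≤ eLpNorm u 2 μ ∧
          eLpNorm (fun z => a z * u z) 2 planeMeasure ≤ eLpNorm u 2 μ := by
      intro u hu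
      rw [← ENNReal.pow_le_pow_left_iff two_ne_zero,
        ← ENNReal.pow_le_pow_left_iff (a := eLpNorm (fun z => a z * u z) 2 planeMeasure)
          two_ne_zero, hint u hu]
      exact ⟨le_self_add, le_add_self⟩
    have hfφ : AEStronglyMeasurable (⇑f - φ) planeMeasure :=
      (Lp.aestronglyMeasurable f).sub hφs.continuous.aestronglyMeasurable
    have hφm : MemLp (fun z => a z * φ z) 2 planeMeasure := by
      refine ⟨by have := hφs.continuous.measurable; fun_prop, ?_⟩
      refine (hle φ hφs.continuous.aestronglyMeasurable).2.trans_lt ?_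
      exact (hφs.continuous.memLp_of_hasCompactSupport hφc).2
    refine ⟨(s.toLp 2 planeMeasure, hφm.toLp), ⟨s, rfl, hφm.coeFn_toLp⟩, ?_⟩
    have key : ∀ u v : Lp ℂ 2 planeMeasure, eLpNorm (⇑u - ⇑v) 2 planeMeasure ≤
        ENNReal.ofReal (ε / 2) → dist u v < ε := by
      intro u v huv
      rw [Lp.dist_def]
      exact (ENNReal.toReal_le_of_le_ofReal (half_pos hε).le huv).trans_lt (half_lt_self hε)
    rw [Prod.dist_eq]
    refine max_lt (key _ _ ?_) (key _ _ ?_)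
    · rw [eLpNorm_congr_ae (g := ⇑f - φ)]
      · exact (hle _ hfφ).1.trans hφ
      · filter_upwards [coeFn_toLp s 2 planeMeasure] with z hz
        simp [hz, hsφ]
    · rw [eLpNorm_congr_ae (g := fun z => a z * (⇑f - φ) z)]
      · exact (hle _ hfφ).2.trans hφ
      · filter_upwards [hφm.coeFn_toLp, h] with z h1 h2
        simp [h1, h2, mul_sub]

/-- Isometric changes of the domain and of the range commute with the closure of a graph. -/
theorem mem_closure_image {E F E' F' : Type*} [NormedAddCommGroup E] [NormedSpace ℂ E]
    [NormedAddCommGroup F] [NormedSpace ℂ F] [NormedAddCommGroup E'] [NormedSpace ℂ E']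
    [NormedAddCommGroup F'] [NormedSpace ℂ F'] [CompleteSpace F]
    (W : E' ≃ₗᵢ[ℂ] E) (V : F →ₗᵢ[ℂ] F') (G : Set (E × F)) (A : E') (u : F') :
    (A, u) ∈ closure {P : E' × F' | ∃ g, (W P.1, g) ∈ G ∧ P.2 = V g} ↔
      ∃ g, (W A, g) ∈ closure G ∧ u = V g := by
  have hW : Topology.IsClosedEmbedding W.symm := W.symm.toHomeomorph.isClosedEmbedding
  have hV : Topology.IsClosedEmbedding V := V.isometry.isClosedEmbedding
  have h := (hW.prodMap hV).closure_image_eq G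
  have e : ∀ S : Set (E × F), Prod.map W.symm V '' S =
      {P : E' × F' | ∃ g, (W P.1, g) ∈ S ∧ P.2 = V g} := by
    intro S
    ext ⟨x, y⟩
    constructor
    · rintro ⟨⟨e, f⟩, he, h⟩
      simp only [Prod.map_apply, Prod.mk.injEq] at h
      obtain ⟨rfl, rfl⟩ := h
      exact ⟨f, by simpa using he, rfl⟩
    · rintro ⟨g, hg, hy⟩
      refine ⟨(W x, g), hg, ?_⟩
      simp only [Prod.map_apply, LinearIsometryEquiv.symm_apply_apply, Prod.mk.injEq, true_and]
      exact hy.symm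
  rw [e, e] at h
  rw [h]
  rfl

theorem lintegral_closedBall_id_lt_top (R : ℝ) :
    ∫⁻ z in Metric.closedBall (0 : ℂ) R, ‖z‖ₑ ^ 2 ∂planeMeasure < ∞ := by
  have h : IntegrableOn (fun z : ℂ => ‖z‖ ^ 2) (Metric.closedBall 0 R) planeMeasure :=
    (by fun_prop : Continuous fun z : ℂ => ‖z‖ ^ 2).continuousOn.integrableOn_compact
      (isCompact_closedBall _ _)
  have h2 := h.2
  rw [hasFiniteIntegral_iff_enorm] at h2
  convert h2 using 3 with z
  simp [enorm_pow]

/-- As `A ↦ χ_A` is onto Schwartz functions, `a - b†` on test operators becomes exactly the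
multiplication by `z` on Schwartz functions, which is a core. -/
theorem isSpectralRep_spectralMap : IsSpectralRep modeZGraph planeMeasure spectralMap := by
  intro A C
  have h : modeZGraph = {P : HS × HS | ∃ g, (spectralMap P.1, g) ∈ schwartzMulGraph (fun z => z) ∧
      P.2 = spectralMap.symm.toLinearIsometry g} := by
    ext ⟨A, C⟩
    constructor
    · rintro ⟨K, rfl, hC⟩
      have hC' : C = toHS (modeSchwartz (1 / 2) K) := by
        refine Lp.ext ?_
        filter_upwards [hC, coeFn_toLp (modeSchwartz (1 / 2) K) 2 volume] with p h1 h2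
        rw [h1, modeZ_schwartz]
        exact h2.symm
      refine ⟨spectralMap C, ⟨symbolEquiv K, spectralMap_toHS K, ?_⟩, by simp⟩
      rw [hC']
      filter_upwards [spectralMap_toHS_ae (modeSchwartz (1 / 2) K)] with z hz
      rw [hz, ← modeZ_schwartz, charFn_modeZ, symbolEquiv_apply]
    · rintro ⟨g, ⟨s, hs, hg⟩, hC⟩
      refine ⟨symbolEquiv.symm s, ?_, ?_⟩
      · apply spectralMap.injective
        rw [spectralMap_toHS]
        simpa using hs
      · have hC' : C = toHS (modeSchwartz (1 / 2) (symbolEquiv.symm s)) := by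
          apply spectralMap.injective
          have h1 : spectralMap C = g := by
            have : C = spectralMap.symm g := hC
            simp [this]
          rw [h1]
          refine Lp.ext ?_
          filter_upwards [hg, spectralMap_toHS_ae (modeSchwartz (1 / 2) (symbolEquiv.symm s))]
            with z h2 h3
          rw [h2, h3, ← modeZ_schwartz, charFn_modeZ, ← symbolEquiv_apply]
          simp
        rw [modeZ_schwartz]
        simp only [hC']
        exact coeFn_toLp (modeSchwartz (1 / 2) (symbolEquiv.symm s)) 2 volume
  rw [h, mem_closure_image]
  constructor
  · rintro ⟨g, hg, rfl⟩
    have := (mem_closure_schwartzMulGraph measurable_id' lintegral_closedBall_id_lt_top _ _).1 hg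
    filter_upwards [this] with z hz
    simpa using hz
  · intro hC
    exact ⟨spectralMap C, (mem_closure_schwartzMulGraph measurable_id'
      lintegral_closedBall_id_lt_top _ _).2 hC, by simp⟩

/-! ### The Fourier transform in one variable of a family of `L²` functions -/

/-- Plancherel's theorem for integrable, square integrable functions. -/
theorem lintegral_fourierInv {f : ℝ → ℂ} (h1 : Integrable f) (h2 : MemLp f 2 volume) :
    ∫⁻ x, ‖𝓕⁻ f x‖ₑ ^ 2 = ∫⁻ x, ‖f x‖ₑ ^ 2 := by
  set F : Lp ℂ 2 (volume : Measure ℝ) := h2.toLp with hF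
  have hc : Continuous (𝓕 f) := VectorFourier.fourierIntegral_continuous
    Real.continuous_fourierChar (by fun_prop) h1
  -- the `L²` Fourier transform and the integral agree as tempered distributions
  have hae : ⇑(𝓕 F : Lp ℂ 2 (volume : Measure ℝ)) =ᵐ[volume] 𝓕 f := by
    refine ae_eq_of_integral_contDiff_smul_eq ?_ hc.locallyIntegrable fun g hg hgc => ?_
    · exact (Lp.memLp _).locallyIntegrable one_le_two
    · have hs : HasCompactSupport fun x => (g x : ℂ) := hgc.comp_left (g := ((↑) : ℝ → ℂ)) rfl
      have hsm : ContDiff ℝ ((⊤ : ℕ∞) : WithTop ℕ∞) fun x => (g x : ℂ) :=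
        Complex.ofRealCLM.contDiff.comp hg
      set s : 𝓢(ℝ, ℂ) := hs.toSchwartzMap hsm with hsdef
      have e := DFunLike.congr_fun (Lp.fourier_toTemperedDistribution_eq F) s
      rw [TemperedDistribution.fourier_apply, Lp.toTemperedDistribution_apply,
        Lp.toTemperedDistribution_apply] at e
      have e2 : ∫ x, 𝓕 f x • s x = ∫ x, f x • 𝓕 (s : ℝ → ℂ) x := by
        have := VectorFourier.integral_fourierIntegral_smul_eq_flip (L := innerₗ ℝ)
          (ν := (volume : Measure ℝ)) Real.continuous_fourierChar continuous_inner h1 s.integrable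
        rw [flip_innerₗ] at this
        exact this
      have e3 : ∫ x, (𝓕 s : 𝓢(ℝ, ℂ)) x • F x = ∫ x, f x • 𝓕 (s : ℝ → ℂ) x := by
        refine integral_congr_ae ?_
        filter_upwards [h2.coeFn_toLp] with x hx
        rw [hF, hx, fourier_coe, smul_eq_mul, smul_eq_mul, mul_comm]
      have e4 : ∀ u : ℝ → ℂ, ∫ x, g x • u x = ∫ x, s x • u x := fun u => by
        congr 1
      rw [e4, e4, ← e, e3, ← e2]
      congr 1 with x
      rw [smul_eq_mul, smul_eq_mul, mul_comm]
  have h3 : ∫⁻ x, ‖𝓕 f x‖ₑ ^ 2 = ∫⁻ x, ‖f x‖ₑ ^ 2 := by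
    rw [← eLpNorm_two_eq_iff, ← eLpNorm_congr_ae hae, ← eLpNorm_congr_ae h2.coeFn_toLp]
    have := Lp.norm_fourier_eq F
    rwa [Lp.norm_def, Lp.norm_def, ENNReal.toReal_eq_toReal_iff' (Lp.eLpNorm_ne_top _)
      (Lp.eLpNorm_ne_top _)] at this
  rw [← h3, ← (Measure.measurePreserving_neg (volume : Measure ℝ)).lintegral_comp
    (f := fun x => ‖𝓕 f x‖ₑ ^ 2) (by have := hc.measurable; fun_prop)]
  simp_rw [Real.fourierInv_eq_fourier_neg]

theorem integrable_fourierChar_smul {f : ℝ → ℂ} (h : Integrable f) (x : ℝ) :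
    Integrable fun v => Real.fourierChar (inner ℝ v x) • f v := by
  have := (Real.fourierIntegral_convergent_iff (-x)).2 h
  simpa only [inner_neg_right, neg_neg] using this

section Slices

variable {α : Type*} [MeasurableSpace α]

/-- The inverse Fourier transform of a family of functions of one variable. -/
def sliceFourierInv (g : α × ℝ → ℂ) (p : α × ℝ) : ℂ := 𝓕⁻ (fun k => g (p.1, k)) p.2

theorem ae_fst_of_ae {ν : Measure α} {P : α → Prop} (h : ∀ᵐ a ∂ν, P a) :
    ∀ᵐ p ∂ν.prod (volume : Measure ℝ), P p.1 :=
  Measure.quasiMeasurePreserving_fst.ae h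

theorem sliceFourierInv_congr {ν : Measure α} [SFinite ν] {f g : α × ℝ → ℂ}
    (h : f =ᵐ[ν.prod volume] g) : sliceFourierInv f =ᵐ[ν.prod volume] sliceFourierInv g := by
  filter_upwards [ae_fst_of_ae (Measure.ae_ae_of_ae_prod h)] with p hp
  simp only [sliceFourierInv, Real.fourierInv_eq]
  refine integral_congr_ae ?_
  filter_upwards [hp] with k hk
  rw [hk]

theorem aestronglyMeasurable_sliceFourierInv {ν : Measure α} [SFinite ν] {g : α × ℝ → ℂ}
    (hg : AEStronglyMeasurable g (ν.prod volume)) :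
    AEStronglyMeasurable (sliceFourierInv g) (ν.prod volume) := by
  refine AEStronglyMeasurable.congr (f := sliceFourierInv (hg.mk g)) ?_
    (sliceFourierInv_congr hg.ae_eq_mk.symm)
  refine StronglyMeasurable.aestronglyMeasurable ?_
  have h : sliceFourierInv (hg.mk g) = fun p : α × ℝ => ∫ k : ℝ,
      Complex.exp (((2 * Real.pi * inner ℝ k p.2 : ℝ) : ℂ) * Complex.I) * hg.mk g (p.1, k) := by
    ext p
    rw [sliceFourierInv, Real.fourierInv_eq']
    rfl
  rw [h]
  refine StronglyMeasurable.integral_prod_right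
    (f := fun (p : α × ℝ) (k : ℝ) =>
      Complex.exp (((2 * Real.pi * inner ℝ k p.2 : ℝ) : ℂ) * Complex.I) * hg.mk g (p.1, k)) ?_
  refine Measurable.stronglyMeasurable ?_
  have := hg.stronglyMeasurable_mk.measurable
  fun_prop

/-- The square integrable families of functions such that almost all members are integrable. -/
def sliceIntegrable (ν : Measure α) [SFinite ν] :
    Submodule ℂ (Lp ℂ 2 (ν.prod (volume : Measure ℝ))) where
  carrier := {g | ∀ᵐ a ∂ν, Integrable fun k => g (a, k)}
  zero_mem' := by
    filter_upwards [Measure.ae_ae_of_ae_prod (Lp.coeFn_zero ℂ 2 (ν.prod (volume : Measure ℝ)))]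
      with a ha
    exact (integrable_zero ℝ ℂ volume).congr (by filter_upwards [ha] with k hk; exact hk.symm)
  add_mem' {f g} hf hg := by
    change ∀ᵐ a ∂ν, _
    filter_upwards [Measure.ae_ae_of_ae_prod (Lp.coeFn_add f g), hf, hg] with a ha h1 h2
    exact (h1.add h2).congr (by filter_upwards [ha] with k hk; exact hk.symm)
  smul_mem' c g hg := by
    change ∀ᵐ a ∂ν, _
    filter_upwards [Measure.ae_ae_of_ae_prod (Lp.coeFn_smul c g), hg] with a ha h1
    exact (h1.smul c).congr (by filter_upwards [ha] with k hk; exact hk.symm)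

theorem lintegral_sliceFourierInv {ν : Measure α} [SFinite ν] {g : α × ℝ → ℂ}
    (h2 : MemLp g 2 (ν.prod volume)) (h1 : ∀ᵐ a ∂ν, Integrable fun k => g (a, k)) :
    ∫⁻ p, ‖sliceFourierInv g p‖ₑ ^ 2 ∂ν.prod volume = ∫⁻ p, ‖g p‖ₑ ^ 2 ∂ν.prod volume := by
  have hgm := h2.aestronglyMeasurable
  have hsm := aestronglyMeasurable_sliceFourierInv hgm
  have hfin := (memLp_two_iff hgm).1 h2
  have m1 : AEMeasurable (fun p => ‖g p‖ₑ ^ 2) (ν.prod volume) := hgm.enorm.pow_const 2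
  rw [lintegral_prod _ m1] at hfin
  have m2 : AEMeasurable (fun p => ‖sliceFourierInv g p‖ₑ ^ 2) (ν.prod volume) :=
    hsm.enorm.pow_const 2
  rw [lintegral_prod _ m2, lintegral_prod _ m1]
  have hfin' : ∀ᵐ a ∂ν, ∫⁻ k, ‖g (a, k)‖ₑ ^ 2 < ∞ :=
    ae_lt_top' m1.lintegral_prod_right' hfin.ne
  refine lintegral_congr_ae ?_
  filter_upwards [h1, hfin'] with a ha hb
  have h3 : MemLp (fun k => g (a, k)) 2 volume := (memLp_two_iff ha.aestronglyMeasurable).2 hb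
  have h4 := lintegral_fourierInv ha h3
  simpa only [sliceFourierInv] using h4

theorem memLp_sliceFourierInv {ν : Measure α} [SFinite ν] {g : α × ℝ → ℂ}
    (h2 : MemLp g 2 (ν.prod volume)) (h1 : ∀ᵐ a ∂ν, Integrable fun k => g (a, k)) :
    MemLp (sliceFourierInv g) 2 (ν.prod volume) := by
  rw [memLp_two_iff (aestronglyMeasurable_sliceFourierInv h2.aestronglyMeasurable),
    lintegral_sliceFourierInv h2 h1]
  exact (memLp_two_iff h2.aestronglyMeasurable).1 h2

/-- The inverse Fourier transform in the second variable, on families with integrable members. -/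
def sliceFourierInvAux (ν : Measure α) [SFinite ν] :
    sliceIntegrable ν →ₗ[ℂ] Lp ℂ 2 (ν.prod (volume : Measure ℝ)) where
  toFun g := (memLp_sliceFourierInv (Lp.memLp g.1) g.2).toLp
  map_add' f g := by
    refine Lp.ext ?_
    filter_upwards [(memLp_sliceFourierInv (Lp.memLp (f + g).1) (f + g).2).coeFn_toLp,
      (memLp_sliceFourierInv (Lp.memLp f.1) f.2).coeFn_toLp,
      (memLp_sliceFourierInv (Lp.memLp g.1) g.2).coeFn_toLp,
      Lp.coeFn_add ((memLp_sliceFourierInv (Lp.memLp f.1) f.2).toLp)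
        ((memLp_sliceFourierInv (Lp.memLp g.1) g.2).toLp),
      sliceFourierInv_congr (Lp.coeFn_add f.1 g.1), ae_fst_of_ae f.2, ae_fst_of_ae g.2]
      with p e1 e2 e3 e4 e5 i1 i2
    rw [e1, e4, Pi.add_apply, e2, e3]
    refine e5.trans ?_
    simp only [sliceFourierInv, Real.fourierInv_eq, Pi.add_apply, smul_add]
    exact integral_add (integrable_fourierChar_smul i1 p.2) (integrable_fourierChar_smul i2 p.2)
  map_smul' c g := by
    refine Lp.ext ?_
    filter_upwards [(memLp_sliceFourierInv (Lp.memLp (c • g).1) (c • g).2).coeFn_toLp,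
      (memLp_sliceFourierInv (Lp.memLp g.1) g.2).coeFn_toLp,
      Lp.coeFn_smul c ((memLp_sliceFourierInv (Lp.memLp g.1) g.2).toLp),
      sliceFourierInv_congr (Lp.coeFn_smul c g.1)]
      with p e1 e2 e3 e4
    rw [e1, RingHom.id_apply, e3, Pi.smul_apply, e2]
    refine e4.trans ?_
    simp only [sliceFourierInv, Real.fourierInv_eq, Pi.smul_apply, smul_comm _ c]
    exact integral_smul _ _

theorem norm_sliceFourierInvAux (ν : Measure α) [SFinite ν] (g : sliceIntegrable ν) :
    ‖sliceFourierInvAux ν g‖ = ‖(sliceIntegrable ν).subtype g‖ := by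
  refine norm_toLp_eq_of_lintegral _ _ ?_
  have h := (memLp_sliceFourierInv (Lp.memLp g.1) g.2).coeFn_toLp
  have h' : ∫⁻ p, ‖sliceFourierInvAux ν g p‖ₑ ^ 2 ∂ν.prod volume =
      ∫⁻ p, ‖sliceFourierInv g.1 p‖ₑ ^ 2 ∂ν.prod volume := by
    refine lintegral_congr_ae ?_
    filter_upwards [h] with p hp
    rw [← hp]
    rfl
  rw [h', lintegral_sliceFourierInv (Lp.memLp g.1) g.2]
  rfl

theorem denseRange_sliceIntegrable (ν : Measure α) [SFinite ν] :
    DenseRange (sliceIntegrable ν).subtype := by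
  refine (Lp.simpleFunc.dense (E := ℂ) (p := 2) (μ := ν.prod (volume : Measure ℝ))
    ENNReal.ofNat_ne_top).mono ?_
  intro f hf
  refine ⟨⟨f, ?_⟩, rfl⟩
  have h1 := Lp.simpleFunc.toSimpleFunc_eq_toFun ⟨f, hf⟩
  have h2 : MemLp (Lp.simpleFunc.toSimpleFunc ⟨f, hf⟩) 2 (ν.prod (volume : Measure ℝ)) :=
    Lp.simpleFunc.memLp ⟨f, hf⟩
  rw [SimpleFunc.memLp_iff_integrable two_ne_zero ENNReal.ofNat_ne_top] at h2
  exact (h2.congr h1).prod_right_ae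

/-- The inverse Fourier transform in the second variable, as an isometry: the continuous extension
from families with integrable members, which are dense. -/
def sliceFourierInvLI (ν : Measure α) [SFinite ν] :
    Lp ℂ 2 (ν.prod (volume : Measure ℝ)) →ₗᵢ[ℂ] Lp ℂ 2 (ν.prod (volume : Measure ℝ)) where
  toLinearMap := ((sliceFourierInvAux ν).extendOfNorm (sliceIntegrable ν).subtype).toLinearMap
  norm_map' f := by
    refine (denseRange_sliceIntegrable ν).induction_on (p := fun f =>
      ‖(sliceFourierInvAux ν).extendOfNorm (sliceIntegrable ν).subtype f‖ = ‖f‖) f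
      (isClosed_eq (by fun_prop) (by fun_prop)) fun g => ?_
    rw [LinearMap.extendOfNorm_eq (denseRange_sliceIntegrable ν)
      ⟨1, fun g => by rw [norm_sliceFourierInvAux, one_mul]⟩, norm_sliceFourierInvAux]

theorem sliceFourierInvLI_apply {ν : Measure α} [SFinite ν]
    (g : Lp ℂ 2 (ν.prod (volume : Measure ℝ))) {b : α × ℝ → ℂ} (hb : ⇑g =ᵐ[ν.prod volume] b)
    (h : ∀ᵐ a ∂ν, Integrable fun k => b (a, k)) :
    ⇑(sliceFourierInvLI ν g) =ᵐ[ν.prod volume] sliceFourierInv b := by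
  have hg : g ∈ sliceIntegrable ν := by
    filter_upwards [h, Measure.ae_ae_of_ae_prod hb] with a h1 h2
    exact h1.congr (by filter_upwards [h2] with k hk; rw [hk])
  have e : sliceFourierInvLI ν g = sliceFourierInvAux ν ⟨g, hg⟩ :=
    LinearMap.extendOfNorm_eq (denseRange_sliceIntegrable ν)
      ⟨1, fun g => by rw [norm_sliceFourierInvAux, one_mul]⟩ (⟨g, hg⟩ : sliceIntegrable ν)
  rw [e]
  exact (memLp_sliceFourierInv (Lp.memLp g) hg).coeFn_toLp.trans (sliceFourierInv_congr hb)

end Slices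

/-! ### Polar coordinates on the plane with signed radius -/

/-- The probability measure `dφ/π` on `[0, π)`. -/
def angleMeasure : Measure ℝ :=
  ENNReal.ofReal (1 / Real.pi) • volume.restrict (Set.Ico 0 Real.pi)

instance : IsFiniteMeasure angleMeasure := by
  constructor
  rw [angleMeasure, Measure.smul_apply, Measure.restrict_apply_univ, Real.volume_Ico, smul_eq_mul]
  exact ENNReal.mul_lt_top ENNReal.ofReal_lt_top ENNReal.ofReal_lt_top

theorem ae_angleMeasure {p : ℝ → Prop} :
    (∀ᵐ φ ∂angleMeasure, p φ) ↔ ∀ᵐ φ ∂volume.restrict (Set.Ico 0 Real.pi), p φ := by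
  rw [angleMeasure, Measure.ae_ennreal_smul_measure_iff]
  simp [Real.pi_pos]

/-- The ray `κ ↦ π i κ e^{iφ}`, on which `D(z) = exp(2πiκ X_φ)`. -/
def polarMap (q : ℝ × ℝ) : ℂ := Real.pi * Complex.I * q.2 * Complex.exp (Complex.I * q.1)

theorem continuous_polarMap : Continuous polarMap := by
  unfold polarMap
  fun_prop

theorem norm_polarMap (q : ℝ × ℝ) : ‖polarMap q‖ = Real.pi * |q.2| := by
  rw [polarMap, norm_mul, mul_comm Complex.I (q.1 : ℂ), Complex.norm_exp_ofReal_mul_I]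
  simp [abs_of_pos Real.pi_pos]

theorem polarMap_sub_pi (φ κ : ℝ) : polarMap (φ - Real.pi, κ) = polarMap (φ, -κ) := by
  simp only [polarMap]
  push_cast
  rw [mul_sub, mul_comm Complex.I (Real.pi : ℂ), Complex.exp_sub, Complex.exp_pi_mul_I]
  ring

theorem lintegral_Ioi_comp_mul {c : ℝ} (hc : 0 < c) {f : ℝ → ℝ≥0∞} (hf : Measurable f) :
    ∫⁻ r in Set.Ioi (0 : ℝ), f r = ∫⁻ κ in Set.Ioi (0 : ℝ), ENNReal.ofReal c * f (c * κ) := by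
  have h1 : MeasurePreserving (fun y : ℝ => c * y) volume (ENNReal.ofReal (1 / c) • volume) := by
    refine ⟨by fun_prop, ?_⟩
    rw [Real.map_volume_mul_left hc.ne', abs_of_pos (by positivity), one_div]
  have h2 := h1.setLIntegral_comp_preimage (s := Set.Ioi 0) measurableSet_Ioi hf
  have h3 : (fun y : ℝ => c * y) ⁻¹' Set.Ioi 0 = Set.Ioi 0 := by
    ext y
    simp [hc]
  rw [h3] at h2
  rw [lintegral_const_mul _ (by fun_prop), h2, Measure.restrict_smul,
    lintegral_smul_measure, smul_eq_mul, ← mul_assoc, ← ENNReal.ofReal_mul hc.le]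
  simp [hc.ne']

/-- Integration in polar coordinates: `d²z/π` is `π² |κ| dκ dφ/π` for `z = π i κ e^{iφ}`. -/
theorem lintegral_polarMap {f : ℂ → ℝ≥0∞} (hf : Measurable f) :
    ∫⁻ z, f z ∂planeMeasure =
      ∫⁻ q, ENNReal.ofReal (Real.pi ^ 2 * |q.2|) * f (polarMap q) ∂angleMeasure.prod volume := by
  have hpi := Real.pi_pos
  have hpm := continuous_polarMap.measurable
  set J : ℝ → ℝ≥0∞ := fun θ =>
    ∫⁻ κ in Set.Ioi (0 : ℝ), ENNReal.ofReal (Real.pi ^ 2 * κ) * f (polarMap (θ, κ)) with hJ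
  have hJm : Measurable J := by
    refine Measurable.lintegral_prod_right'
      (f := fun q : ℝ × ℝ => ENNReal.ofReal (Real.pi ^ 2 * q.2) * f (polarMap q)) ?_
    fun_prop
  -- the factor `i` in `polarMap`
  have hrot : ∫⁻ z, f z = ∫⁻ z, f (Complex.I * z) := by
    have h : MeasurePreserving (rotation (⟨Complex.I, by simp [Submonoid.unitSphere]⟩ : Circle))
        (volume : Measure ℂ) volume := LinearIsometryEquiv.measurePreserving _
    rw [← h.lintegral_comp hf]
    rfl
  have hplane : ∫⁻ z, f z = ∫⁻ θ in Set.Ioo (-Real.pi) Real.pi, J θ := by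
    rw [hrot, ← Complex.lintegral_comp_polarCoord_symm]
    change ∫⁻ p in Set.Ioi (0 : ℝ) ×ˢ Set.Ioo (-Real.pi) Real.pi, _ = _
    simp only [Complex.polarCoord_symm_apply, smul_eq_mul]
    rw [Measure.volume_eq_prod, ← Measure.prod_restrict, lintegral_prod_symm' _ (by fun_prop)]
    refine lintegral_congr fun θ => ?_
    rw [lintegral_Ioi_comp_mul hpi (f := fun r => ENNReal.ofReal r *
      f (Complex.I * (r * (Real.cos θ + Real.sin θ * Complex.I)))) (by fun_prop), hJ]
    refine setLIntegral_congr_fun measurableSet_Ioi fun κ _ => ?_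
    rw [← mul_assoc, ← ENNReal.ofReal_mul hpi.le, polarMap, mul_comm Complex.I (θ : ℂ),
      Complex.exp_mul_I]
    congr 2
    · ring_nf
    · push_cast
      ring
  -- the lower half of the circle is reached with negative `κ`
  have hneg : ∀ φ, ∫⁻ κ in Set.Iic (0 : ℝ), ENNReal.ofReal (Real.pi ^ 2 * |κ|) *
      f (polarMap (φ, κ)) = J (φ - Real.pi) := by
    intro φ
    rw [← setLIntegral_congr (Iio_ae_eq_Iic (a := (0 : ℝ)) (μ := volume)), hJ]
    rw [← (Measure.measurePreserving_neg (volume : Measure ℝ)).setLIntegral_comp_preimage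
      measurableSet_Iio (by fun_prop)]
    simp only [Set.neg_preimage, Set.neg_Iio, neg_zero, abs_neg]
    refine setLIntegral_congr_fun measurableSet_Ioi fun κ hκ => ?_
    simp only [polarMap_sub_pi, abs_of_pos (Set.mem_Ioi.1 hκ)]
  have hpos : ∀ φ, ∫⁻ κ in Set.Ioi (0 : ℝ), ENNReal.ofReal (Real.pi ^ 2 * |κ|) *
      f (polarMap (φ, κ)) = J φ := by
    intro φ
    refine setLIntegral_congr_fun measurableSet_Ioi fun κ hκ => ?_
    simp only [abs_of_pos (Set.mem_Ioi.1 hκ)]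
  have hsplit : ∀ φ, ∫⁻ κ, ENNReal.ofReal (Real.pi ^ 2 * |κ|) * f (polarMap (φ, κ)) =
      J (φ - Real.pi) + J φ := by
    intro φ
    rw [← lintegral_add_compl _ (measurableSet_Iic (a := (0 : ℝ))), Set.compl_Iic, hneg, hpos]
  have hshift : ∫⁻ φ in Set.Ico 0 Real.pi, J (φ - Real.pi) =
      ∫⁻ θ in Set.Ico (-Real.pi) 0, J θ := by
    rw [← (measurePreserving_sub_right (volume : Measure ℝ) Real.pi).setLIntegral_comp_preimage
      measurableSet_Ico hJm]
    simp
  rw [lintegral_prod _ (by fun_prop), planeMeasure, angleMeasure, lintegral_smul_measure,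
    lintegral_smul_measure, hplane]
  congr 1
  simp only [hsplit]
  rw [lintegral_add_left (by fun_prop), hshift,
    ← lintegral_union measurableSet_Ico (Set.disjoint_left.2 fun x h1 h2 => by
      exact absurd h1.2 (not_lt.2 h2.1)),
    Set.Ico_union_Ico_eq_Ico (by linarith) hpi.le]
  exact setLIntegral_congr Ioo_ae_eq_Ico

theorem ae_polarMap {p : ℂ → Prop} (h : ∀ᵐ z ∂planeMeasure, p z) :
    ∀ᵐ q ∂angleMeasure.prod (volume : Measure ℝ), p (polarMap q) := by
  obtain ⟨t, hts, htm, ht0⟩ := exists_measurable_superset_of_null (ae_iff.1 h)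
  have h1 := lintegral_polarMap (f := t.indicator 1) (measurable_one.indicator htm)
  rw [lintegral_indicator_one htm, ht0, eq_comm, lintegral_eq_zero_iff
    (by have := continuous_polarMap.measurable; exact (by fun_prop : Measurable _).mul
          ((measurable_one.indicator htm).comp this))] at h1
  have h2 : ∀ᵐ q ∂angleMeasure.prod (volume : Measure ℝ), q.2 ≠ 0 :=
    Measure.quasiMeasurePreserving_snd.ae (Measure.ae_ne volume 0)
  filter_upwards [h1, h2] with q h3 h4
  by_contra hq
  have h5 : polarMap q ∈ t := hts hq
  simp only [Set.indicator_of_mem h5, Pi.one_apply, mul_one, Pi.zero_apply,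
    ENNReal.ofReal_eq_zero] at h3
  have : 0 < Real.pi ^ 2 * |q.2| := by positivity
  linarith

/-- The lift of a function on the plane to polar coordinates, multiplied by the square root of the
Jacobian. -/
def polarLift (f : ℂ → ℂ) (q : ℝ × ℝ) : ℂ := ((Real.pi * √|q.2| : ℝ) : ℂ) * f (polarMap q)

theorem polarLift_congr {f g : ℂ → ℂ} (h : f =ᵐ[planeMeasure] g) :
    polarLift f =ᵐ[angleMeasure.prod volume] polarLift g := by
  filter_upwards [ae_polarMap h] with q hq
  simp only [polarLift, hq]

theorem enorm_polarLift (f : ℂ → ℂ) (q : ℝ × ℝ) :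
    ‖polarLift f q‖ₑ ^ 2 = ENNReal.ofReal (Real.pi ^ 2 * |q.2|) * ‖f (polarMap q)‖ₑ ^ 2 := by
  rw [polarLift, enorm_mul, mul_pow]
  congr 1
  rw [← ofReal_norm, ← ENNReal.ofReal_pow (norm_nonneg _), Complex.norm_real,
    Real.norm_of_nonneg (mul_nonneg Real.pi_pos.le (Real.sqrt_nonneg _)), mul_pow,
    Real.sq_sqrt (abs_nonneg _)]

theorem lintegral_polarLift {f : ℂ → ℂ} (hf : Measurable f) :
    ∫⁻ q, ‖polarLift f q‖ₑ ^ 2 ∂angleMeasure.prod volume = ∫⁻ z, ‖f z‖ₑ ^ 2 ∂planeMeasure := by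
  rw [lintegral_polarMap (by fun_prop)]
  simp only [enorm_polarLift]

theorem measurable_polarLift {f : ℂ → ℂ} (hf : Measurable f) : Measurable (polarLift f) := by
  have := continuous_polarMap.measurable
  unfold polarLift
  fun_prop

theorem memLp_polarLift (f : Lp ℂ 2 planeMeasure) :
    MemLp (polarLift f) 2 (angleMeasure.prod volume) := by
  have hf := (Lp.stronglyMeasurable f).measurable
  rw [memLp_two_iff (measurable_polarLift hf).aestronglyMeasurable, lintegral_polarLift hf]
  exact (memLp_two_iff (Lp.aestronglyMeasurable f)).1 (Lp.memLp f)

/-- Polar coordinates as an isometry of `L²` spaces. -/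
def polarLI : Lp ℂ 2 planeMeasure →ₗᵢ[ℂ] Lp ℂ 2 (angleMeasure.prod (volume : Measure ℝ)) where
  toFun f := (memLp_polarLift f).toLp
  map_add' f g := by
    refine Lp.ext ?_
    filter_upwards [(memLp_polarLift (f + g)).coeFn_toLp, (memLp_polarLift f).coeFn_toLp,
      (memLp_polarLift g).coeFn_toLp, Lp.coeFn_add (memLp_polarLift f).toLp
      (memLp_polarLift g).toLp, polarLift_congr (Lp.coeFn_add f g)] with q e1 e2 e3 e4 e5
    rw [e1, e4, e5, Pi.add_apply, e2, e3]
    simp only [polarLift, Pi.add_apply, mul_add]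
  map_smul' c f := by
    refine Lp.ext ?_
    filter_upwards [(memLp_polarLift (c • f)).coeFn_toLp, (memLp_polarLift f).coeFn_toLp,
      Lp.coeFn_smul c (memLp_polarLift f).toLp, polarLift_congr (Lp.coeFn_smul c f)]
      with q e1 e2 e4 e5
    rw [e1, RingHom.id_apply, e4, e5, Pi.smul_apply, e2]
    simp only [polarLift, Pi.smul_apply, smul_eq_mul]
    ring
  norm_map' f := by
    refine norm_toLp_eq_of_lintegral _ _ ?_
    rw [← lintegral_polarLift (Lp.stronglyMeasurable f).measurable]
    refine lintegral_congr_ae ?_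
    filter_upwards [(memLp_polarLift f).coeFn_toLp] with q hq
    rw [← hq]
    rfl

/-- The isometry from functions of `z` to coefficients of the quorum, `(φ, x)`: polar coordinates,
followed by the inverse Fourier transform of the signed radius. -/
def quorumLI : Lp ℂ 2 planeMeasure →ₗᵢ[ℂ] Coeffs := (sliceFourierInvLI angleMeasure).comp polarLI

theorem quorumLI_apply (f : Lp ℂ 2 planeMeasure) {b : ℝ × ℝ → ℂ}
    (hb : polarLift f =ᵐ[angleMeasure.prod volume] b)
    (h : ∀ᵐ φ ∂angleMeasure, Integrable fun k => b (φ, k)) :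
    ⇑(quorumLI f) =ᵐ[quorumMeasure] sliceFourierInv b :=
  sliceFourierInvLI_apply (polarLI f) ((memLp_polarLift f).coeFn_toLp.trans hb) h

/-! ### Multipliers -/

/-- The signed wave number `k` with `z = (i/2) k e^{iφ}` for some `φ ∈ [0, π)`; the value on the
imaginary axis, a null set, is irrelevant. -/
def waveNumber (z : ℂ) : ℝ := -(2 * ‖z‖) * SignType.sign z.re

theorem measurable_sign_real : Measurable fun x : ℝ => ((SignType.sign x : SignType) : ℝ) := by
  have : (fun x : ℝ => ((SignType.sign x : SignType) : ℝ)) =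
      fun x => if 0 < x then 1 else if x < 0 then -1 else 0 := by
    ext x
    rw [sign_apply]
    split_ifs <;> simp
  rw [this]
  exact Measurable.ite measurableSet_Ioi measurable_const
    (Measurable.ite measurableSet_Iio measurable_const measurable_const)

theorem measurable_waveNumber : Measurable waveNumber := by
  have := measurable_sign_real.comp Complex.measurable_re
  have h2 : Measurable fun z : ℂ => -(2 * ‖z‖) := by fun_prop
  exact h2.mul this

theorem waveNumber_polarMap {φ : ℝ} (hφ : φ ∈ Set.Ioo 0 Real.pi) (κ : ℝ) :
    waveNumber (polarMap (φ, κ)) = 2 * Real.pi * κ := by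
  have hs := Real.sin_pos_of_mem_Ioo hφ
  have hre : (polarMap (φ, κ)).re = -(Real.pi * Real.sin φ) * κ := by
    simp only [polarMap]
    rw [mul_comm Complex.I (φ : ℂ), Complex.exp_mul_I, ← Complex.ofReal_cos, ← Complex.ofReal_sin]
    simp [-Complex.ofReal_sin, -Complex.ofReal_cos]
    ring
  have hneg : SignType.sign (-(Real.pi * Real.sin φ)) = -1 := by
    rw [sign_eq_neg_one_iff]
    have := mul_pos Real.pi_pos hs
    linarith
  rw [waveNumber, norm_polarMap, hre, sign_mul, hneg]
  rcases lt_trichotomy κ 0 with h | h | h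
  · simp [sign_neg h, abs_of_neg h]
    ring
  · simp [h]
  · simp [sign_pos h, abs_of_pos h]
    ring

theorem ae_waveNumber_polarMap : ∀ᵐ q ∂angleMeasure.prod (volume : Measure ℝ),
    waveNumber (polarMap q) = 2 * Real.pi * q.2 := by
  have h : ∀ᵐ φ ∂angleMeasure, φ ∈ Set.Ioo 0 Real.pi := by
    rw [ae_angleMeasure, ← Measure.restrict_congr_set Ioo_ae_eq_Ico]
    exact ae_restrict_mem measurableSet_Ioo
  filter_upwards [ae_fst_of_ae h] with q hq
  exact waveNumber_polarMap hq q.2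

theorem ae_snd_of_ae {P : ℝ → Prop} (h : ∀ᵐ k, P k) :
    ∀ᵐ q ∂angleMeasure.prod (volume : Measure ℝ), P (2 * Real.pi * q.2) := by
  have h1 : Measure.QuasiMeasurePreserving (fun κ : ℝ => 2 * Real.pi * κ) volume volume := by
    refine ⟨by fun_prop, ?_⟩
    rw [Real.map_volume_mul_left (by positivity)]
    exact Measure.smul_absolutelyContinuous
  have h2 : ∀ᵐ κ : ℝ, P (2 * Real.pi * κ) := h1.ae h
  exact Measure.quasiMeasurePreserving_snd.ae h2

theorem ae_waveNumber {P : ℝ → Prop} (h : ∀ᵐ k, P k) :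
    ∀ᵐ z ∂planeMeasure, P (waveNumber z) := by
  obtain ⟨t, hts, htm, ht0⟩ := exists_measurable_superset_of_null (ae_iff.1 h)
  have hm : MeasurableSet (waveNumber ⁻¹' t) := measurable_waveNumber htm
  refine ae_iff.2 (measure_mono_null (t := waveNumber ⁻¹' t) (fun z hz => hts hz) ?_)
  rw [← lintegral_indicator_one hm, lintegral_polarMap (measurable_one.indicator hm)]
  refine lintegral_eq_zero_of_ae_eq_zero ?_
  have h3 : ∀ᵐ k, k ∉ t := measure_eq_zero_iff_ae_notMem.1 ht0
  filter_upwards [ae_waveNumber_polarMap, ae_snd_of_ae h3] with q h1 h2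
  have : polarMap q ∉ waveNumber ⁻¹' t := by rwa [Set.mem_preimage, h1]
  simp [this]

/-- The multiplier `conj H(k) / √(π |z|)` through which the coefficients of `h(X_φ - x)` depend on
the characteristic function, for `h = 𝓕[H]` and `z = (i/2) k e^{iφ}`. -/
def analysisMultiplier (H : ℝ → ℂ) (z : ℂ) : ℂ :=
  conj (H (waveNumber z)) / ((√(Real.pi * ‖z‖) : ℝ) : ℂ)

theorem measurable_analysisMultiplier {H : ℝ → ℂ} (hH : Measurable H) :
    Measurable (analysisMultiplier H) := by
  have := hH.comp measurable_waveNumber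
  unfold analysisMultiplier
  exact (Complex.continuous_conj.measurable.comp this).div (by fun_prop)

theorem norm_analysisMultiplier_sq (H : ℝ → ℂ) (z : ℂ) :
    ‖analysisMultiplier H z‖ ^ 2 = ‖H (waveNumber z)‖ ^ 2 / (Real.pi * ‖z‖) := by
  rw [analysisMultiplier, norm_div, div_pow, Complex.norm_conj, Complex.norm_real,
    Real.norm_of_nonneg (Real.sqrt_nonneg _),
    Real.sq_sqrt (mul_nonneg Real.pi_pos.le (norm_nonneg _))]

/-- The factor `1 / √(π |z|)` of the multiplier cancels the square root of the Jacobian. -/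
theorem polarLift_analysisMultiplier (H : ℝ → ℂ) (f : ℂ → ℂ) :
    polarLift (fun z => analysisMultiplier H z * f z) =ᵐ[angleMeasure.prod volume]
      fun q => conj (H (2 * Real.pi * q.2)) * f (polarMap q) := by
  have h2 : ∀ᵐ q ∂angleMeasure.prod (volume : Measure ℝ), q.2 ≠ 0 :=
    Measure.quasiMeasurePreserving_snd.ae (Measure.ae_ne volume 0)
  filter_upwards [ae_waveNumber_polarMap, h2] with q h1 h2
  have h3 : √(Real.pi * ‖polarMap q‖) = Real.pi * √|q.2| := by
    rw [norm_polarMap, ← mul_assoc, Real.sqrt_mul (by positivity),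
      Real.sqrt_mul_self Real.pi_pos.le]
  have h4 : ((Real.pi * √|q.2| : ℝ) : ℂ) ≠ 0 := by
    have : 0 < √|q.2| := Real.sqrt_pos.2 (abs_pos.2 h2)
    exact_mod_cast (mul_pos Real.pi_pos this).ne'
  simp only [polarLift, analysisMultiplier, h1, h3]
  field_simp

/-! ### Quadrature densities -/

/-- The characteristic function of a test operator along the ray `z = π i κ e^{iφ}`. -/
def raySchwartz (K : TestOp) (φ : ℝ) : 𝓢(ℝ, ℂ) :=
  compCLMOfAntilipschitz (K := 1) ℂ (g := fun κ : ℝ => polarMap (φ, κ))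
    (by
      have h : (fun κ : ℝ => polarMap (φ, κ)) = ContinuousLinearMap.smulRight
          (1 : ℝ →L[ℝ] ℝ) (Real.pi * Complex.I * Complex.exp (Complex.I * φ)) := by
        ext κ
        simp [polarMap]
        ring
      rw [h]
      exact ContinuousLinearMap.hasTemperateGrowth _)
    (AntilipschitzWith.of_le_mul_dist fun x y => by
      have h : polarMap (φ, x) - polarMap (φ, y) = polarMap (φ, x - y) := by
        simp [polarMap]
        ring
      rw [dist_eq_norm, dist_eq_norm, h, norm_polarMap, NNReal.coe_one, one_mul, Real.norm_eq_abs]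
      have := Real.pi_gt_three
      nlinarith [abs_nonneg (x - y)])
    (symbolEquiv K)

theorem raySchwartz_apply (K : TestOp) (φ κ : ℝ) :
    raySchwartz K φ κ = charFn K (polarMap (φ, κ)) := symbolEquiv_apply K _

theorem polarMap_re_im (φ κ : ℝ) : (polarMap (φ, κ)).re = -(Real.pi * Real.sin φ) * κ ∧
    (polarMap (φ, κ)).im = Real.pi * Real.cos φ * κ := by
  simp only [polarMap]
  rw [mul_comm Complex.I (φ : ℂ), Complex.exp_mul_I, ← Complex.ofReal_cos, ← Complex.ofReal_sin]
  constructor <;> simp [-Complex.ofReal_sin, -Complex.ofReal_cos] <;> ring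

theorem fourierInv_comp_neg (f : ℝ → ℂ) (y : ℝ) : 𝓕⁻ (fun x => f (-x)) y = 𝓕⁻ f (-y) := by
  rw [Real.fourierInv_eq_fourier_comp_neg, Real.fourierInv_eq_fourier_neg, neg_neg]
  simp

theorem quadratureDensity_of_sin_eq_zero (K : TestOp) {φ : ℝ} (hφ : Real.sin φ = 0) (y : ℝ) :
    quadratureDensity φ K y = 𝓕⁻ (raySchwartz K φ : ℝ → ℂ) y := by
  set ψ := sliceSchwartz (compEquiv midpointEquiv K) 0 with hψ
  have hray : (raySchwartz K φ : ℝ → ℂ) = fun κ => (𝓕 ψ : 𝓢(ℝ, ℂ)) (Real.cos φ * κ) := by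
    ext κ
    rw [raySchwartz_apply, ← symbolEquiv_apply, symbolEquiv_eq_fourier]
    obtain ⟨h1, h2⟩ := polarMap_re_im φ κ
    rw [h1, h2, hφ]
    simp only [mul_zero, neg_zero, zero_mul]
    congr 1
    field_simp
  have hinv : ∀ y, 𝓕⁻ ((𝓕 ψ : 𝓢(ℝ, ℂ)) : ℝ → ℂ) y = ψ y := fun y => by
    rw [← fourierInv_coe, FourierTransform.fourierInv_fourier_eq]
  have hval : quadratureDensity φ K y = ψ (Real.cos φ * y) := by
    rw [quadratureDensity, if_pos hφ]
    simp [hψ]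
  rw [hval, hray]
  have hc : Real.cos φ = 1 ∨ Real.cos φ = -1 := by
    have := Real.sin_sq_add_cos_sq φ
    rw [hφ] at this
    exact mul_self_eq_one_iff.1 (by linarith)
  rcases hc with h | h
  · simp only [h, one_mul, hinv]
  · simp only [h, neg_mul, one_mul]
    rw [fourierInv_comp_neg, hinv]

/-- In midpoint coordinates the quadratic phases of the generalized eigenfunctions combine to a
phase that is linear in the midpoint, which is the phase of the characteristic function. -/
theorem quadratureDensity_of_sin_ne_zero (K : TestOp) {φ : ℝ} (hφ : Real.sin φ ≠ 0) (y : ℝ) :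
    quadratureDensity φ K y = 𝓕⁻ (raySchwartz K φ : ℝ → ℂ) y := by
  set s := Real.sin φ with hs
  set c := Real.cos φ with hc
  set k := compEquiv midpointEquiv K with hk
  set e : ℝ × ℝ → ℂ := fun p =>
    Complex.exp ((((2 * c * p.2 * p.1 - 2 * p.1 * y) / s : ℝ) : ℂ) * Complex.I) with he
  have hec : Continuous e := by
    rw [he]
    fun_prop
  have hint : Integrable (fun p => e p * k p) volume := by
    refine k.integrable.bdd_mul (c := 1) hec.aestronglyMeasurable ?_
    exact Filter.Eventually.of_forall fun p => (Complex.norm_exp_ofReal_mul_I _).le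
  have hleft : quadratureDensity φ K y =
      ((1 / (Real.pi * |s|) : ℝ) : ℂ) * ∫ q, ∫ u, e (q, u) * k (q, u) := by
    rw [quadratureDensity, if_neg hφ,
      ← measurePreserving_midpointEquiv.integral_comp
        midpointEquiv.toHomeomorph.measurableEmbedding,
      ← integral_prod _ hint, ← integral_const_mul, Measure.volume_eq_prod]
    congr 1 with p
    obtain ⟨q, u⟩ := p
    simp only [midpointEquiv_apply, quadratureKet, ← hs, ← hc]
    have h1 : k (q, u) = K (u + q / 2, u - q / 2) := rfl
    have h2 : ((1 / (Real.pi * |s|) : ℝ) : ℂ) =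
        ((1 / √(Real.pi * |s|) : ℝ) : ℂ) * ((1 / √(Real.pi * |s|) : ℝ) : ℂ) := by
      rw [← Complex.ofReal_mul]
      congr 1
      rw [div_mul_div_comm, one_mul, Real.mul_self_sqrt (by positivity)]
    rw [h1, h2, map_mul, Complex.conj_ofReal, ← Complex.exp_conj, map_mul, Complex.conj_I,
      Complex.conj_ofReal]
    have h3 : e (q, u) =
        Complex.exp (-Complex.I * (((2 * (u + q / 2) * y - c * (u + q / 2) ^ 2) / s : ℝ) : ℂ)) *
        Complex.exp (Complex.I * (((2 * (u - q / 2) * y - c * (u - q / 2) ^ 2) / s : ℝ) : ℂ)) := by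
      rw [← Complex.exp_add]
      simp only [he]
      congr 1
      push_cast
      ring
    rw [h3]
    ring
  have hray : ∀ κ, Complex.exp (((2 * Real.pi * inner ℝ κ y : ℝ) : ℂ) * Complex.I) •
      raySchwartz K φ κ = (fun q => ∫ u, e (q, u) * k (q, u)) (-(Real.pi * s) * κ) := by
    intro κ
    obtain ⟨h1, h2⟩ := polarMap_re_im φ κ
    rw [raySchwartz_apply, charFn_eq_integral, h1, h2, smul_eq_mul, ← integral_const_mul]
    congr 1 with u
    rw [← mul_assoc, ← Complex.exp_add, ← hs, ← hc]
    have h3 : k (-(Real.pi * s) * κ, u) =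
        K (u + -(Real.pi * s) * κ / 2, u - -(Real.pi * s) * κ / 2) := rfl
    rw [h3, he]
    congr 2
    have hin : inner ℝ κ y = y * κ := rfl
    have hs' : (s : ℂ) ≠ 0 := by exact_mod_cast hφ
    rw [hin]
    push_cast
    field_simp
    ring
  rw [hleft, Real.fourierInv_eq', integral_congr_ae (Filter.Eventually.of_forall hray),
    Measure.integral_comp_mul_left (fun q => ∫ u, e (q, u) * k (q, u)), Complex.real_smul]
  congr 2
  rw [inv_neg, abs_neg, abs_inv, abs_mul, abs_of_pos Real.pi_pos, one_div]

/-- The quadrature density is the inverse Fourier transform of the characteristic function along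
the ray of the quadrature. -/
theorem quadratureDensity_eq (K : TestOp) (φ : ℝ) :
    quadratureDensity φ K = (𝓕⁻ (raySchwartz K φ) : 𝓢(ℝ, ℂ)) := by
  ext y
  rw [fourierInv_coe]
  by_cases h : Real.sin φ = 0
  · exact quadratureDensity_of_sin_eq_zero K h y
  · exact quadratureDensity_of_sin_ne_zero K h y

theorem integral_exp_mul_eq_fourier (f : ℝ → ℂ) (k : ℝ) :
    ∫ y : ℝ, Complex.exp (-(Complex.I * k * y)) * f y = 𝓕 f (k / (2 * Real.pi)) := by
  rw [Real.fourier_real_eq_integral_exp_smul]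
  congr 1 with y
  rw [smul_eq_mul]
  congr 2
  push_cast
  field_simp

theorem integral_exp_mul_quadratureDensity (K : TestOp) (φ k : ℝ) :
    ∫ y : ℝ, Complex.exp (-(Complex.I * k * y)) * quadratureDensity φ K y =
      raySchwartz K φ (k / (2 * Real.pi)) := by
  rw [integral_exp_mul_eq_fourier, quadratureDensity_eq, ← fourier_coe,
    FourierTransform.fourier_fourierInv_eq]

theorem raySchwartz_div (K : TestOp) (φ k : ℝ) : raySchwartz K φ (k / (2 * Real.pi)) =
    charFn K (Complex.I * k * Complex.exp (Complex.I * φ) / 2) := by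
  rw [raySchwartz_apply, polarMap]
  congr 1
  push_cast
  field_simp

theorem exists_schwartz_conj_quadratureDensity (K : TestOp) (φ x : ℝ) :
    ∃ s : 𝓢(ℝ, ℂ), ⇑s = fun y => conj (quadratureDensity φ K (x + y)) := by
  refine ⟨compCLMOfAntilipschitz (K := 1) ℝ (g := fun y : ℝ => x + y)
    ((Function.HasTemperateGrowth.const x).add Function.HasTemperateGrowth.id')
    (AntilipschitzWith.of_le_mul_dist fun a b => by simp)
    (postcompCLM (Complex.conjCLE : ℂ →L[ℝ] ℂ) (𝓕⁻ (raySchwartz K φ))), ?_⟩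
  ext y
  rw [quadratureDensity_eq]
  rfl

theorem fourierTr_conj_quadratureDensity (K : TestOp) (φ x k : ℝ) :
    fourierTr (fun y => conj (quadratureDensity φ K (x + y))) k =
      Complex.exp (-(Complex.I * k * x)) * conj (raySchwartz K φ (k / (2 * Real.pi))) /
        (2 * Real.pi) := by
  have h : ∀ y : ℝ, Complex.exp (Complex.I * y * k) * conj (quadratureDensity φ K (x + y)) /
      (2 * Real.pi) = (fun y : ℝ => Complex.exp (-(Complex.I * k * x)) / (2 * Real.pi) *
        conj (Complex.exp (-(Complex.I * k * y)) * quadratureDensity φ K y)) (x + y) := by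
    intro y
    simp only [map_mul, ← Complex.exp_conj, map_neg, Complex.conj_I, Complex.conj_ofReal]
    rw [div_mul_eq_mul_div, ← mul_assoc, ← Complex.exp_add]
    congr 3
    push_cast
    ring
  rw [fourierTr]
  simp only [h]
  rw [integral_add_left_eq_self (fun y : ℝ => Complex.exp (-(Complex.I * k * x)) / (2 * Real.pi) *
        conj (Complex.exp (-(Complex.I * k * y)) * quadratureDensity φ K y)) x,
    integral_const_mul, integral_conj, integral_exp_mul_quadratureDensity]
  ring

theorem symbolIntegrand_eq (m : ℝ → ℂ) (x φ : ℝ) (K : TestOp) (k : ℝ) :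
    symbolIntegrand m x φ K k = m k * (Complex.exp (-(Complex.I * k * x)) *
      conj (raySchwartz K φ (k / (2 * Real.pi))) / (2 * Real.pi)) := by
  rw [symbolIntegrand, fourierTr_conj_quadratureDensity]

/-- The characteristic function in polar coordinates, multiplied by a conjugate Fourier symbol. -/
def symbolLift (m : ℝ → ℂ) (K : TestOp) (q : ℝ × ℝ) : ℂ :=
  conj (m (2 * Real.pi * q.2)) * charFn K (polarMap q)

/-- The coefficients are inverse Fourier transforms along the rays, in units `κ = k / (2π)`. -/
theorem symbolCoeff_eq (m : ℝ → ℂ) (x φ : ℝ) (K : TestOp) :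
    symbolCoeff m x φ K = sliceFourierInv (symbolLift m K) (φ, x) := by
  have hpi := Real.pi_pos
  rw [symbolCoeff, ← integral_conj, sliceFourierInv, Real.fourierInv_eq']
  have h : ∀ κ : ℝ, Complex.exp (((2 * Real.pi * inner ℝ κ x : ℝ) : ℂ) * Complex.I) •
      symbolLift m K (φ, κ) = (2 * Real.pi : ℂ) *
        (fun k => conj (symbolIntegrand m x φ K k)) (2 * Real.pi * κ) := by
    intro κ
    have h2 : 2 * Real.pi * κ / (2 * Real.pi) = κ := by field_simp
    have hin : inner ℝ κ x = x * κ := rfl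
    simp only [symbolIntegrand_eq, h2, raySchwartz_apply, symbolLift, map_mul, map_div₀,
      Complex.conj_conj, ← Complex.exp_conj, map_neg, Complex.conj_I, Complex.conj_ofReal, hin,
      smul_eq_mul, map_ofNat]
    have h3 : (((2 * Real.pi * (x * κ) : ℝ) : ℂ) * Complex.I) =
        -(-Complex.I * ((2 * Real.pi * κ : ℝ) : ℂ) * x) := by
      push_cast
      ring
    rw [h3]
    field_simp
  rw [integral_congr_ae (Filter.Eventually.of_forall h), integral_const_mul,
    Measure.integral_comp_mul_left (fun k => conj (symbolIntegrand m x φ K k)),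
    Complex.real_smul, abs_of_pos (by positivity)]
  push_cast
  field_simp

/-- The translation by `x` only contributes a phase, so that integrability does not depend on it. -/
theorem integrable_symbolLift {m : ℝ → ℂ} {x φ : ℝ} {K : TestOp}
    (h : Integrable (symbolIntegrand m x φ K)) :
    Integrable fun κ => symbolLift m K (φ, κ) := by
  have h1 : Integrable fun k : ℝ => conj (m k) * raySchwartz K φ (k / (2 * Real.pi)) := by
    have h2 := (h.bdd_mul (c := 2 * Real.pi)
      (f := fun k : ℝ => 2 * Real.pi * Complex.exp (((k * x : ℝ) : ℂ) * Complex.I))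
      (Continuous.aestronglyMeasurable (by fun_prop))
      (Filter.Eventually.of_forall fun k => by
        rw [norm_mul, Complex.norm_exp_ofReal_mul_I]
        simp [abs_of_pos Real.pi_pos]))
    have h3 := (Complex.conjCLE : ℂ →L[ℝ] ℂ).integrable_comp h2
    refine h3.congr (Filter.Eventually.of_forall fun k => ?_)
    have h4 : Complex.exp (((k * x : ℝ) : ℂ) * Complex.I) *
        Complex.exp (-(Complex.I * k * x)) = 1 := by
      rw [← Complex.exp_add, Complex.exp_eq_one_iff]
      exact ⟨0, by push_cast; ring⟩
    have h5 : (2 * Real.pi * Complex.exp (((k * x : ℝ) : ℂ) * Complex.I)) *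
        symbolIntegrand m x φ K k = m k * conj (raySchwartz K φ (k / (2 * Real.pi))) := by
      rw [symbolIntegrand_eq]
      have hpi : (Real.pi : ℂ) ≠ 0 := by exact_mod_cast Real.pi_ne_zero
      field_simp
      linear_combination (m k * conj (raySchwartz K φ (k / (2 * Real.pi)))) * h4
    change conj ((2 * Real.pi * Complex.exp (((k * x : ℝ) : ℂ) * Complex.I)) *
        symbolIntegrand m x φ K k) = _
    rw [h5, map_mul, Complex.conj_conj]
  have h6 := h1.comp_mul_left' (R := 2 * Real.pi) (by positivity)
  refine h6.congr (Filter.Eventually.of_forall fun κ => ?_)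
  have h2 : 2 * Real.pi * κ / (2 * Real.pi) = κ := by field_simp
  simp only [h2, raySchwartz_apply, symbolLift]

theorem frameCoeff_eq {h : 𝓢'(ℝ, ℂ)} {H : ℝ → ℂ} (hH : HasBoundedFourier h H) (x φ : ℝ)
    (K : TestOp) : frameCoeff h x φ K = symbolCoeff H x φ K := by
  have he := exists_schwartz_conj_quadratureDensity K φ x
  rw [frameCoeff, symbolCoeff, distPair, dif_pos he, hH.2, he.choose_spec]
  rfl

/-! ### The analysis operator -/

theorem HasBoundedFourier.congr {h : 𝓢'(ℝ, ℂ)} {H H' : ℝ → ℂ} (hH : HasBoundedFourier h H)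
    (e : H =ᵐ[volume] H') : HasBoundedFourier h H' := by
  refine ⟨hH.1.ae_eq e, fun θ => ?_⟩
  rw [hH.2]
  exact integral_congr_ae (e.mono fun k hk => by simp only [hk])

/-- A Fourier symbol that is defined up to null sets has a representative that is measurable and
bounded everywhere. -/
theorem HasBoundedFourier.exists_measurable {h : 𝓢'(ℝ, ℂ)} {H : ℝ → ℂ}
    (hH : HasBoundedFourier h H) : ∃ (H' : ℝ → ℂ) (C : ℝ), Measurable H' ∧ (∀ k, ‖H' k‖ ≤ C) ∧
      H =ᵐ[volume] H' ∧ HasBoundedFourier h H' := by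
  set C := lpNorm H ∞ volume with hC
  have h1 : ∀ᵐ k, ‖H k‖ ≤ C := ae_le_lpNorm_exponent_top hH.1
  set G := hH.1.1.mk H with hG
  have hGm : Measurable G := hH.1.1.stronglyMeasurable_mk.measurable
  have e : H =ᵐ[volume] fun k => if ‖G k‖ ≤ C then G k else 0 := by
    filter_upwards [h1, hH.1.1.ae_eq_mk] with k h2 h3
    rw [← hG] at h3
    rw [← h3, if_pos h2]
  refine ⟨_, C, Measurable.ite (measurableSet_le hGm.norm measurable_const) hGm measurable_const,
    fun k => ?_, e, hH.congr e⟩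
  split_ifs with h
  · exact h
  · rw [norm_zero]
    exact lpNorm_nonneg

/-- In polar coordinates, the Jacobian absorbs the singularity of the multiplier at `z = 0`. -/
theorem lintegral_analysisMultiplier_mul_le {H : ℝ → ℂ} (hH : Measurable H) {C : ℝ}
    (hC : ∀ k, ‖H k‖ ≤ C) {f : ℂ → ℂ} (hf : Measurable f) :
    ∫⁻ z, ‖analysisMultiplier H z * f z‖ₑ ^ 2 ∂planeMeasure ≤
      ∫⁻ q, ENNReal.ofReal ((C * ‖f (polarMap q)‖) ^ 2) ∂angleMeasure.prod volume := by
  have hm : Measurable fun z => analysisMultiplier H z * f z :=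
    (measurable_analysisMultiplier hH).mul hf
  rw [← lintegral_polarLift hm]
  refine lintegral_mono_ae ?_
  filter_upwards [polarLift_analysisMultiplier H f] with q hq
  rw [hq, ← ofReal_norm, ← ENNReal.ofReal_pow (norm_nonneg _)]
  gcongr
  rw [norm_mul, RCLike.norm_conj]
  gcongr
  exact hC _

theorem integrable_norm_sq_polarMap (s : 𝓢(ℂ, ℂ)) (C : ℝ) :
    Integrable (fun q => (C * ‖s (polarMap q)‖) ^ 2) (angleMeasure.prod volume) := by
  obtain ⟨D₀, hD₀, h₀⟩ := s.decay 0 0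
  obtain ⟨D₁, hD₁, h₁⟩ := s.decay 1 0
  have hg := (integrable_inv_one_add_sq.comp_snd angleMeasure).const_mul (C ^ 2 * (D₀ ^ 2 + D₁ ^ 2))
  refine hg.mono' ?_ (Filter.Eventually.of_forall fun q => ?_)
  · have := continuous_polarMap
    exact Continuous.aestronglyMeasurable (by fun_prop)
  · rw [Real.norm_eq_abs, abs_of_nonneg (by positivity), mul_pow, mul_assoc]
    gcongr
    rw [← div_eq_mul_inv, le_div_iff₀ (by positivity)]
    have e₀ := h₀ (polarMap q)
    have e₁ := h₁ (polarMap q)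
    simp only [pow_zero, one_mul, pow_one, norm_iteratedFDeriv_zero] at e₀ e₁
    have e₂ : q.2 ^ 2 * ‖s (polarMap q)‖ ^ 2 ≤ (‖polarMap q‖ * ‖s (polarMap q)‖) ^ 2 := by
      rw [mul_pow, norm_polarMap, mul_pow, sq_abs]
      have h : 1 ≤ Real.pi ^ 2 := one_le_pow₀ (by linarith [Real.pi_gt_three])
      gcongr
      nlinarith [sq_nonneg q.2]
    have e₃ := pow_le_pow_left₀ (by positivity) e₀ 2
    have e₄ := pow_le_pow_left₀ (by positivity) e₁ 2
    nlinarith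

theorem memLp_analysisMultiplier_mul {H : ℝ → ℂ} (hH : Measurable H) {C : ℝ}
    (hC : ∀ k, ‖H k‖ ≤ C) (s : 𝓢(ℂ, ℂ)) :
    MemLp (fun z => analysisMultiplier H z * s z) 2 planeMeasure := by
  have hm := (measurable_analysisMultiplier hH).mul s.continuous.measurable
  refine (memLp_two_iff hm.aestronglyMeasurable).2 ?_
  refine (lintegral_analysisMultiplier_mul_le hH hC s.continuous.measurable).trans_lt ?_
  exact (integrable_norm_sq_polarMap s C).lintegral_lt_top

theorem lintegral_analysisMultiplier_closedBall {H : ℝ → ℂ} (hH : Measurable H) {C : ℝ}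
    (hC : ∀ k, ‖H k‖ ≤ C) (R : ℝ) :
    ∫⁻ z in Metric.closedBall 0 R, ‖analysisMultiplier H z‖ₑ ^ 2 ∂planeMeasure < ∞ := by
  have h1 := lintegral_analysisMultiplier_mul_le hH hC
    (f := (Metric.closedBall (0 : ℂ) R).indicator 1)
    (measurable_one.indicator measurableSet_closedBall)
  have h2 : ∫⁻ z in Metric.closedBall 0 R, ‖analysisMultiplier H z‖ₑ ^ 2 ∂planeMeasure =
      ∫⁻ z, ‖analysisMultiplier H z * (Metric.closedBall (0 : ℂ) R).indicator 1 z‖ₑ ^ 2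
        ∂planeMeasure := by
    rw [← lintegral_indicator measurableSet_closedBall]
    congr 1 with z
    by_cases hz : z ∈ Metric.closedBall (0 : ℂ) R
    · simp only [Set.indicator_of_mem hz, Pi.one_apply, mul_one]
    · simp [Set.indicator_of_notMem hz]
  rw [h2]
  refine h1.trans_lt ?_
  have h3 : ∫⁻ q, ENNReal.ofReal ((C * ‖(Metric.closedBall (0 : ℂ) R).indicator
      (1 : ℂ → ℂ) (polarMap q)‖) ^ 2) ∂angleMeasure.prod volume ≤
      ∫⁻ q, (Set.univ ×ˢ Set.Icc (-R) R).indicator (fun _ => ENNReal.ofReal (C ^ 2)) q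
        ∂angleMeasure.prod volume := by
    refine lintegral_mono fun q => ?_
    by_cases hz : polarMap q ∈ Metric.closedBall (0 : ℂ) R
    · rw [Set.indicator_of_mem hz, Set.indicator_of_mem]
      · simp
      · rw [mem_closedBall_zero_iff, norm_polarMap] at hz
        refine ⟨trivial, abs_le.1 ?_⟩
        have := Real.pi_gt_three
        nlinarith [abs_nonneg q.2]
    · simp [Set.indicator_of_notMem hz]
  refine h3.trans_lt ?_
  rw [lintegral_indicator_const (MeasurableSet.univ.prod measurableSet_Icc), Measure.prod_prod]
  exact ENNReal.mul_lt_top ENNReal.ofReal_lt_top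
    (ENNReal.mul_lt_top (measure_lt_top _ _) measure_Icc_lt_top)

theorem quorumLI_eq_symbolCoeff {m : ℝ → ℂ} {K : TestOp} {g : Lp ℂ 2 planeMeasure}
    (hg : ⇑g =ᵐ[planeMeasure] fun z => analysisMultiplier m z * charFn K z)
    (h : ∀ᵐ φ ∂angleMeasure, Integrable fun κ => symbolLift m K (φ, κ)) :
    ⇑(quorumLI g) =ᵐ[quorumMeasure] fun q => symbolCoeff m q.2 q.1 K := by
  refine (quorumLI_apply g ((polarLift_congr hg).trans
    (polarLift_analysisMultiplier m (charFn K))) h).trans (Filter.Eventually.of_forall fun q => ?_)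
  simp only [symbolCoeff_eq]
  rfl

theorem integrable_symbolLift_of_bounded {H : ℝ → ℂ} (hH : Measurable H) {C : ℝ}
    (hC : ∀ k, ‖H k‖ ≤ C) (K : TestOp) (φ : ℝ) :
    Integrable fun κ => symbolLift H K (φ, κ) := by
  refine ((raySchwartz K φ).integrable.bdd_mul (c := C)
    (f := fun κ => conj (H (2 * Real.pi * κ))) ?_ (Filter.Eventually.of_forall fun κ => ?_)).congr
    (Filter.Eventually.of_forall fun κ => ?_)
  · have h1 : Measurable fun κ : ℝ => H (2 * Real.pi * κ) := hH.comp (by fun_prop)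
    exact (Complex.continuous_conj.measurable.comp h1).aestronglyMeasurable
  · rw [Complex.norm_conj]
    exact hC _
  · simp only [symbolLift, raySchwartz_apply]

theorem quorumLI_eq_frameCoeff {h : 𝓢'(ℝ, ℂ)} {H : ℝ → ℂ} (hh : HasBoundedFourier h H)
    (hH : Measurable H) {C : ℝ} (hC : ∀ k, ‖H k‖ ≤ C) {K : TestOp} {g : Lp ℂ 2 planeMeasure}
    (hg : ⇑g =ᵐ[planeMeasure] fun z => analysisMultiplier H z * charFn K z) :
    ⇑(quorumLI g) =ᵐ[quorumMeasure] fun q => frameCoeff h q.2 q.1 K := by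
  simp only [frameCoeff_eq hh]
  exact quorumLI_eq_symbolCoeff hg
    (Filter.Eventually.of_forall (integrable_symbolLift_of_bounded hH hC K))

/-- In the spectral representation of `a - b†`, the analysis operator is a multiplication operator,
followed by an isometry. -/
theorem analysisGraph_eq {h : 𝓢'(ℝ, ℂ)} {H : ℝ → ℂ} (hh : HasBoundedFourier h H)
    (hH : Measurable H) {C : ℝ} (hC : ∀ k, ‖H k‖ ≤ C) :
    analysisGraph h = {P : HS × Coeffs | ∃ g, (spectralMap P.1, g) ∈
      schwartzMulGraph (analysisMultiplier H) ∧ P.2 = quorumLI g} := by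
  ext ⟨A, u⟩
  constructor
  · rintro ⟨K, rfl, hu⟩
    have hm := memLp_analysisMultiplier_mul hH hC (symbolEquiv K)
    refine ⟨hm.toLp, ⟨symbolEquiv K, spectralMap_toHS K, hm.coeFn_toLp⟩, Lp.ext ?_⟩
    refine hu.trans (quorumLI_eq_frameCoeff hh hH hC ?_).symm
    simpa only [symbolEquiv_apply] using hm.coeFn_toLp
  · rintro ⟨g, ⟨s, hs, hg⟩, rfl⟩
    refine ⟨symbolEquiv.symm s, ?_, quorumLI_eq_frameCoeff hh hH hC ?_⟩
    · apply spectralMap.injective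
      rw [spectralMap_toHS]
      simpa using hs
    · simpa only [← symbolEquiv_apply, LinearEquiv.apply_symm_apply] using hg

theorem mem_closure_analysisGraph {h : 𝓢'(ℝ, ℂ)} {H : ℝ → ℂ} (hh : HasBoundedFourier h H)
    (hH : Measurable H) {C : ℝ} (hC : ∀ k, ‖H k‖ ≤ C) (A : HS) (u : Coeffs) :
    (A, u) ∈ closure (analysisGraph h) ↔ ∃ g : Lp ℂ 2 planeMeasure,
      (⇑g =ᵐ[planeMeasure] fun z => analysisMultiplier H z * spectralMap A z) ∧
        u = quorumLI g := by
  rw [analysisGraph_eq hh hH hC, mem_closure_image]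
  simp only [mem_closure_schwartzMulGraph (measurable_analysisMultiplier hH)
    (lintegral_analysisMultiplier_closedBall hH hC)]

/-! ### The frame operator -/

theorem locallyIntegrable_of_locally_sq {a : ℂ → ℂ} (ha : Measurable a)
    (hloc : ∀ R : ℝ, ∫⁻ z in Metric.closedBall 0 R, ‖a z‖ₑ ^ 2 ∂planeMeasure < ∞)
    (g : Lp ℂ 2 planeMeasure) : LocallyIntegrable (fun z => conj (a z) * g z) planeMeasure := by
  rw [locallyIntegrable_iff]
  intro k hk
  obtain ⟨R, hR⟩ := hk.isBounded.subset_closedBall 0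
  refine IntegrableOn.mono_set ?_ hR
  have h1 : MemLp (fun z => conj (a z)) 2 (planeMeasure.restrict (Metric.closedBall 0 R)) := by
    refine (memLp_two_iff (Complex.continuous_conj.measurable.comp ha).aestronglyMeasurable).2 ?_
    simpa [RCLike.enorm_conj] using hloc R
  exact h1.integrable_mul ((Lp.memLp g).restrict _)

/-- In the spectral representation of `a - b†`, the frame operator is the multiplication by
`|a(z)|²`, where `a` is the multiplier of the analysis operator. -/
theorem frameOp_iff {h : 𝓢'(ℝ, ℂ)} {H : ℝ → ℂ} (hh : HasBoundedFourier h H)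
    (hH : Measurable H) {c : ℝ} (hc : ∀ k, ‖H k‖ ≤ c) (A C : HS) :
    FrameOp h A C ↔ ∀ᵐ z ∂planeMeasure, spectralMap C z =
      ((‖analysisMultiplier H z‖ ^ 2 : ℝ) : ℂ) * spectralMap A z := by
  have ham := measurable_analysisMultiplier hH
  have hloc := lintegral_analysisMultiplier_closedBall hH hc
  constructor
  · -- the adjoint relation is tested on operators with smooth compactly supported symbols
    rintro ⟨u, hu, hadj⟩
    obtain ⟨g, hg, rfl⟩ := (mem_closure_analysisGraph hh hH hc A u).1 hu
    have h1 : (fun z => conj (analysisMultiplier H z) * g z) =ᵐ[planeMeasure] spectralMap C := by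
      refine ae_eq_of_integral_contDiff_smul_eq (locallyIntegrable_of_locally_sq ham hloc g)
        ((Lp.memLp (spectralMap C)).locallyIntegrable one_le_two) fun b hb hbc => ?_
      have hb' : ContDiff ℝ (⊤ : ℕ∞) fun z => (b z : ℂ) := Complex.ofRealCLM.contDiff.comp hb
      set s : 𝓢(ℂ, ℂ) := (hbc.comp_left Complex.ofReal_zero).toSchwartzMap hb' with hs
      have hsb : ∀ z, s z = b z := fun z => rfl
      have hm := memLp_analysisMultiplier_mul hH hc s
      have h2 := hadj (toHS (symbolEquiv.symm s)) (quorumLI hm.toLp) (by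
        rw [analysisGraph_eq hh hH hc]
        exact ⟨_, ⟨s, by rw [spectralMap_toHS]; simp, hm.coeFn_toLp⟩, rfl⟩)
      rw [LinearIsometry.inner_map_map, ← spectralMap.inner_map_map, spectralMap_toHS,
        LinearEquiv.apply_symm_apply, L2.inner_def, L2.inner_def] at h2
      convert h2 using 1
      · refine integral_congr_ae ?_
        filter_upwards [hm.coeFn_toLp] with z hz
        rw [hz, RCLike.inner_apply, map_mul, hsb, Complex.conj_ofReal, Complex.real_smul]
        ring
      · refine integral_congr_ae ?_
        filter_upwards [coeFn_toLp s 2 planeMeasure] with z hz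
        rw [hz, RCLike.inner_apply, hsb, Complex.conj_ofReal, Complex.real_smul]
        ring
    filter_upwards [h1, hg] with z h1 h2
    rw [← h1, h2, ← mul_assoc, Complex.conj_mul']
    push_cast
    rfl
  · -- `|a A|² = |A| |a² A|` is integrable, so `A` is in the domain of the closed analysis operator
    intro hC
    have hm : MemLp (fun z => analysisMultiplier H z * spectralMap A z) 2 planeMeasure := by
      have hsm : AEStronglyMeasurable (fun z => analysisMultiplier H z * spectralMap A z)
        planeMeasure := ham.aestronglyMeasurable.mul (Lp.aestronglyMeasurable _)
      refine (memLp_two_iff_integrable_sq_norm hsm).2 ?_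
      refine ((Lp.memLp (spectralMap C)).norm.integrable_mul
        (Lp.memLp (spectralMap A)).norm).congr ?_
      filter_upwards [hC] with z hz
      rw [Pi.mul_apply, hz, norm_mul, Complex.norm_real, norm_mul,
        Real.norm_of_nonneg (by positivity)]
      ring
    refine ⟨quorumLI hm.toLp, (mem_closure_analysisGraph hh hH hc A _).2
      ⟨_, hm.coeFn_toLp, rfl⟩, fun B v hv => ?_⟩
    obtain ⟨g, hg, rfl⟩ := (mem_closure_analysisGraph hh hH hc B v).1 (subset_closure hv)
    rw [LinearIsometry.inner_map_map, ← spectralMap.inner_map_map, L2.inner_def, L2.inner_def]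
    refine integral_congr_ae ?_
    filter_upwards [hC, hg, hm.coeFn_toLp] with z h1 h2 h3
    rw [h1, h2, h3, RCLike.inner_apply, RCLike.inner_apply, map_mul, Complex.ofReal_pow,
      ← Complex.mul_conj']
    ring

/-- A maximal multiplication operator on `L²` is densely defined. -/
theorem dense_memLp_mul {α : Type*} [MeasurableSpace α] {μ : Measure α} {w : α → ℂ}
    (hw : Measurable w) :
    Dense {f : Lp ℂ 2 μ | ∃ g : Lp ℂ 2 μ, ⇑g =ᵐ[μ] fun z => w z * f z} := by
  let S : Submodule ℂ (Lp ℂ 2 μ) :=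
    { carrier := {f : Lp ℂ 2 μ | ∃ g : Lp ℂ 2 μ, ⇑g =ᵐ[μ] fun z => w z * f z}
      add_mem' := by
        rintro f₁ f₂ ⟨g₁, h₁⟩ ⟨g₂, h₂⟩
        refine ⟨g₁ + g₂, ?_⟩
        filter_upwards [h₁, h₂, Lp.coeFn_add f₁ f₂, Lp.coeFn_add g₁ g₂] with z e₁ e₂ e₃ e₄
        rw [e₄, e₃, Pi.add_apply, Pi.add_apply, e₁, e₂, mul_add]
      zero_mem' := ⟨0, by
        filter_upwards [Lp.coeFn_zero ℂ 2 μ] with z hz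
        simp only [hz, Pi.zero_apply, mul_zero]⟩
      smul_mem' := by
        rintro c f ⟨g, h⟩
        refine ⟨c • g, ?_⟩
        filter_upwards [h, Lp.coeFn_smul c f, Lp.coeFn_smul c g] with z e₁ e₂ e₃
        rw [e₂, e₃, Pi.smul_apply, Pi.smul_apply, e₁, smul_eq_mul, smul_eq_mul]
        ring }
  change Dense (S : Set (Lp ℂ 2 μ))
  rw [Submodule.dense_iff_topologicalClosure_eq_top, Submodule.topologicalClosure_eq_top_iff,
    Submodule.eq_bot_iff]
  intro v hv
  -- `v / (1 + |w|)` is in the domain, and its inner product with `v` controls `v`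
  set r : α → ℂ := fun z => ((1 + ‖w z‖ : ℝ) : ℂ)⁻¹ with hr
  have hrn : ∀ z, ‖r z‖ = (1 + ‖w z‖)⁻¹ := fun z => by
    rw [hr, norm_inv, Complex.norm_real, Real.norm_of_nonneg (by positivity)]
  have hrm : Measurable r := by
    rw [hr]
    fun_prop
  have hf : MemLp (fun z => r z * v z) 2 μ :=
    (Lp.memLp v).mono (hrm.aestronglyMeasurable.mul (Lp.aestronglyMeasurable v))
      (Filter.Eventually.of_forall fun z => by
        rw [norm_mul, hrn]
        exact mul_le_of_le_one_left (norm_nonneg _) (inv_le_one_of_one_le₀ (by simp)))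
  have hg : MemLp (fun z => w z * (r z * v z)) 2 μ :=
    (Lp.memLp v).mono (hw.aestronglyMeasurable.mul hf.1)
      (Filter.Eventually.of_forall fun z => by
        rw [norm_mul, norm_mul, hrn, ← mul_assoc]
        refine mul_le_of_le_one_left (norm_nonneg _) ?_
        rw [← div_eq_mul_inv, div_le_one (by positivity)]
        linarith)
  have hS : hf.toLp ∈ S := ⟨hg.toLp, by
    filter_upwards [hg.coeFn_toLp, hf.coeFn_toLp] with z h1 h2
    rw [h1, h2]⟩
  have h0 := (Submodule.mem_orthogonal S v).1 hv _ hS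
  rw [L2.inner_def] at h0
  have h1 : ∫ z, (1 + ‖w z‖)⁻¹ * ‖v z‖ ^ 2 ∂μ = 0 := by
    have h2 : ((∫ z, (1 + ‖w z‖)⁻¹ * ‖v z‖ ^ 2 ∂μ : ℝ) : ℂ) = 0 := by
      rw [← h0, ← integral_complex_ofReal]
      refine integral_congr_ae ?_
      filter_upwards [hf.coeFn_toLp] with z hz
      rw [hz, RCLike.inner_apply, map_mul, hr]
      simp only [map_inv₀, Complex.conj_ofReal]
      push_cast
      rw [← Complex.mul_conj']
      ring
    exact_mod_cast h2
  rw [integral_eq_zero_iff_of_nonneg (fun z => by positivity)] at h1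
  · refine Lp.ext ?_
    filter_upwards [h1, Lp.coeFn_zero ℂ 2 μ] with z h2 h3
    rw [h3]
    have h4 : (1 + ‖w z‖)⁻¹ ≠ 0 := by positivity
    have h5 := (mul_eq_zero.1 h2).resolve_left h4
    simpa using h5
  · have h2 := (Lp.memLp v).norm.integrable_mul hf.norm
    refine h2.congr (Filter.Eventually.of_forall fun z => ?_)
    simp only [Pi.mul_apply, norm_mul, hrn]
    ring

/-- `frameOp_iff` with the multiplier written out, for a Fourier symbol that need not be measurable
or bounded on null sets. -/
theorem frameOp_iff_ae {h : 𝓢'(ℝ, ℂ)} {H : ℝ → ℂ} (hh : HasBoundedFourier h H) (A C : HS) :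
    FrameOp h A C ↔ ∀ᵐ z ∂planeMeasure, spectralMap C z =
      ((‖H (waveNumber z)‖ ^ 2 / (Real.pi * ‖z‖) : ℝ) : ℂ) * spectralMap A z := by
  obtain ⟨H', c, hm, hc, e, hh'⟩ := hh.exists_measurable
  rw [frameOp_iff hh' hm hc]
  refine Filter.eventually_congr ?_
  filter_upwards [ae_waveNumber e] with z hz
  rw [norm_analysisMultiplier_sq, hz]

theorem ae_ne_zero_planeMeasure : ∀ᵐ z ∂planeMeasure, z ≠ 0 := by
  filter_upwards [ae_waveNumber (Measure.ae_ne volume 0)] with z hz h0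
  exact hz (by simp [waveNumber, h0])

theorem ae_frame_weight_ne_zero {H : ℝ → ℂ} (hne : ∀ᵐ k, H k ≠ 0) : ∀ᵐ z ∂planeMeasure,
    ((‖H (waveNumber z)‖ ^ 2 / (Real.pi * ‖z‖) : ℝ) : ℂ) ≠ 0 := by
  filter_upwards [ae_waveNumber hne, ae_ne_zero_planeMeasure] with z h1 h2
  have h3 : 0 < ‖H (waveNumber z)‖ := norm_pos_iff.2 h1
  have h4 : 0 < ‖z‖ := norm_pos_iff.2 h2
  have := Real.pi_pos
  rw [Ne, Complex.ofReal_eq_zero]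
  positivity

theorem exists_eq_frameCoeff {h : 𝓢'(ℝ, ℂ)} {H : ℝ → ℂ} (hh : HasBoundedFourier h H)
    (K : TestOp) : ∃ u : Coeffs, ⇑u =ᵐ[quorumMeasure] fun q => frameCoeff h q.2 q.1 K := by
  obtain ⟨H', c, hm, hc, -, hh'⟩ := hh.exists_measurable
  have hs := memLp_analysisMultiplier_mul hm hc (symbolEquiv K)
  refine ⟨quorumLI hs.toLp, quorumLI_eq_frameCoeff hh' hm hc ?_⟩
  simpa only [symbolEquiv_apply] using hs.coeFn_toLp

theorem eq_of_mem_closure_analysisGraph {h : 𝓢'(ℝ, ℂ)} {H : ℝ → ℂ} (hh : HasBoundedFourier h H)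
    {A : HS} {u v : Coeffs} (hu : (A, u) ∈ closure (analysisGraph h))
    (hv : (A, v) ∈ closure (analysisGraph h)) : u = v := by
  obtain ⟨H', c, hm, hc, -, hh'⟩ := hh.exists_measurable
  obtain ⟨f, hf, rfl⟩ := (mem_closure_analysisGraph hh' hm hc A u).1 hu
  obtain ⟨g, hg, rfl⟩ := (mem_closure_analysisGraph hh' hm hc A v).1 hv
  rw [Lp.ext (hf.trans hg.symm)]

theorem isFrame_of_ae_ne_zero {h : 𝓢'(ℝ, ℂ)} {H : ℝ → ℂ} (hh : HasBoundedFourier h H)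
    (hne : ∀ᵐ k, H k ≠ 0) : IsFrame h := by
  obtain ⟨H', c, hm, hc, e, hh'⟩ := hh.exists_measurable
  have hne' : ∀ᵐ k, H' k ≠ 0 := by
    filter_upwards [hne, e] with k h1 h2
    rwa [← h2]
  have hw := ae_frame_weight_ne_zero hne'
  set w : ℂ → ℂ := fun z => ((‖H' (waveNumber z)‖ ^ 2 / (Real.pi * ‖z‖) : ℝ) : ℂ) with hwdef
  have hwm : Measurable w := by
    have : Measurable fun z => H' (waveNumber z) := hm.comp measurable_waveNumber
    exact Complex.measurable_ofReal.comp ((this.norm.pow_const 2).div (by fun_prop))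
  have hF : ∀ A C, FrameOp h A C ↔ ∀ᵐ z ∂planeMeasure, spectralMap C z = w z * spectralMap A z :=
    frameOp_iff_ae hh'
  refine ⟨fun K => (exists_eq_frameCoeff hh K).imp fun u hu => ⟨K, rfl, hu⟩, fun u hu => ?_,
    fun A C C' h1 h2 => ?_, ?_, fun A A' C h1 h2 => ?_, ?_⟩
  · have hz : ((0 : HS), (0 : Coeffs)) ∈ closure (analysisGraph h) := by
      refine (mem_closure_analysisGraph hh' hm hc 0 0).2 ⟨0, ?_, by simp⟩
      rw [map_zero]
      filter_upwards [Lp.coeFn_zero ℂ 2 planeMeasure] with z hz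
      simp only [hz, Pi.zero_apply, mul_zero]
    exact eq_of_mem_closure_analysisGraph hh hu hz
  · refine spectralMap.injective (Lp.ext ?_)
    filter_upwards [(hF _ _).1 h1, (hF _ _).1 h2] with z e1 e2
    rw [e1, e2]
  · convert (dense_memLp_mul hwm).preimage spectralMap.toHomeomorph.isOpenMap using 1
    ext A
    simp only [Set.mem_ofPred_eq, hF, Set.mem_preimage]
    exact ⟨fun ⟨C, hC⟩ => ⟨spectralMap C, hC⟩, fun ⟨g, hg⟩ =>
      ⟨spectralMap.symm g, by rw [LinearIsometryEquiv.apply_symm_apply]; exact hg⟩⟩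
  · refine spectralMap.injective (Lp.ext ?_)
    filter_upwards [(hF _ _).1 h1, (hF _ _).1 h2, hw] with z e1 e2 e3
    exact mul_left_cancel₀ e3 (e1.symm.trans e2)
  · convert (dense_memLp_mul hwm.inv).preimage spectralMap.toHomeomorph.isOpenMap using 1
    ext C
    simp only [Set.mem_ofPred_eq, hF, Set.mem_preimage]
    constructor
    · rintro ⟨A, hA⟩
      refine ⟨spectralMap A, ?_⟩
      filter_upwards [hA, hw] with z h1 h2
      change _ = (w z)⁻¹ * spectralMap C z
      rw [h1, inv_mul_cancel_left₀ h2]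
    · rintro ⟨g, hg⟩
      refine ⟨spectralMap.symm g, ?_⟩
      filter_upwards [hg, hw] with z h1 h2
      rw [LinearIsometryEquiv.apply_symm_apply, h1]
      change spectralMap C z = w z * ((w z)⁻¹ * spectralMap C z)
      rw [mul_inv_cancel_left₀ h2]

theorem frameOp_iff_of_norm_eq {h h' : 𝓢'(ℝ, ℂ)} {H H' : ℝ → ℂ} (hh : HasBoundedFourier h H)
    (hh' : HasBoundedFourier h' H') (e : ∀ᵐ k, ‖H k‖ = ‖H' k‖) (A C : HS) :
    FrameOp h A C ↔ FrameOp h' A C := by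
  rw [frameOp_iff_ae hh, frameOp_iff_ae hh']
  refine Filter.eventually_congr ?_
  filter_upwards [ae_waveNumber e] with z hz
  rw [hz]

theorem abs_waveNumber {z : ℂ} (hz : waveNumber z ≠ 0) : |waveNumber z| = 2 * ‖z‖ := by
  rcases lt_trichotomy z.re 0 with h | h | h
  · simp [waveNumber, sign_neg h]
  · simp [waveNumber, h] at hz
  · simp [waveNumber, sign_pos h]

theorem norm_abs_eq_of_even {H : ℝ → ℂ} {k : ℝ} (h : ‖H (-k)‖ = ‖H k‖) : ‖H |k|‖ = ‖H k‖ := by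
  rcases abs_choice k with h1 | h1 <;> rw [h1]
  exact h

theorem ae_frame_weight_eq {H : ℝ → ℂ} (he : ∀ᵐ k, ‖H (-k)‖ = ‖H k‖) : ∀ᵐ z ∂planeMeasure,
    ‖H (waveNumber z)‖ ^ 2 / (Real.pi * ‖z‖) = frameSymbol H ‖z‖ := by
  filter_upwards [ae_waveNumber he, ae_waveNumber (Measure.ae_ne volume 0)] with z h1 h2
  rw [frameSymbol, ← abs_waveNumber h2, norm_abs_eq_of_even h1]

theorem frameOp_iff_isFunctionOf {h : 𝓢'(ℝ, ℂ)} {H : ℝ → ℂ} (hh : HasBoundedFourier h H)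
    (he : ∀ᵐ k, ‖H (-k)‖ = ‖H k‖) (A C : HS) :
    FrameOp h A C ↔ IsFunctionOf spectralMap (fun z => (frameSymbol H ‖z‖ : ℂ)) A C := by
  rw [frameOp_iff_ae hh]
  refine Filter.eventually_congr ?_
  filter_upwards [ae_frame_weight_eq he] with z hz
  rw [hz]

theorem frameOp_iff_isFunctionOf_abs {h : 𝓢'(ℝ, ℂ)} {g : ℝ → ℂ}
    (hh : HasBoundedFourier h (fun k => (√Real.pi : ℂ) * g (|k| / 2))) (A C : HS) :
    FrameOp h A C ↔
      IsFunctionOf spectralMap (fun z => ((‖g ‖z‖‖ ^ 2 / ‖z‖ : ℝ) : ℂ)) A C := by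
  rw [frameOp_iff_isFunctionOf hh (by simp)]
  have e : ∀ z : ℂ, frameSymbol (fun k => (√Real.pi : ℂ) * g (|k| / 2)) ‖z‖ =
      ‖g ‖z‖‖ ^ 2 / ‖z‖ := by
    intro z
    have h1 : |2 * ‖z‖| / 2 = ‖z‖ := by
      rw [abs_of_nonneg (by positivity)]
      ring
    rw [frameSymbol, h1, norm_mul, mul_pow, Complex.norm_real,
      Real.norm_of_nonneg (Real.sqrt_nonneg _), Real.sq_sqrt Real.pi_pos.le,
      mul_div_mul_left _ _ Real.pi_pos.ne']
  simp only [e]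

/-! ### The inverse of the frame operator and the canonical dual -/

theorem fourierTr_eq_fourierInv (f : ℝ → ℂ) (k : ℝ) :
    fourierTr f k = 𝓕⁻ f (k / (2 * Real.pi)) / (2 * Real.pi) := by
  rw [fourierTr, integral_div, Real.fourierInv_eq']
  congr 2 with y
  rw [smul_eq_mul]
  congr 2
  have hin : inner ℝ y (k / (2 * Real.pi)) = k / (2 * Real.pi) * y := rfl
  rw [hin]
  push_cast
  field_simp

/-- Fourier inversion at the origin. -/
theorem hasBoundedFourier_diracDelta : HasBoundedFourier diracDelta fun _ => 1 := by
  refine ⟨memLp_top_const 1, fun θ => ?_⟩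
  have h1 : diracDelta θ = θ 0 := by
    change ∫ y, θ y ∂Measure.dirac 0 = θ 0
    rw [integral_dirac]
  have h2 : ∫ k : ℝ, 1 * fourierTr θ k = ∫ κ : ℝ, 𝓕⁻ (θ : ℝ → ℂ) κ := by
    simp only [one_mul, fourierTr_eq_fourierInv]
    rw [integral_div, Measure.integral_comp_div, abs_of_pos (by positivity), Complex.real_smul]
    push_cast
    have hpi : (Real.pi : ℂ) ≠ 0 := by exact_mod_cast Real.pi_ne_zero
    field_simp
  have h3 : (𝓕 (𝓕⁻ θ : 𝓢(ℝ, ℂ)) : 𝓢(ℝ, ℂ)) 0 = ∫ κ : ℝ, 𝓕⁻ (θ : ℝ → ℂ) κ := by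
    rw [fourier_coe, fourierInv_coe, Real.fourier_real_eq_integral_exp_smul]
    simp
  rw [h1, h2, ← h3, FourierTransform.fourier_fourierInv_eq]

/-- The coefficients of `F⁻¹ K` for `g(X_φ - x)` have the Fourier symbol of `g`, divided by the
symbol of `F`. -/
theorem frameInverseEq {h g : 𝓢'(ℝ, ℂ)} {H G : ℝ → ℂ} (hh : HasBoundedFourier h H)
    (hne : ∀ᵐ k, H k ≠ 0) (he : ∀ᵐ k, ‖H (-k)‖ = ‖H k‖) (hg : HasBoundedFourier g G) :
    FrameInverseEq h g fun k => G k / (frameSymbol H (|k| / 2) : ℂ) := by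
  rintro K B u ⟨hF, hu, hint⟩
  obtain ⟨G', c, hm, hc, e, hg'⟩ := hg.exists_measurable
  obtain ⟨b, hb, rfl⟩ := (mem_closure_analysisGraph hg' hm hc B u).1 hu
  refine quorumLI_eq_symbolCoeff ?_ ?_
  · filter_upwards [hb, (frameOp_iff_ae hh _ _).1 hF, ae_frame_weight_ne_zero hne,
      ae_frame_weight_eq he, spectralMap_toHS_ae K, ae_waveNumber e,
      ae_waveNumber (Measure.ae_ne volume 0)] with z h1 h2 h3 h4 h5 h6 h7
    rw [h1, ← h5, h2, analysisMultiplier, analysisMultiplier, abs_waveNumber h7,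
      mul_div_cancel_left₀ _ two_ne_zero, ← h4, map_div₀, Complex.conj_ofReal, h6]
    field_simp
  · rw [ae_angleMeasure]
    filter_upwards [hint] with φ hφ
    exact integrable_symbolLift (hφ 0)

/-- A Hilbert-Schmidt operator is expanded in the frame `h(X_φ - x)`, with the coefficients of the
canonical dual. -/
theorem inner_eq_integral_dual {h : 𝓢'(ℝ, ℂ)} {H : ℝ → ℂ} (hh : HasBoundedFourier h H)
    {m : ℝ → ℂ} (hm : FrameInverseEq h h m) {K : TestOp} (L : TestOp) {B : HS} {u : Coeffs}
    (hd : IsDualTest h h m K B u) :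
    Integrable (fun q : ℝ × ℝ => conj (frameCoeff h q.2 q.1 L) * symbolCoeff m q.2 q.1 K)
        quorumMeasure ∧
      inner ℂ (toHS L) (toHS K) =
        ∫ q : ℝ × ℝ, conj (frameCoeff h q.2 q.1 L) * symbolCoeff m q.2 q.1 K ∂quorumMeasure := by
  obtain ⟨v, hvL⟩ := exists_eq_frameCoeff hh L
  have hu := hm K B u hd
  obtain ⟨u', hu', hadj⟩ := hd.1
  -- `u` is also the coefficient function that witnesses `F B = K`
  have huu : u = u' := eq_of_mem_closure_analysisGraph hh hd.2.1 hu'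
  have hinner := hadj _ v ⟨L, rfl, hvL⟩
  rw [← huu] at hinner
  have hvu : (fun q => inner ℂ (v q) (u q)) =ᵐ[quorumMeasure] fun q : ℝ × ℝ =>
      conj (frameCoeff h q.2 q.1 L) * symbolCoeff m q.2 q.1 K := by
    filter_upwards [hu, hvL] with q h1 h2
    rw [RCLike.inner_apply, h1, h2, mul_comm]
  refine ⟨(L2.integrable_inner v u).congr hvu, ?_⟩
  refine hinner.symm.trans ?_
  rw [L2.inner_def]
  exact integral_congr_ae hvu

/-- If `1/H` is locally bounded, then the test operators whose characteristic function has compact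
support have an image under `F⁻¹`, with coefficients in the domain of every analysis operator with
bounded Fourier symbol. -/
theorem exists_isDualTest {h g : 𝓢'(ℝ, ℂ)} {H G : ℝ → ℂ} (hh : HasBoundedFourier h H)
    (he : ∀ᵐ k, ‖H (-k)‖ = ‖H k‖) (hg : HasBoundedFourier g G)
    (hloc : ∀ R : ℝ, ∃ c : ℝ, 0 < c ∧ ∀ᵐ k, |k| ≤ R → c ≤ ‖H k‖)
    {s : 𝓢(ℂ, ℂ)} (hs : HasCompactSupport s) :
    ∃ B u, IsDualTest h g (fun k => G k / (frameSymbol H (|k| / 2) : ℂ)) (symbolEquiv.symm s)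
      B u := by
  obtain ⟨R, hR⟩ := hs.isCompact.isBounded.subset_closedBall 0
  have hsR : ∀ z, R < ‖z‖ → s z = 0 := fun z hz => by
    by_contra h0
    have := hR (subset_tsupport _ h0)
    rw [mem_closedBall_zero_iff] at this
    exact absurd this hz.not_ge
  obtain ⟨c, hc0, hc⟩ := hloc (2 * R)
  obtain ⟨H', C', hHm, hHb, eH, -⟩ := hh.exists_measurable
  obtain ⟨G', C, hGm, hGb, eG, hg'⟩ := hg.exists_measurable
  have hHwm : Measurable fun z => H' (waveNumber z) := hHm.comp measurable_waveNumber
  set M := Real.pi * R / c ^ 2 with hM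
  set b : ℂ → ℂ := fun z => ((Real.pi * ‖z‖ / ‖H' (waveNumber z)‖ ^ 2 : ℝ) : ℂ) * s z with hb
  have hbm : Measurable b := Measurable.mul
    (Complex.measurable_ofReal.comp (Measurable.div (by fun_prop) (hHwm.norm.pow_const 2)))
    s.continuous.measurable
  -- the wave numbers that occur on the support of `s` are bounded by `2 R`
  have hlow : ∀ᵐ z ∂planeMeasure, ‖z‖ ≤ R → c ≤ ‖H' (waveNumber z)‖ := by
    filter_upwards [ae_waveNumber hc, ae_waveNumber eH,
      ae_waveNumber (Measure.ae_ne volume 0)] with z h1 h2 h3 h4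
    rw [← h2]
    refine h1 ?_
    rw [abs_waveNumber h3]
    linarith
  have hbb : ∀ᵐ z ∂planeMeasure, ‖b z‖ ≤ M * ‖s z‖ := by
    filter_upwards [hlow] with z h1
    rcases le_or_gt ‖z‖ R with hz | hz
    · have h2 := h1 hz
      have h3 : 0 ≤ R := (norm_nonneg z).trans hz
      rw [hb, norm_mul, Complex.norm_real, Real.norm_of_nonneg (by positivity), hM]
      gcongr
    · simp [hb, hsR z hz]
  have hbL : MemLp b 2 planeMeasure :=
    (s.memLp 2 planeMeasure).of_le_mul hbm.aestronglyMeasurable hbb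
  have hgL : MemLp (fun z => analysisMultiplier G' z * b z) 2 planeMeasure := by
    refine (memLp_analysisMultiplier_mul hGm hGb s).of_le_mul (c := M)
      ((measurable_analysisMultiplier hGm).mul hbm).aestronglyMeasurable ?_
    filter_upwards [hbb] with z hz
    rw [norm_mul (analysisMultiplier G' z) (b z), norm_mul (analysisMultiplier G' z) (s z),
      mul_left_comm]
    exact mul_le_mul_of_nonneg_left hz (norm_nonneg _)
  refine ⟨spectralMap.symm hbL.toLp, quorumLI hgL.toLp, (frameOp_iff_ae hh _ _).2 ?_,
    (mem_closure_analysisGraph hg' hGm hGb _ _).2 ⟨_, ?_, rfl⟩,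
    Filter.Eventually.of_forall fun φ x => ?_⟩
  · rw [spectralMap_toHS, LinearEquiv.apply_symm_apply, LinearIsometryEquiv.apply_symm_apply]
    filter_upwards [coeFn_toLp s 2 planeMeasure, hbL.coeFn_toLp, hlow, ae_waveNumber eH,
      ae_ne_zero_planeMeasure] with z h1 h2 h3 h4 h5
    rw [h1, h2, hb, h4]
    rcases le_or_gt ‖z‖ R with hz | hz
    · have h6 : 0 < ‖H' (waveNumber z)‖ := hc0.trans_le (h3 hz)
      have h7 : 0 < ‖z‖ := norm_pos_iff.2 h5
      have hpi := Real.pi_pos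
      simp only
      rw [← mul_assoc, ← Complex.ofReal_mul, div_mul_div_cancel₀ (by positivity),
        div_self (by positivity), Complex.ofReal_one, one_mul]
    · simp [hsR z hz]
  · rw [LinearIsometryEquiv.apply_symm_apply]
    filter_upwards [hgL.coeFn_toLp, hbL.coeFn_toLp] with z h1 h2
    rw [h1, h2]
  · set r := raySchwartz (symbolEquiv.symm s) φ with hr
    have hrs : ∀ k : ℝ, 2 * R < |k| → r (k / (2 * Real.pi)) = 0 := by
      intro k hk
      rw [hr, raySchwartz_apply, ← symbolEquiv_apply, LinearEquiv.apply_symm_apply]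
      refine hsR _ ?_
      have : |k / (2 * Real.pi)| = |k| / (2 * Real.pi) := by
        rw [abs_div, abs_of_pos (a := 2 * Real.pi) (by positivity)]
      rw [norm_polarMap, this]
      have hpi := Real.pi_pos
      field_simp
      linarith
    have hdom : Integrable fun k : ℝ => C * M / (2 * Real.pi) * ‖r (k / (2 * Real.pi))‖ :=
      (r.integrable.comp_div (by positivity : (2 * Real.pi : ℝ) ≠ 0)).norm.const_mul _
    have hval : ∀ᵐ k : ℝ, symbolIntegrand (fun k => G k / (frameSymbol H (|k| / 2) : ℂ)) x φ
        (symbolEquiv.symm s) k = G' k / ((‖H' k‖ ^ 2 / (Real.pi * (|k| / 2)) : ℝ) : ℂ) *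
          (Complex.exp (-(Complex.I * k * x)) * conj (r (k / (2 * Real.pi))) /
            (2 * Real.pi)) := by
      filter_upwards [eG, eH, he] with k h1 h2 h3
      rw [symbolIntegrand_eq, h1, frameSymbol, mul_div_cancel₀ _ (two_ne_zero' ℝ),
        norm_abs_eq_of_even h3, h2]
    refine hdom.mono' ?_ ?_
    · refine AEStronglyMeasurable.congr ?_ (Filter.EventuallyEq.symm hval)
      have h1 : Continuous fun k : ℝ => Complex.exp (-(Complex.I * k * x)) *
          conj (r (k / (2 * Real.pi))) / (2 * Real.pi) := by
        have := r.continuous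
        fun_prop
      refine AEStronglyMeasurable.mul (Measurable.aestronglyMeasurable ?_) h1.aestronglyMeasurable
      fun_prop
    · filter_upwards [hval, hc, eH] with k h1 h2 h3
      rw [h1]
      rcases le_or_gt |k| (2 * R) with hk | hk
      · have h4 := h2 hk
        rw [h3] at h4
        have h5 : ‖Complex.exp (-(Complex.I * k * x))‖ = 1 := by
          rw [show -(Complex.I * k * x) = ((-(k * x) : ℝ) : ℂ) * Complex.I by push_cast; ring,
            Complex.norm_exp_ofReal_mul_I]
        have h6 : ‖(2 * Real.pi : ℂ)‖ = 2 * Real.pi := by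
          simp [abs_of_pos Real.pi_pos]
        have hpi := Real.pi_pos
        have hC : 0 ≤ C := (norm_nonneg _).trans (hGb 0)
        have hR0 : 0 ≤ R := by linarith [abs_nonneg k]
        rw [norm_mul, norm_div, norm_div, norm_mul, h5, h6, Complex.norm_conj, Complex.norm_real,
          Real.norm_of_nonneg (by positivity), one_mul, div_div_eq_mul_div, hM]
        have h7 : ‖G' k‖ * (Real.pi * (|k| / 2)) / ‖H' k‖ ^ 2 ≤ C * (Real.pi * R / c ^ 2) := by
          rw [← mul_div_assoc C]
          refine div_le_div₀ (by positivity) (mul_le_mul (hGb k) ?_ (by positivity) hC)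
            (by positivity) (pow_le_pow_left₀ hc0.le h4 2)
          exact mul_le_mul_of_nonneg_left (by linarith) hpi.le
        refine (mul_le_mul_of_nonneg_right h7 (by positivity)).trans_eq ?_
        ring
      · simp [hrs k hk]

/-- The operators whose characteristic function is smooth with compact support are dense. -/
theorem dense_isDualTest {h g : 𝓢'(ℝ, ℂ)} {H G : ℝ → ℂ} (hh : HasBoundedFourier h H)
    (he : ∀ᵐ k, ‖H (-k)‖ = ‖H k‖) (hg : HasBoundedFourier g G)
    (hloc : ∀ R : ℝ, ∃ c : ℝ, 0 < c ∧ ∀ᵐ k, |k| ≤ R → c ≤ ‖H k‖) :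
    Dense {A : HS | ∃ K : TestOp, A = toHS K ∧
      (∃ B u, IsDualTest h g (fun k => G k / (frameSymbol H (|k| / 2) : ℂ)) K B u) ∧
      (∃ B u, IsDualTest h h (fun k => H k / (frameSymbol H (|k| / 2) : ℂ)) K B u)} := by
  have hd := (Lp.dense_hasCompactSupport_contDiff (E := ℂ) (F := ℂ) (μ := planeMeasure)
    (p := 2) ENNReal.ofNat_ne_top).preimage spectralMap.toHomeomorph.isOpenMap
  refine hd.mono ?_
  rintro A ⟨f, hf, hfc, hfs⟩
  refine ⟨symbolEquiv.symm (hfc.toSchwartzMap hfs), spectralMap.injective ?_,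
    exists_isDualTest hh he hg hloc hfc, exists_isDualTest hh he hh hloc hfc⟩
  rw [spectralMap_toHS, LinearEquiv.apply_symm_apply]
  exact Lp.ext (hf.trans (coeFn_toLp (hfc.toSchwartzMap hfs) 2 planeMeasure).symm)

/-! ### The Gaussian frame -/

theorem integral_fourierTr_mul {f g : ℝ → ℂ} (hf : Integrable f) (hg : Integrable g) :
    ∫ y, fourierTr f y * g y = ∫ k, f k * fourierTr g k := by
  have hint : Integrable (Function.uncurry fun y k : ℝ => Complex.exp (((y * k : ℝ) : ℂ) *
      Complex.I) * (g y * f k / (2 * Real.pi))) (volume.prod volume) := by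
    refine ((hg.mul_prod hf).div_const _).bdd_mul (c := 1)
      (Continuous.aestronglyMeasurable (by fun_prop)) (Filter.Eventually.of_forall fun p => ?_)
    exact (Complex.norm_exp_ofReal_mul_I _).le
  have h := integral_integral_swap hint
  convert h using 1
  · congr 1 with y
    rw [fourierTr, ← integral_mul_const]
    congr 1 with k
    rw [show Complex.I * k * y = ((y * k : ℝ) : ℂ) * Complex.I by push_cast; ring]
    ring
  · congr 1 with k
    rw [fourierTr, ← integral_const_mul]
    congr 1 with y
    rw [show Complex.I * y * k = ((y * k : ℝ) : ℂ) * Complex.I by push_cast; ring]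
    ring

theorem integrable_gaussian_half {σ : ℝ} (hσ : 0 < σ) :
    Integrable fun k : ℝ => (gaussian σ (k / 2) : ℂ) := by
  refine Integrable.ofReal ?_
  refine ((integrable_exp_neg_mul_sq (b := σ ^ 2 / 8) (by positivity)).const_mul
    √(σ ^ 2 / (2 * Real.pi))).congr (Filter.Eventually.of_forall fun k => ?_)
  beta_reduce
  congr 2
  ring

theorem fourierTr_gaussian {σ : ℝ} (hσ : 0 < σ) (y : ℝ) :
    (√Real.pi : ℂ) * fourierTr (fun k => (gaussian σ (k / 2) : ℂ)) y =
      ((1 / √Real.pi * Real.exp (-(2 * y ^ 2 / σ ^ 2)) : ℝ) : ℂ) := by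
  have hpi := Real.pi_pos
  have hb : 0 < ((σ ^ 2 / 8 : ℝ) : ℂ).re := by
    rw [Complex.ofReal_re]
    positivity
  have h := fourierIntegral_gaussian hb (y : ℂ)
  have h1 : fourierTr (fun k => (gaussian σ (k / 2) : ℂ)) y =
      ((√(σ ^ 2 / (2 * Real.pi)) / (2 * Real.pi) : ℝ) : ℂ) *
        ∫ k : ℝ, Complex.exp (Complex.I * y * k) *
          Complex.exp (-((σ ^ 2 / 8 : ℝ) : ℂ) * (k : ℂ) ^ 2) := by
    rw [fourierTr, ← integral_const_mul]
    congr 1 with k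
    rw [gaussian, show Complex.I * y * k = Complex.I * k * y by ring,
      show -((σ ^ 2 / 8 : ℝ) : ℂ) * (k : ℂ) ^ 2 = ((-(σ ^ 2 * (k / 2) ^ 2 / 2) : ℝ) : ℂ) by
        push_cast; ring]
    push_cast
    ring
  have h2 : ((Real.pi : ℂ) / ((σ ^ 2 / 8 : ℝ) : ℂ)) ^ (1 / 2 : ℂ) =
      ((√(Real.pi / (σ ^ 2 / 8)) : ℝ) : ℂ) := by
    rw [Real.sqrt_eq_rpow, ← Complex.ofReal_div, Complex.ofReal_cpow (by positivity)]
    norm_num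
  have h3 : -(y : ℂ) ^ 2 / (4 * ((σ ^ 2 / 8 : ℝ) : ℂ)) = ((-(2 * y ^ 2 / σ ^ 2) : ℝ) : ℂ) := by
    push_cast
    field_simp
    ring
  have h4 : √Real.pi * (√(σ ^ 2 / (2 * Real.pi)) / (2 * Real.pi) *
      √(Real.pi / (σ ^ 2 / 8))) = 1 / √Real.pi := by
    rw [div_mul_eq_mul_div, ← Real.sqrt_mul (by positivity),
      show σ ^ 2 / (2 * Real.pi) * (Real.pi / (σ ^ 2 / 8)) = 2 ^ 2 by field_simp; norm_num,
      Real.sqrt_sq (by norm_num)]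
    field_simp
    rw [Real.sq_sqrt hpi.le]
  rw [h1, h, h2, h3, ← h4]
  push_cast
  ring

theorem gaussian_ne_zero {σ : ℝ} (hσ : 0 < σ) (t : ℝ) : gaussian σ t ≠ 0 := by
  have := Real.pi_pos
  rw [gaussian]
  positivity

theorem frameSymbol_gaussian {σ : ℝ} (t : ℝ) :
    frameSymbol (fun k => (√Real.pi : ℂ) * (gaussian σ (k / 2) : ℂ)) t =
      σ ^ 2 / (2 * Real.pi * t) * Real.exp (-(σ ^ 2 * t ^ 2)) := by
  have hpi := Real.pi_pos
  rw [frameSymbol, norm_mul, Complex.norm_real, Complex.norm_real, mul_pow,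
    Real.norm_of_nonneg (Real.sqrt_nonneg _), Real.sq_sqrt hpi.le,
    mul_div_mul_left _ _ hpi.ne', Real.norm_eq_abs, sq_abs, gaussian, mul_pow,
    Real.sq_sqrt (by positivity), ← Real.exp_nat_mul, mul_div_cancel_left₀ _ (two_ne_zero' ℝ),
    show ((2 : ℕ) : ℝ) * -(σ ^ 2 * t ^ 2 / 2) = -(σ ^ 2 * t ^ 2) by push_cast; ring]
  rw [div_mul_eq_mul_div, div_mul_eq_mul_div, div_div]

theorem exists_gaussian_frame {σ : ℝ} (hσ : 0 < σ) : ∃ h : 𝓢'(ℝ, ℂ),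
    (∀ θ : 𝓢(ℝ, ℂ),
      h θ = ∫ y : ℝ, ((1 / √Real.pi * Real.exp (-(2 * y ^ 2 / σ ^ 2)) : ℝ) : ℂ) * θ y) ∧
    HasBoundedFourier h (fun k => (√Real.pi : ℂ) * (gaussian σ (k / 2) : ℂ)) ∧
    IsFrame h ∧
    ∀ A C, FrameOp h A C ↔ IsFunctionOf spectralMap (fun z =>
      ((σ ^ 2 / (2 * Real.pi * ‖z‖) * Real.exp (-(σ ^ 2 * ‖z‖ ^ 2)) : ℝ) : ℂ)) A C := by
  have hpi := Real.pi_pos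
  set f : ℝ → ℂ := fun y => ((1 / √Real.pi * Real.exp (-(2 * y ^ 2 / σ ^ 2)) : ℝ) : ℂ) with hf
  have hfi : Integrable f := by
    refine Integrable.ofReal ?_
    refine ((integrable_exp_neg_mul_sq (b := 2 / σ ^ 2) (by positivity)).const_mul
      (1 / √Real.pi)).congr (Filter.Eventually.of_forall fun k => ?_)
    beta_reduce
    congr 2
    ring
  have hfm := memLp_one_iff_integrable.2 hfi
  have hh : ∀ θ : 𝓢(ℝ, ℂ), Lp.toTemperedDistribution hfm.toLp θ = ∫ y, f y * θ y := by
    intro θ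
    rw [Lp.toTemperedDistribution_apply]
    refine integral_congr_ae ?_
    filter_upwards [hfm.coeFn_toLp] with y hy
    rw [hy, smul_eq_mul, mul_comm]
  have hG := integrable_gaussian_half hσ
  have hb : HasBoundedFourier (Lp.toTemperedDistribution hfm.toLp)
      fun k => (√Real.pi : ℂ) * (gaussian σ (k / 2) : ℂ) := by
    refine ⟨memLp_top_of_bound (hG.1.const_mul _) (√Real.pi * √(σ ^ 2 / (2 * Real.pi)))
      (Filter.Eventually.of_forall fun k => ?_), fun θ => ?_⟩
    · rw [norm_mul, Complex.norm_real, Complex.norm_real, Real.norm_of_nonneg (Real.sqrt_nonneg _),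
        gaussian, Real.norm_of_nonneg (by positivity)]
      gcongr
      refine mul_le_of_le_one_right (Real.sqrt_nonneg _) (Real.exp_le_one_iff.2 ?_)
      rw [neg_nonpos]
      positivity
    · rw [hh]
      simp only [hf, ← fourierTr_gaussian hσ, mul_assoc]
      rw [integral_const_mul, integral_const_mul, integral_fourierTr_mul hG θ.integrable]
  refine ⟨_, hh, hb, isFrame_of_ae_ne_zero hb (Filter.Eventually.of_forall fun k => ?_),
    fun A C => ?_⟩
  · refine mul_ne_zero ?_ (Complex.ofReal_ne_zero.2 (gaussian_ne_zero hσ _))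
    exact Complex.ofReal_ne_zero.2 (Real.sqrt_ne_zero'.2 hpi)
  · rw [frameOp_iff_isFunctionOf hb
      (Filter.Eventually.of_forall fun k => by simp [gaussian, neg_div])]
    simp only [frameSymbol_gaussian]

/-! ### Commutators with test operators and with displacements -/

/-- The common form `x + c d/dx` of `a` (for `c = 1/2`) and of `a†` (for `c = -1/2`). -/
def ladder (c : ℂ) : WaveOp := fun u x => x * u x + c * deriv u x

theorem annih_eq_ladder : annih = ladder (1 / 2) := by
  ext u x
  simp only [annih, ladder]
  ring

theorem creat_eq_ladder : creat = ladder (-1 / 2) := by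
  ext u x
  simp only [creat, ladder]
  ring

theorem hasTemperateGrowth_ofReal : Function.HasTemperateGrowth fun x : ℝ => (x : ℂ) :=
  Complex.ofRealCLM.hasTemperateGrowth

/-- `ladder c` as a map of Schwartz functions. -/
def ladderSchwartz (c : ℂ) (u : 𝓢(ℝ, ℂ)) : 𝓢(ℝ, ℂ) :=
  mulSchwartz (fun x : ℝ => (x : ℂ)) u + c • derivCLM ℂ ℂ u

theorem ladder_schwartz (c : ℂ) (u : 𝓢(ℝ, ℂ)) : ladder c u = ladderSchwartz c u := by
  ext x
  rw [ladder, ← mulSchwartz_apply hasTemperateGrowth_ofReal]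
  rfl

theorem integrable_kernel_mul (K : TestOp) (u : 𝓢(ℝ, ℂ)) (x : ℝ) :
    Integrable fun y => K (x, y) * u y := by
  obtain ⟨D, -, hD⟩ := K.decay 0 0
  refine u.integrable.bdd_mul (c := D) ?_ (Filter.Eventually.of_forall fun y => ?_)
  · have := K.continuous
    exact Continuous.aestronglyMeasurable (by fun_prop)
  · simpa using hD (x, y)

theorem hasDerivAt_kernelOp (K : TestOp) (u : 𝓢(ℝ, ℂ)) (x : ℝ) :
    HasDerivAt (kernelOp K u) (kernelOp (dirDeriv (1, 0) K) u x) x := by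
  obtain ⟨D, -, hD⟩ := (dirDeriv (1, 0) K).decay 0 0
  refine (hasDerivAt_integral_of_dominated_loc_of_deriv_le (F := fun x y => K (x, y) * u y)
    (F' := fun x y => dirDeriv (1, 0) K (x, y) * u y) (bound := fun y => D * ‖u y‖)
    (s := Set.univ) Filter.univ_mem
    (Filter.Eventually.of_forall fun x => (integrable_kernel_mul K u x).1)
    (integrable_kernel_mul K u x) (integrable_kernel_mul _ u x).1
    (Filter.Eventually.of_forall fun y x _ => ?_) (u.integrable.norm.const_mul D)
    (Filter.Eventually.of_forall fun y x _ => ?_)).2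
  · rw [norm_mul]
    gcongr
    simpa using hD (x, y)
  · exact (deriv_fst_schwartz K (x, y)).mul_const _

theorem kernelOp_dirDeriv_snd (K : TestOp) (u : 𝓢(ℝ, ℂ)) (x : ℝ) :
    kernelOp (dirDeriv (0, 1) K) u x = -kernelOp K (derivCLM ℂ ℂ u) x := by
  rw [kernelOp, kernelOp, ← integral_neg]
  have h := integral_mul_deriv_eq_deriv_mul_of_integrable
    (u := fun y => K (x, y)) (u' := fun y => dirDeriv (0, 1) K (x, y)) (v := u)
    (v' := derivCLM ℂ ℂ u) (fun y _ => deriv_snd_schwartz K (x, y))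
    (fun y _ => u.differentiableAt.hasDerivAt) (integrable_kernel_mul K _ x)
    (integrable_kernel_mul _ u x) (integrable_kernel_mul K u x)
  rw [integral_neg, h, neg_neg]

/-- `a - b†` and `a† - b` act on kernels as commutators with `a` and `a†` act on operators. -/
theorem kernelOp_modeSchwartz (c : ℂ) (K : TestOp) (u : 𝓢(ℝ, ℂ)) (x : ℝ) :
    kernelOp (modeSchwartz c K) u x = opComm (ladder c) (kernelOp K) u x := by
  have h1 : kernelOp K (ladderSchwartz c u) x = ∫ y, K (x, y) * (y * u y) + c *
      (K (x, y) * derivCLM ℂ ℂ u y) := by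
    rw [kernelOp]
    congr 1 with y
    rw [← ladder_schwartz, ladder]
    change K (x, y) * (y * u y + c * deriv u y) = K (x, y) * (y * u y) + c * (K (x, y) * deriv u y)
    ring
  have i1 : Integrable fun y : ℝ => K (x, y) * (y * u y) := by
    refine (integrable_kernel_mul K (mulSchwartz (fun x : ℝ => (x : ℂ)) u) x).congr
      (Filter.Eventually.of_forall fun y => ?_)
    simp only [mulSchwartz_apply hasTemperateGrowth_ofReal]
  have i2 := (integrable_kernel_mul K (derivCLM ℂ ℂ u) x).const_mul c
  have i3 := (integrable_kernel_mul K u x).const_mul (x : ℂ)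
  have i4 := (integrable_kernel_mul (dirDeriv (1, 0) K) u x).const_mul c
  have i5 := (integrable_kernel_mul (dirDeriv (0, 1) K) u x).const_mul c
  have i6 : Integrable fun y : ℝ => x * (K (x, y) * u y) - K (x, y) * (y * u y) := i3.sub i1
  have i7 : Integrable fun y : ℝ => (x * (K (x, y) * u y) - K (x, y) * (y * u y)) +
      c * (dirDeriv (1, 0) K (x, y) * u y) := i6.add i4
  have h2 : kernelOp (modeSchwartz c K) u x = ∫ y, ((x * (K (x, y) * u y) - K (x, y) * (y * u y)) +
      c * (dirDeriv (1, 0) K (x, y) * u y)) + c * (dirDeriv (0, 1) K (x, y) * u y) := by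
    rw [kernelOp]
    congr 1 with y
    rw [modeSchwartz_apply]
    ring
  have h3 := kernelOp_dirDeriv_snd K u x
  have h4 := (hasDerivAt_kernelOp K u x).deriv
  simp only [kernelOp] at h3 h4
  rw [opComm, ladder_schwartz, h1, h2, integral_add i7 i5,
    integral_add i6 i4, integral_sub i3 i1, integral_add i1 i2, ladder,
    integral_const_mul, integral_const_mul, integral_const_mul, integral_const_mul, h3]
  simp only [kernelOp]
  rw [h4]
  ring

theorem opComm_ladder_kernelOp (c : ℂ) (K : TestOp) (u : 𝓢(ℝ, ℂ)) :
    opComm (ladder c) (kernelOp K) u = kernelOp (modeSchwartz c K) u :=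
  funext fun x => (kernelOp_modeSchwartz c K u x).symm

theorem opComm_opComm_ladder_kernelOp (c d : ℂ) (K : TestOp) (u : 𝓢(ℝ, ℂ)) (x : ℝ) :
    opComm (ladder c) (opComm (ladder d) (kernelOp K)) u x =
      kernelOp (modeSchwartz c (modeSchwartz d K)) u x := by
  change ladder c (opComm (ladder d) (kernelOp K) u) x -
    opComm (ladder d) (kernelOp K) (ladder c u) x = _
  rw [opComm_ladder_kernelOp, ladder_schwartz c u, opComm_ladder_kernelOp,
    kernelOp_modeSchwartz c, ← ladder_schwartz]
  rfl

theorem ladder_sub {c : ℂ} {f g : ℝ → ℂ} {x : ℝ} (hf : DifferentiableAt ℝ f x)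
    (hg : DifferentiableAt ℝ g x) :
    ladder c (fun y => f y - g y) x = ladder c f x - ladder c g x := by
  simp only [ladder]
  rw [deriv_fun_sub hf hg]
  ring

theorem hasDerivAt_ladder {c : ℂ} {f f₁ f₂ : ℝ → ℂ} (h₁ : ∀ x, HasDerivAt f (f₁ x) x)
    (h₂ : ∀ x, HasDerivAt f₁ (f₂ x) x) (x : ℝ) :
    HasDerivAt (ladder c f) (f x + x * f₁ x + c * f₂ x) x := by
  have h : ladder c f = fun x : ℝ => (x : ℂ) * f x + c * f₁ x := by
    ext x
    rw [ladder, (h₁ x).deriv]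
  have hx : HasDerivAt (fun x : ℝ => (x : ℂ)) 1 x := Complex.ofRealCLM.hasDerivAt
  rw [h]
  exact ((hx.mul (h₁ x)).add ((h₂ x).const_mul c)).congr_deriv (by ring)

/-- The canonical commutation relation `[a, a†] = 1`. -/
theorem annih_creat {f f₁ f₂ : ℝ → ℂ} (h₁ : ∀ x, HasDerivAt f (f₁ x) x)
    (h₂ : ∀ x, HasDerivAt f₁ (f₂ x) x) (x : ℝ) :
    annih (creat f) x = creat (annih f) x + f x := by
  rw [annih_eq_ladder, creat_eq_ladder, ladder, (hasDerivAt_ladder h₁ h₂ x).deriv,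
    ladder.eq_1 (-1 / 2) (ladder _ _), (hasDerivAt_ladder h₁ h₂ x).deriv, ladder, ladder,
    (h₁ x).deriv]
  ring

/-- Expanding both sides, the difference is a multiple of `[a, a†] A - A [a, a†] = 0`. -/
theorem opComm_opComm_eq_lindblad (K : TestOp) (u : 𝓢(ℝ, ℂ)) (x : ℝ) :
    opComm creat (opComm annih (kernelOp K)) u x =
      -(lindblad annih creat (kernelOp K) u x + lindblad creat annih (kernelOp K) u x) := by
  have h₁ := hasDerivAt_kernelOp K u
  have h₂ := hasDerivAt_kernelOp (dirDeriv (1, 0) K) u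
  have c1 := annih_creat h₁ h₂ x
  have e1 : creat (fun y => annih (kernelOp K u) y - kernelOp K (annih u) y) x =
      creat (annih (kernelOp K u)) x - creat (kernelOp K (annih u)) x := by
    rw [creat_eq_ladder, annih_eq_ladder]
    refine ladder_sub (hasDerivAt_ladder h₁ h₂ x).differentiableAt ?_
    rw [ladder_schwartz]
    exact (hasDerivAt_kernelOp K _ x).differentiableAt
  have e2 : kernelOp K (annih (creat u)) x = kernelOp K (creat (annih u)) x + kernelOp K u x := by
    have h : annih (creat u) = fun y => creat (annih u) y + u y := by
      ext y
      exact annih_creat (f₁ := derivCLM ℂ ℂ u) (f₂ := derivCLM ℂ ℂ (derivCLM ℂ ℂ u))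
        (fun x => u.differentiableAt.hasDerivAt)
        (fun x => (derivCLM ℂ ℂ u).differentiableAt.hasDerivAt) y
    rw [h]
    have i1 := integrable_kernel_mul K (ladderSchwartz (-1 / 2) (ladderSchwartz (1 / 2) u)) x
    rw [← ladder_schwartz, ← ladder_schwartz, ← creat_eq_ladder, ← annih_eq_ladder] at i1
    simp only [kernelOp, mul_add]
    exact integral_add i1 (integrable_kernel_mul K u x)
  have e3 : opComm creat (opComm annih (kernelOp K)) u x =
      creat (fun y => annih (kernelOp K u) y - kernelOp K (annih u) y) x -
        (annih (kernelOp K (creat u)) x - kernelOp K (annih (creat u)) x) := rfl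
  rw [e3, e1, lindblad, lindblad, e2]
  linear_combination -(1 / 2) * c1

theorem hasDerivAt_displace (z : ℂ) {f f₁ : ℝ → ℂ} (h : ∀ x, HasDerivAt f (f₁ x) x) (x : ℝ) :
    HasDerivAt (displace z f) (2 * z.im * Complex.I * displace z f x + displace z f₁ x) x := by
  have h1 : HasDerivAt (fun x : ℝ => ((2 * z.im * x - z.re * z.im : ℝ) : ℂ))
      ((2 * z.im : ℝ) : ℂ) x :=
    ((((hasDerivAt_id x).const_mul (2 * z.im)).sub_const (z.re * z.im)).congr_deriv
      (mul_one _)).ofReal_comp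
  have h2 := ((h1.const_mul Complex.I).cexp).mul ((h (x - z.re)).comp_sub_const x z.re)
  refine h2.congr_deriv ?_
  simp only [displace]
  push_cast
  ring

/-- `[a, D(z)] = z D(z)` for `c = 1/2`, and `[a†, D(z)] = z̄ D(z)` for `c = -1/2`. -/
theorem opComm_ladder_displace (c z : ℂ) {f f₁ : ℝ → ℂ} (h : ∀ x, HasDerivAt f (f₁ x) x) (x : ℝ) :
    opComm (ladder c) (displace z) f x = (z.re + 2 * c * z.im * Complex.I) * displace z f x := by
  have h1 : deriv f = f₁ := funext fun x => (h x).deriv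
  simp only [opComm, ladder, (hasDerivAt_displace z h x).deriv, h1, displace]
  push_cast
  ring

theorem opComm_opComm_quadratureExp (k φ : ℝ) (u : 𝓢(ℝ, ℂ)) (x : ℝ) :
    opComm creat (opComm annih (quadratureExp k φ)) u x =
      (k ^ 2 / 4 : ℝ) * quadratureExp k φ u x := by
  set z : ℂ := Complex.I * k * Complex.exp (Complex.I * φ) / 2 with hz
  have hu : ∀ x, HasDerivAt u (derivCLM ℂ ℂ u x) x := fun x => u.differentiableAt.hasDerivAt
  have h1 : ∀ v : 𝓢(ℝ, ℂ), opComm (ladder (1 / 2)) (displace z) v =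
      fun x => z * displace z v x := by
    intro v
    ext x
    rw [opComm_ladder_displace _ z (f₁ := derivCLM ℂ ℂ v) fun x => v.differentiableAt.hasDerivAt]
    congr 1
    apply Complex.ext <;> simp
  have h2 : ladder (-1 / 2) (fun x => z * displace z u x) x =
      z * ladder (-1 / 2) (displace z u) x := by
    simp only [ladder]
    rw [deriv_const_mul _ (hasDerivAt_displace z hu x).differentiableAt]
    ring
  have h3 := opComm_ladder_displace (-1 / 2) z hu x
  have h4 : (z.re + 2 * (-1 / 2) * z.im * Complex.I) = conj z := by
    apply Complex.ext <;> simp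
    ring
  have h5 : z * conj z = ((k ^ 2 / 4 : ℝ) : ℂ) := by
    rw [Complex.mul_conj, Complex.normSq_eq_norm_sq, hz]
    congr 1
    rw [norm_div, norm_mul, norm_mul, Complex.norm_I, mul_comm Complex.I (φ : ℂ),
      Complex.norm_exp_ofReal_mul_I, Complex.norm_real, Real.norm_eq_abs]
    simp [div_pow]
    norm_num
  have h6 : opComm creat (opComm annih (quadratureExp k φ)) u x =
      creat (opComm annih (displace z) u) x - opComm annih (displace z) (creat u) x := rfl
  rw [h4, opComm] at h3
  rw [h6, annih_eq_ladder, creat_eq_ladder, h1, ladder_schwartz, h1, h2, ← ladder_schwartz,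
    ← mul_sub, h3, ← mul_assoc, h5]
  rfl

theorem exists_modeZdag_modeZ (K : TestOp) : ∃ C : HS, ⇑C =ᵐ[volume] modeZdag (modeZ K) ∧
    IsFunctionOf spectralMap (fun z => (‖z‖ : ℂ) ^ 2) (toHS K) C := by
  have h : modeZdag (modeZ K) = modeSchwartz (-1 / 2) (modeSchwartz (1 / 2) K) := by
    rw [modeZ_schwartz, modeZdag_schwartz]
  refine ⟨toHS (modeSchwartz (-1 / 2) (modeSchwartz (1 / 2) K)), ?_, ?_⟩
  · rw [h]
    exact coeFn_toLp _ 2 volume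
  · filter_upwards [spectralMap_toHS_ae K,
      spectralMap_toHS_ae (modeSchwartz (-1 / 2) (modeSchwartz (1 / 2) K))] with z h1 h2
    rw [h1, h2, ← modeZdag_schwartz, charFn_modeZdag, ← modeZ_schwartz, charFn_modeZ, ← mul_assoc,
      Complex.conj_mul']

end HomodyneFrames

end

theorem mainTheorem10 :
    -- the operators `D(z)` diagonalize the normal operator `a - b†`
    ∃ W : HS ≃ₗᵢ[ℂ] Lp ℂ 2 planeMeasure,
      (∀ K : TestOp, ⇑(W (toHS K))
        =ᵐ[planeMeasure] charFn K) ∧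
      IsSpectralRep modeZGraph planeMeasure W ∧
      -- `|a - b†|²` acts as the double opComm, and as a Lindblad super-operator
      (∀ K : TestOp, ∃ C : HS,
        ⇑C =ᵐ[volume] modeZdag (modeZ K) ∧
        IsFunctionOf W (fun z => (‖z‖ : ℂ) ^ 2) (toHS K) C) ∧
      (∀ (K : TestOp) (u : 𝓢(ℝ, ℂ)) (x : ℝ),
        kernelOp (modeZ K) u x =
          opComm annih (kernelOp K) u x ∧
        kernelOp (modeZdag (modeZ K)) u x =
          opComm creat
            (opComm annih (kernelOp K)) u x ∧
        opComm creat
            (opComm annih (kernelOp K)) u x =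
          -(lindblad annih creat
              (kernelOp K) u x +
            lindblad creat annih
              (kernelOp K) u x)) ∧
      (∀ (k φ : ℝ) (u : 𝓢(ℝ, ℂ)) (x : ℝ),
        opComm creat
            (opComm annih (quadratureExp k φ)) u x =
          (k ^ 2 / 4 : ℝ) * quadratureExp k φ u x) ∧
      -- the quadrature densities of test operators are Schwartz functions, and their Fourier
      -- transforms are `Tr[exp(i k X_φ)† A]`
      (∀ (K : TestOp) (φ : ℝ),
        (∃ s : 𝓢(ℝ, ℂ), ⇑s = quadratureDensity φ K) ∧
        ∀ k : ℝ, ∫ y : ℝ, Complex.exp (-(Complex.I * k * y)) * quadratureDensity φ K y =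
          charFn K (Complex.I * k * Complex.exp (Complex.I * φ) / 2)) ∧
      -- a bounded and invertible Fourier transform gives a frame
      (∀ (h : 𝓢'(ℝ, ℂ)) (H : ℝ → ℂ), HasBoundedFourier h H →
        (∀ᵐ k, H k ≠ 0) → IsFrame h) ∧
      -- Fourier transforms with the same modulus give the same frame operator
      (∀ (h h' : 𝓢'(ℝ, ℂ)) (H H' : ℝ → ℂ), HasBoundedFourier h H →
        HasBoundedFourier h' H' → (∀ᵐ k, ‖H k‖ = ‖H' k‖) →
        ∀ A C, FrameOp h A C ↔ FrameOp h' A C) ∧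
      -- the frame operator is `f(|a - b†|)`
      (∀ (h : 𝓢'(ℝ, ℂ)) (H : ℝ → ℂ), HasBoundedFourier h H →
        (∀ᵐ k, ‖H (-k)‖ = ‖H k‖) →
        ∀ A C, FrameOp h A C ↔
          IsFunctionOf W (fun z => (frameSymbol H ‖z‖ : ℂ)) A C) ∧
      -- the frame that is generated by `g(|a - b†|)`, with `|t| f(|t|) = |g(t)|²`
      (∀ (h : 𝓢'(ℝ, ℂ)) (g : ℝ → ℂ),
        HasBoundedFourier h (fun k => (√Real.pi : ℂ) * g (|k| / 2)) →
        ∀ A C, FrameOp h A C ↔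
          IsFunctionOf W (fun z => ((‖g ‖z‖‖ ^ 2 / ‖z‖ : ℝ) : ℂ)) A C) ∧
      -- the inverse of the frame operator and the canonical dual
      (∀ (h : 𝓢'(ℝ, ℂ)) (H : ℝ → ℂ), HasBoundedFourier h H →
        (∀ᵐ k, H k ≠ 0) → (∀ᵐ k, ‖H (-k)‖ = ‖H k‖) →
        FrameInverseEq h diracDelta
          (fun k => 1 / (frameSymbol H (|k| / 2) : ℂ)) ∧
        FrameInverseEq h h
          (fun k => H k / (frameSymbol H (|k| / 2) : ℂ)) ∧
        (∀ (K L : TestOp) (B : HS) (u : Coeffs),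
          IsDualTest h h
            (fun k => H k / (frameSymbol H (|k| / 2) : ℂ)) K B u →
          Integrable (fun q : ℝ × ℝ => conj (frameCoeff h q.2 q.1 L) *
            symbolCoeff
              (fun k => H k / (frameSymbol H (|k| / 2) : ℂ)) q.2 q.1 K)
            quorumMeasure ∧
          inner ℂ (toHS L) (toHS K) =
            ∫ q : ℝ × ℝ, conj (frameCoeff h q.2 q.1 L) *
              symbolCoeff
                (fun k => H k / (frameSymbol H (|k| / 2) : ℂ)) q.2 q.1 K
              ∂quorumMeasure) ∧
        ((∀ R : ℝ, ∃ c : ℝ, 0 < c ∧ ∀ᵐ k, |k| ≤ R → c ≤ ‖H k‖) →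
          Dense {A : HS | ∃ K : TestOp, A = toHS K ∧
            (∃ B u, IsDualTest h diracDelta
              (fun k => 1 / (frameSymbol H (|k| / 2) : ℂ)) K B u) ∧
            (∃ B u, IsDualTest h h
              (fun k => H k / (frameSymbol H (|k| / 2) : ℂ)) K B u)})) ∧
      -- the Gaussian example
      (∀ σ : ℝ, 0 < σ →
        (∀ y : ℝ, (√Real.pi : ℂ) *
            fourierTr (fun k => (gaussian σ (k / 2) : ℂ)) y =
          ((1 / √Real.pi * Real.exp (-(2 * y ^ 2 / σ ^ 2)) : ℝ) : ℂ)) ∧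
        ∃ h : 𝓢'(ℝ, ℂ),
          (∀ θ : 𝓢(ℝ, ℂ),
            h θ = ∫ y : ℝ, ((1 / √Real.pi * Real.exp (-(2 * y ^ 2 / σ ^ 2)) : ℝ) : ℂ) * θ y) ∧
          HasBoundedFourier h
            (fun k => (√Real.pi : ℂ) * (gaussian σ (k / 2) : ℂ)) ∧
          IsFrame h ∧
          ∀ A C, FrameOp h A C ↔
            IsFunctionOf W (fun z =>
              ((σ ^ 2 / (2 * Real.pi * ‖z‖) * Real.exp (-(σ ^ 2 * ‖z‖ ^ 2)) : ℝ) : ℂ)) A C) := by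
  refine ⟨spectralMap, spectralMap_toHS_ae, isSpectralRep_spectralMap, exists_modeZdag_modeZ,
    fun K u x => ⟨?_, ?_, opComm_opComm_eq_lindblad K u x⟩, opComm_opComm_quadratureExp,
    fun K φ => ⟨⟨_, (quadratureDensity_eq K φ).symm⟩, fun k => ?_⟩,
    fun h H hh hne => isFrame_of_ae_ne_zero hh hne,
    fun h h' H H' hh hh' e => frameOp_iff_of_norm_eq hh hh' e,
    fun h H hh he => frameOp_iff_isFunctionOf hh he,
    fun h g hh => frameOp_iff_isFunctionOf_abs hh,
    fun h H hh hne he => ⟨frameInverseEq hh hne he hasBoundedFourier_diracDelta,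
      frameInverseEq hh hne he hh,
      fun K L B u hd => inner_eq_integral_dual hh (frameInverseEq hh hne he hh) L hd,
      dense_isDualTest hh he hasBoundedFourier_diracDelta⟩,
    fun σ hσ => ⟨fourierTr_gaussian hσ, exists_gaussian_frame hσ⟩⟩
  · rw [modeZ_schwartz, annih_eq_ladder, kernelOp_modeSchwartz]
  · rw [modeZ_schwartz, modeZdag_schwartz, annih_eq_ladder, creat_eq_ladder,
      opComm_opComm_ladder_kernelOp]
  · rw [integral_exp_mul_quadratureDensity, raySchwartz_div]
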